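/- Conventions. For probability laws $P,Q$ on $\mathbb R$ let $d_{\mathrm{Kol}}(P,Q)=\sup_{x\in\mathbb R}|P((-\infty,x])-Q((-\infty,x])|$; for a random variable we use its law. A graph on $\{1,\dots,n\}$ is a dependency graph of $(X_k)_{1\le k\le n}$ if $(X_k)_{k\in A}$ and $(X_k)_{k\in B}$ are independent whenever $A,B\subset\{1,\dots,n\}$ are disjoint and no edge joins $A$ to $B$. Let $\nu\in(0,\infty)$, $\delta>4$, $\tilde\delta=\delta/2$ and $K>0$. For $n\ge 1$ and times $0=t_0<t_1<\dots<t_n$ put $\kappa_k=t_k-t_{k-1}$. Let $(X_k)_{1\le k\le n}$ be real random variables with a dependency graph of maximal degree (at most) $m$, such that $\mathbb E[X_k]=0$, $\operatorname{Var}[X_k]=\nu\kappa_k$ and $X_k\in L^\delta$ for every $k$. Define the least-squares estimators $$\hat{\mathfrak e}_n=\frac1{t_n}\sum_{k=1}^nX_k,\qquad \hat\nu_n=\frac1n\sum_{k=1}^n\frac{X_k^2}{\kappa_k}-\frac{t_n}{n}\,\hat{\mathfrak e}_n^{\,2},$$ and $$\mathcal T=\frac{2^{\frac{\delta-1}2}}{n}\sum_{i=1}^n\Big(\kappa_i^\delta+\frac12\Big(\frac{t_n}{n}\Big)^\delta\Big)\,\mathbb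 E\Big[\Big|\frac{X_i}{\kappa_i}\Big|^\delta\Big].$$ (1) Let $n\ge1$ and assume $\operatorname{Var}[\hat\nu_n]\ge K^2/n$. If $\delta\in(4,6)$, then $$d_{\mathrm{Kol}}\Big(\tfrac{\hat\nu_n-\nu}{\sqrt{\operatorname{Var}[\hat\nu_n]}},\mathcal N(0,1)\Big)\le 8.015\Big(\frac{n}{Kt_n}\Big)^{\frac{\tilde\delta}{\tilde\delta+1}}\mathcal T^{\frac1{\tilde\delta+1}}(4(m+1))^{\frac{\tilde\delta-1}{\tilde\delta+1}}n^{-\frac{\tilde\delta-2}{2(\tilde\delta+1)}}.$$ If $\delta\in[6,\infty)$, then $$d_{\mathrm{Kol}}\Big(\tfrac{\hat\nu_n-\nu}{\sqrt{\operatorname{Var}[\hat\nu_n]}},\mathcal N(0,1)\Big)\le\max\Big\{18.96\Big(\frac{n}{Kt_n}\Big)^{\frac{\tilde\delta}{\tilde\delta+1}}\mathcal T^{\frac1{\tilde\delta+1}}(4(m+1))^{\frac{\tilde\delta-1}{\tilde\delta+1}}n^{-\frac{\tilde\delta-2}{2(\tilde\delta+1)}},\ 227.5\Big(\frac{n}{Kt_n}\Big)^{3}\mathcal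 T^{\frac3{\tilde\delta}}\frac{(4(m+1))^2}{\sqrt n}\Big\}.$$ (2) Suppose that for every $n$ such times $t^{(n)}$ and random variables $X^{(n)}$ are given (the times, the random variables, their probability space and the degree $m=m(n)$ may depend on $n$, while $\nu$, $\delta$ and $K$ do not), and that $\operatorname{Var}[\hat\nu_n]\ge K^2/n$ for all sufficiently large $n$. Write $\mathcal T_n$ for the corresponding $\mathcal T$ and $t_n$ for the final time $t^{(n)}_n$. Assume $\limsup_{n\to\infty}\mathcal T_n<\infty$ and $\limsup_{n\to\infty}n/t_n<\infty$. If either $\delta\in(4,6)$ and $m(n)+1=o\big(n^{\frac{\tilde\delta-2}{2\tilde\delta-2}}\big)$, or $\delta\in[6,\infty)$ and $m(n)+1=o(n^{1/4})$, then $$\frac{\hat\nu_n-\nu}{\sqrt{\operatorname{Var}[\hat\nu_n]}}\longrightarrow\mathcal N(0,1)\quad\text{in distribution as }n\to\infty.$$ -/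

import Mathlib

open MeasureTheory ProbabilityTheory Filter Asymptotics
open scoped Topology ENNReal

noncomputable section

/-- Kolmogorov distance between two laws on the real line. -/
def kolmogorovDist (P Q : Measure ℝ) : ℝ :=
  ⨆ x : ℝ, |P.real (Set.Iic x) - Q.real (Set.Iic x)|

/-- `G` is a dependency graph of the family `Y` under `μ`: whenever two disjoint sets of indices
are not joined by any edge of `G`, the two corresponding subfamilies are independent. -/
def IsDependencyGraph {ι Ω : Type*} [MeasurableSpace Ω] (G : SimpleGraph ι)
    (Y : ι → Ω → ℝ) (μ : Measure Ω) : Prop :=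
  ∀ A B : Set ι, Disjoint A B → (∀ i ∈ A, ∀ j ∈ B, ¬ G.Adj i j) →
    IndepFun (fun ω (i : A) => Y i ω) (fun ω (j : B) => Y j ω) μ

/-- The `i`-th time step `κ i = t (i + 1) - t i` of a finite sequence of times
`t 0, …, t n`; the index `i : Fin n` stands for `i + 1 ∈ {1, …, n}`. -/
def timeStep {n : ℕ} (t : Fin (n + 1) → ℝ) (i : Fin n) : ℝ :=
  t i.succ - t i.castSucc

/-- The final time `t n`. -/
def finalTime {n : ℕ} (t : Fin (n + 1) → ℝ) : ℝ := t (Fin.last n)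

/-- The least squares estimator of the drift, `(1 / t_n) ∑ X_k`. -/
def driftEstimator {Ω : Type*} {n : ℕ} (t : Fin (n + 1) → ℝ) (X : Fin n → Ω → ℝ) (ω : Ω) : ℝ :=
  (1 / finalTime t) * ∑ k, X k ω

/-- The least squares estimator of the volatility,
`(1 / n) ∑ X_k ^ 2 / κ_k - (t_n / n) * (drift estimator) ^ 2`. -/
def volEstimator {Ω : Type*} {n : ℕ} (t : Fin (n + 1) → ℝ) (X : Fin n → Ω → ℝ) (ω : Ω) : ℝ :=
  (1 / (n : ℝ)) * ∑ k, X k ω ^ 2 / timeStep t k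
    - (finalTime t / n) * driftEstimator t X ω ^ 2

/-- The estimation error of the volatility estimator divided by its standard deviation,
`(ν̂_n - ν) / √(Var ν̂_n)`. -/
def normalizedVolError {Ω : Type*} [MeasurableSpace Ω] (μ : Measure Ω) {n : ℕ} (ν : ℝ)
    (t : Fin (n + 1) → ℝ) (X : Fin n → Ω → ℝ) (ω : Ω) : ℝ :=
  (volEstimator t X ω - ν) / √(Var[volEstimator t X; μ])

/-- The quantity
`2 ^ ((δ - 1) / 2) / n * ∑ (κ_i ^ δ + (1 / 2) (t_n / n) ^ δ) * E |X_i / κ_i| ^ δ`. -/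
def momentFunctional {Ω : Type*} [MeasurableSpace Ω] (μ : Measure Ω) {n : ℕ} (δ : ℝ)
    (t : Fin (n + 1) → ℝ) (X : Fin n → Ω → ℝ) : ℝ :=
  (2 : ℝ) ^ ((δ - 1) / 2) / n *
    ∑ i, (timeStep t i ^ δ + 1 / 2 * (finalTime t / n) ^ δ) *
      ∫ ω, |X i ω / timeStep t i| ^ δ ∂μ

/-- The standing assumptions on the times and on the centred returns: `0 = t_0 < ⋯ < t_n`, and the
random variables `X_k` are centred, have variance `ν κ_k`, lie in `L ^ δ`, and have a dependency
graph of maximal degree at most `m`. -/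
structure IsReturnModel {Ω : Type*} [MeasurableSpace Ω] (μ : Measure Ω) {n : ℕ} (ν δ : ℝ)
    (t : Fin (n + 1) → ℝ) (X : Fin n → Ω → ℝ) (m : ℕ) : Prop where
  time_zero : t 0 = 0
  time_strictMono : StrictMono t
  measurable : ∀ k, Measurable (X k)
  memLp : ∀ k, MemLp (X k) (ENNReal.ofReal δ) μ
  mean : ∀ k, ∫ ω, X k ω ∂μ = 0
  variance : ∀ k, Var[X k; μ] = ν * timeStep t k
  dependency : ∃ G : SimpleGraph (Fin n), IsDependencyGraph G X μ ∧
    ∀ k, (G.neighborSet k).ncard ≤ m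

end

/-!
Bounds for the distance between the normalized volatility estimator and the normal law, by Stein's
method for sums with a dependency graph.

The estimator is a quadratic form: up to the factor `n * t_n` it is the sum over all pairs `(i,
j)` of `pairTerm t X (i, j) = t_n / n * X_i ^ 2 / κ_i - X_i * X_j`. Two such terms are dependent
only if an index of one pair equals, or is adjacent to, an index of the other, so the `n ^ 2`
summands have a dependency graph whose closed neighbourhoods have at most `D = 4 * (m + 1) * n`
elements (`isDependencyGraph_pairGraph`, `card_nbhd_pairGraph_le`). Their averaged `p`-th moments,
`p = δ / 2`, are bounded by `momentFunctional` (`sum_integral_pairTerm_le`). Centring and dividing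
by the standard deviation gives `normTerm`, whose sum has variance one. The normalized error is
this sum plus a deterministic bias, which is at most a tenth of the rate after multiplication by
the maximum of the normal density (`IsReturnModel.abs_integral_volEstimator_sub_le`,
`bias_scale_le`).

For a sum `U` with unit variance the indicator of `(-∞, z]` is replaced by the function `ramp z h`,
which is linear on an interval of length `h`; this costs `0.2 * h` (`kolmogorovDist_le_of_ramp`).
The solution `f` of `f' x - x * f x = ramp z h x - E ramp z h Z` is bounded by `1.26`, its
derivative by `1`, and the derivative is Lipschitz with constant `2.52 / h` if `h ≤ 1`. Expanding
`E (f' U - U * f U)` along the dependency graph (`abs_integral_stein_le`) leaves increments of `f'`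
over the contribution of a neighbourhood.

* For `2 < p ≤ 3` the increments are estimated by interpolation with Hölder exponent `p - 2`, and
  `h` is taken to be the rate itself (`kolmogorovDist_sum_le`).
* For `p ≥ 3` the Lipschitz constant `1 / h` is only needed when the sum lies near `[z, z + h]`. The
  probability of this event is at most `0.4` times the length of the interval plus twice the
  Kolmogorov distance `d` under investigation. This yields an inequality for `d` with `d` on both
  sides (`abs_integral_ramp_sub_le_bootstrap`), from which `d` is bounded once `h` is a suitable
  multiple of the third-moment term (`kolmogorovDist_sum_le_bootstrap`). Products of four dependent
  factors and their decoupled versions are estimated by Young's inequality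
  (`decoupled_young_four`), so that only the individual `p`-th moments enter.

Bounds exceeding one are trivial, which is why the rates may be assumed small. The central limit
theorem follows because the rates tend to zero and Kolmogorov convergence implies weak convergence
(`tendsto_of_tendsto_kolmogorovDist`).
-/

noncomputable section

/-! ### The Gaussian weight and Mills' ratio -/

/-- The unnormalised standard Gaussian density `exp (-x ^ 2 / 2)`. -/
def gaussWeight (x : ℝ) : ℝ := Real.exp (-(1 / 2) * x ^ 2)

/-- The unnormalised upper tail `∫_x^∞ exp (-t ^ 2 / 2) dt` of the standard Gaussian law. -/
def gaussTail (x : ℝ) : ℝ := ∫ t in Set.Ioi x, gaussWeight t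

lemma gaussWeight_pos (x : ℝ) : 0 < gaussWeight x := Real.exp_pos _

lemma gaussWeight_neg (x : ℝ) : gaussWeight (-x) = gaussWeight x := by simp [gaussWeight]

lemma gaussWeight_le_one (x : ℝ) : gaussWeight x ≤ 1 :=
  Real.exp_le_one_iff.2 (by nlinarith [sq_nonneg x])

lemma continuous_gaussWeight : Continuous gaussWeight := by unfold gaussWeight; fun_prop

lemma integrable_gaussWeight : Integrable gaussWeight :=
  integrable_exp_neg_mul_sq (b := 1 / 2) (by norm_num)

lemma hasDerivAt_gaussWeight (x : ℝ) : HasDerivAt gaussWeight (-x * gaussWeight x) x := by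
  have h : HasDerivAt (fun y : ℝ => -(1 / 2) * y ^ 2) (-x) x := by
    refine (((hasDerivAt_id x).pow 2).const_mul (-(1 / 2) : ℝ)).congr_deriv ?_
    simp
  exact h.exp.congr_deriv (by rw [gaussWeight]; ring)

lemma integral_gaussWeight : ∫ t, gaussWeight t = √(2 * Real.pi) := by
  have := integral_gaussian (1 / 2 : ℝ)
  unfold gaussWeight
  rw [this]; congr 1; ring

lemma gaussTail_zero : gaussTail 0 = √(2 * Real.pi) / 2 := by
  unfold gaussTail gaussWeight
  rw [integral_gaussian_Ioi]; congr 2; ring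

lemma gaussTail_nonneg (x : ℝ) : 0 ≤ gaussTail x :=
  integral_nonneg fun t => (gaussWeight_pos t).le

lemma gaussTail_eq_sub (x : ℝ) :
    gaussTail x = √(2 * Real.pi) - ∫ t in Set.Iic x, gaussWeight t := by
  rw [← integral_gaussWeight, gaussTail,
    ← intervalIntegral.integral_Iic_add_Ioi (b := x) integrable_gaussWeight.integrableOn
      integrable_gaussWeight.integrableOn]
  ring

/-- Fundamental theorem of calculus for `x ↦ ∫_{-∞}^x k`. -/
lemma hasDerivAt_integral_Iic {k : ℝ → ℝ} (hk : Continuous k) (hi : Integrable k) (x : ℝ) :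
    HasDerivAt (fun y => ∫ t in Set.Iic y, k t) (k x) x := by
  have h1 : (fun y => ∫ t in Set.Iic y, k t)
      = fun y => (∫ t in Set.Iic (0 : ℝ), k t) + ∫ t in (0 : ℝ)..y, k t := by
    ext y
    rw [← intervalIntegral.integral_Iic_sub_Iic hi.integrableOn hi.integrableOn]; ring
  rw [h1]
  have := intervalIntegral.integral_hasDerivAt_right (hk.intervalIntegrable 0 x)
    (hk.stronglyMeasurableAtFilter _ _) hk.continuousAt
  simpa using this.const_add (∫ t in Set.Iic (0 : ℝ), k t)

lemma tendsto_integral_Iic_atTop {k : ℝ → ℝ} (hi : Integrable k) :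
    Tendsto (fun y => ∫ t in Set.Iic y, k t) atTop (𝓝 (∫ t, k t)) := by
  have h := (aecover_Iic (μ := volume) (b := fun y : ℝ => y) tendsto_id)
  exact h.integral_tendsto_of_countably_generated hi

lemma hasDerivAt_gaussTail (x : ℝ) : HasDerivAt gaussTail (-gaussWeight x) x := by
  have h : gaussTail = fun x => √(2 * Real.pi) - ∫ t in Set.Iic x, gaussWeight t :=
    funext gaussTail_eq_sub
  rw [h]
  simpa using (hasDerivAt_integral_Iic continuous_gaussWeight integrable_gaussWeight x).const_sub
    (√(2 * Real.pi))

lemma tendsto_gaussTail_atTop : Tendsto gaussTail atTop (𝓝 0) := by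
  have h : gaussTail = fun x => √(2 * Real.pi) - ∫ t in Set.Iic x, gaussWeight t :=
    funext gaussTail_eq_sub
  rw [h]
  have := (tendsto_integral_Iic_atTop integrable_gaussWeight).const_sub (√(2 * Real.pi))
  rwa [integral_gaussWeight, sub_self] at this

lemma tendsto_gaussWeight_atTop : Tendsto gaussWeight atTop (𝓝 0) := by
  refine Real.tendsto_exp_atBot.comp ?_
  exact (tendsto_pow_atTop (two_ne_zero)).const_mul_atTop_of_neg (by norm_num)

lemma tendsto_gaussWeight_atBot : Tendsto gaussWeight atBot (𝓝 0) := by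
  have := tendsto_gaussWeight_atTop.comp tendsto_neg_atBot_atTop
  refine this.congr fun x => ?_
  simp [gaussWeight_neg]

lemma integrable_mul_gaussWeight : Integrable (fun t => t * gaussWeight t) := by
  simpa [gaussWeight] using integrable_mul_exp_neg_mul_sq (b := 1 / 2) (by norm_num)

/-- Mills' bound `x * ∫_x^∞ exp (-t ^ 2 / 2) dt ≤ exp (-x ^ 2 / 2)`. -/
lemma mul_gaussTail_le (x : ℝ) : x * gaussTail x ≤ gaussWeight x := by
  have h1 : ∫ t in Set.Ioi x, t * gaussWeight t = gaussWeight x := by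
    have := integral_Ioi_of_hasDerivAt_of_tendsto' (a := x) (m := 0) (f := fun t => -gaussWeight t)
      (f' := fun t => t * gaussWeight t)
      (fun t _ => (hasDerivAt_gaussWeight t).neg.congr_deriv (by ring))
      integrable_mul_gaussWeight.integrableOn (by simpa using tendsto_gaussWeight_atTop.neg)
    simpa using this
  rw [← h1, gaussTail, ← integral_const_mul]
  refine setIntegral_mono_on (integrable_gaussWeight.const_mul x).integrableOn
    integrable_mul_gaussWeight.integrableOn measurableSet_Ioi fun t ht => ?_
  exact mul_le_mul_of_nonneg_right (le_of_lt ht) (gaussWeight_pos t).le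

lemma sqrt_two_pi_div_two_le : √(2 * Real.pi) / 2 ≤ 1.26 := by
  have : √(2 * Real.pi) ≤ 2.52 := by
    rw [show (2.52 : ℝ) = √(2.52 ^ 2) by rw [Real.sqrt_sq (by norm_num)]]
    exact Real.sqrt_le_sqrt (by nlinarith [Real.pi_lt_d2])
  linarith

/-- Only right derivatives are needed, because the test functions have kinks. -/
lemma monotone_of_hasDerivWithinAt_Ici_nonneg {G G' : ℝ → ℝ} (hc : Continuous G)
    (hd : ∀ x, HasDerivWithinAt G (G' x) (Set.Ici x) x) (h0 : ∀ x, 0 ≤ G' x) : Monotone G := by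
  intro a b hab
  have := image_le_of_deriv_right_le_deriv_boundary (f := fun _ => G a) (f' := fun _ => 0)
    (a := a) (b := b) continuousOn_const (fun x _ => hasDerivWithinAt_const _ _ _)
    (B := G) (B' := G') le_rfl hc.continuousOn (fun x _ => hd x) (fun x _ => h0 x)
  exact this ⟨hab, le_rfl⟩

/-- On the right half-line Mills' ratio is largest at the origin, where it is `√(π / 2)`. -/
lemma gaussTail_le (x : ℝ) (hx : 0 ≤ x) : gaussTail x ≤ 1.26 * gaussWeight x := by
  have hd : ∀ y, HasDerivAt (fun y => gaussTail y / gaussWeight y)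
      ((-gaussWeight y * gaussWeight y - gaussTail y * (-y * gaussWeight y)) / gaussWeight y ^ 2)
      y := fun y => (hasDerivAt_gaussTail y).div (hasDerivAt_gaussWeight y) (gaussWeight_pos y).ne'
  have hanti : Antitone (fun y => gaussTail y / gaussWeight y) := by
    refine antitone_of_deriv_nonpos (fun y => (hd y).differentiableAt) fun y => ?_
    rw [(hd y).deriv]
    refine div_nonpos_of_nonpos_of_nonneg ?_ (sq_nonneg _)
    nlinarith [mul_gaussTail_le y, gaussWeight_pos y]
  have h := hanti hx
  simp only [gaussTail_zero] at h
  have h0 : gaussWeight 0 = 1 := by simp [gaussWeight]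
  rw [h0, div_one, div_le_iff₀ (gaussWeight_pos x)] at h
  exact h.trans (mul_le_mul_of_nonneg_right sqrt_two_pi_div_two_le (gaussWeight_pos x).le)

/-! ### The Stein equation `F' x - x * F x = H x` -/

/-- Comparison principle for `F' - x F = H` from the right end: `F` is dominated by `B` times
Mills' ratio as soon as `-B ≤ H`. -/
lemma stein_le_of_atTop {F H : ℝ → ℝ} {B : ℝ} (hc : Continuous F)
    (hd : ∀ x, HasDerivWithinAt F (x * F x + H x) (Set.Ici x) x)
    (hlim : Tendsto (fun x => F x * gaussWeight x) atTop (𝓝 0)) (hH : ∀ x, -B ≤ H x) (x : ℝ) :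
    F x * gaussWeight x ≤ B * gaussTail x := by
  have hm : Monotone (fun x => F x * gaussWeight x - B * gaussTail x) := by
    refine monotone_of_hasDerivWithinAt_Ici_nonneg
      (G' := fun x => (H x + B) * gaussWeight x) ?_ (fun y => ?_) fun y => ?_
    · have h1 : Continuous gaussTail :=
        continuous_iff_continuousAt.2 fun y => (hasDerivAt_gaussTail y).continuousAt
      have := continuous_gaussWeight
      fun_prop
    · exact (((hd y).mul (hasDerivAt_gaussWeight y).hasDerivWithinAt).sub
        ((hasDerivAt_gaussTail y).hasDerivWithinAt.const_mul B)).congr_deriv (by ring)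
    · exact mul_nonneg (by linarith [hH y]) (gaussWeight_pos y).le
  have hl : Tendsto (fun x => F x * gaussWeight x - B * gaussTail x) atTop (𝓝 0) := by
    simpa using hlim.sub (tendsto_gaussTail_atTop.const_mul B)
  have := hm.ge_of_tendsto hl x
  linarith

/-- The comparison principle from the left end, obtained by reflection. -/
lemma stein_le_of_atBot {F H : ℝ → ℝ} {B : ℝ} (hc : Continuous F)
    (hd : ∀ x, HasDerivWithinAt F (x * F x + H x) (Set.Ici x) x)
    (hlim : Tendsto (fun x => F x * gaussWeight x) atBot (𝓝 0)) (hH : ∀ x, H x ≤ B) (x : ℝ) :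
    F x * gaussWeight x ≤ B * gaussTail (-x) := by
  have hm : Monotone (fun x => B * gaussTail (-x) - F x * gaussWeight x) := by
    refine monotone_of_hasDerivWithinAt_Ici_nonneg
      (G' := fun x => (B - H x) * gaussWeight x) ?_ (fun y => ?_) fun y => ?_
    · have h1 : Continuous gaussTail :=
        continuous_iff_continuousAt.2 fun y => (hasDerivAt_gaussTail y).continuousAt
      have := continuous_gaussWeight
      fun_prop
    · have h1 : HasDerivAt (fun x => gaussTail (-x)) (gaussWeight y) y := by
        exact ((hasDerivAt_gaussTail (-y)).comp y (hasDerivAt_neg y)).congr_deriv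
          (by simp [gaussWeight_neg])
      exact ((h1.hasDerivWithinAt.const_mul B).sub
        ((hd y).mul (hasDerivAt_gaussWeight y).hasDerivWithinAt)).congr_deriv (by ring)
    · exact mul_nonneg (by linarith [hH y]) (gaussWeight_pos y).le
  have hl : Tendsto (fun x => B * gaussTail (-x) - F x * gaussWeight x) atBot (𝓝 0) := by
    simpa using ((tendsto_gaussTail_atTop.comp tendsto_neg_atBot_atTop).const_mul B).sub hlim
  have := hm.le_of_tendsto hl x
  linarith

/-- A solution of the Stein equation with right-hand side bounded by `B` satisfies
`|x * F x| ≤ B`. -/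
lemma abs_mul_stein_le {F H : ℝ → ℝ} {B : ℝ} (hc : Continuous F)
    (hd : ∀ x, HasDerivWithinAt F (x * F x + H x) (Set.Ici x) x)
    (hlim : Tendsto (fun x => F x * gaussWeight x) atTop (𝓝 0))
    (hlim' : Tendsto (fun x => F x * gaussWeight x) atBot (𝓝 0)) (hB : 0 ≤ B)
    (hH : ∀ x, |H x| ≤ B) (x : ℝ) : |x * F x| ≤ B := by
  have hd' : ∀ x, HasDerivWithinAt (fun x => -F x) (x * (-F x) + -H x) (Set.Ici x) x := fun y =>
    (hd y).neg.congr_deriv (by ring)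
  have hn : Tendsto (fun x => -F x * gaussWeight x) atTop (𝓝 0) := by simpa using hlim.neg
  have hn' : Tendsto (fun x => -F x * gaussWeight x) atBot (𝓝 0) := by simpa using hlim'.neg
  have hw := gaussWeight_pos x
  rw [abs_le]
  rcases le_total 0 x with hx | hx
  · have h1 := stein_le_of_atTop hc hd hlim (fun y => (abs_le.1 (hH y)).1) x
    have h2 := stein_le_of_atTop hc.neg hd' hn (B := B)
      (fun y => by linarith [(abs_le.1 (hH y)).2]) x
    simp only [Pi.neg_apply] at h2
    have h3 := mul_gaussTail_le x
    have h4 := mul_le_mul_of_nonneg_left h1 hx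
    have h5 := mul_le_mul_of_nonneg_left h2 hx
    have h6 := mul_le_mul_of_nonneg_left h3 hB
    constructor
    · refine le_of_mul_le_mul_right ?_ hw; nlinarith
    · refine le_of_mul_le_mul_right ?_ hw; nlinarith
  · have h1 := stein_le_of_atBot hc hd hlim' (fun y => (abs_le.1 (hH y)).2) x
    have h2 := stein_le_of_atBot hc.neg hd' hn' (B := B)
      (fun y => by linarith [(abs_le.1 (hH y)).1]) x
    simp only [Pi.neg_apply] at h2
    have h3 := mul_gaussTail_le (-x)
    rw [gaussWeight_neg] at h3
    have h4 := mul_le_mul_of_nonneg_left h1 (neg_nonneg.2 hx)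
    have h5 := mul_le_mul_of_nonneg_left h2 (neg_nonneg.2 hx)
    have h6 := mul_le_mul_of_nonneg_left h3 hB
    constructor
    · refine le_of_mul_le_mul_right ?_ hw; nlinarith
    · refine le_of_mul_le_mul_right ?_ hw; nlinarith

/-! ### Stein's equation for a smoothed indicator -/

/-- The continuous approximation of the indicator of `(-∞, z]` that decreases linearly from `1`
to `0` on `[z, z + h]`. -/
def ramp (z h x : ℝ) : ℝ := max 0 (min 1 ((z + h - x) / h))

lemma ramp_nonneg (z h x : ℝ) : 0 ≤ ramp z h x := le_max_left _ _

lemma ramp_le_one (z h x : ℝ) : ramp z h x ≤ 1 := max_le zero_le_one (min_le_left _ _)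

lemma continuous_ramp (z h : ℝ) : Continuous (ramp z h) := by unfold ramp; fun_prop

lemma ramp_antitone {h : ℝ} (z : ℝ) (hh : 0 < h) : Antitone (ramp z h) := fun a b hab =>
  max_le_max le_rfl (min_le_min le_rfl (div_le_div_of_nonneg_right (by linarith) hh.le))

lemma ramp_of_le {z h x : ℝ} (hh : 0 < h) (hx : x ≤ z) : ramp z h x = 1 := by
  have : 1 ≤ (z + h - x) / h := by rw [le_div_iff₀ hh]; linarith
  rw [ramp, min_eq_left this, max_eq_right zero_le_one]

lemma ramp_of_ge {z h x : ℝ} (hh : 0 < h) (hx : z + h ≤ x) : ramp z h x = 0 := by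
  have : (z + h - x) / h ≤ 0 := div_nonpos_of_nonpos_of_nonneg (by linarith) hh.le
  rw [ramp, min_eq_right (this.trans zero_le_one), max_eq_left this]

lemma ramp_of_mem {z h x : ℝ} (hh : 0 < h) (h1 : z ≤ x) (h2 : x ≤ z + h) :
    ramp z h x = (z + h - x) / h := by
  have h3 : (z + h - x) / h ≤ 1 := by rw [div_le_iff₀ hh]; linarith
  rw [ramp, min_eq_right h3, max_eq_right (div_nonneg (by linarith) hh.le)]

lemma abs_ramp_sub_le {h : ℝ} (z : ℝ) (hh : 0 < h) (x y : ℝ) :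
    |ramp z h x - ramp z h y| ≤ |x - y| / h := by
  unfold ramp
  refine (abs_max_sub_max_le_max _ _ _ _).trans ?_
  refine max_le (by simp; positivity) ?_
  refine (abs_min_sub_min_le_max _ _ _ _).trans ?_
  refine max_le (by simp; positivity) (le_of_eq ?_)
  rw [← sub_div, abs_div, abs_of_pos hh, abs_sub_comm]
  congr 2; ring

/-- The right derivative of `ramp z h`. -/
def rampDeriv (z h x : ℝ) : ℝ := if z ≤ x ∧ x < z + h then -(1 / h) else 0

lemma hasDerivWithinAt_ramp {z h : ℝ} (hh : 0 < h) (x : ℝ) :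
    HasDerivWithinAt (ramp z h) (rampDeriv z h x) (Set.Ici x) x := by
  unfold rampDeriv
  split_ifs with hx
  · have h1 : HasDerivWithinAt (fun y => (z + h - y) / h) (-(1 / h)) (Set.Ici x) x := by
      refine ((((hasDerivAt_id x).const_sub (z + h)).div_const h).congr_deriv ?_).hasDerivWithinAt
      ring
    refine h1.congr_of_eventuallyEq ?_ (ramp_of_mem hh hx.1 hx.2.le)
    have : Set.Iio (z + h) ∈ 𝓝 x := Iio_mem_nhds hx.2
    filter_upwards [self_mem_nhdsWithin, mem_nhdsWithin_of_mem_nhds this] with y hy hy'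
    exact ramp_of_mem hh (hx.1.trans hy) (le_of_lt hy')
  · rw [not_and_or, not_le, not_lt] at hx
    rcases hx with hx | hx
    · refine ((hasDerivAt_const x (1 : ℝ)).hasDerivWithinAt).congr_of_eventuallyEq ?_
        (ramp_of_le hh hx.le)
      filter_upwards [mem_nhdsWithin_of_mem_nhds (Iio_mem_nhds hx)] with y hy
      exact ramp_of_le hh (le_of_lt hy)
    · refine ((hasDerivAt_const x (0 : ℝ)).hasDerivWithinAt).congr_of_eventuallyEq ?_
        (ramp_of_ge hh hx)
      filter_upwards [self_mem_nhdsWithin] with y hy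
      exact ramp_of_ge hh (hx.trans hy)

/-- The mean of `ramp z h` under the standard normal law. -/
def rampMean (z h : ℝ) : ℝ := ∫ x, ramp z h x ∂(gaussianReal 0 1)

lemma integrable_ramp (z h : ℝ) (P : Measure ℝ) [IsFiniteMeasure P] :
    Integrable (ramp z h) P := by
  refine Integrable.of_bound (continuous_ramp z h).aestronglyMeasurable 1
    (Eventually.of_forall fun x => ?_)
  rw [Real.norm_eq_abs, abs_of_nonneg (ramp_nonneg z h x)]
  exact ramp_le_one z h x

lemma rampMean_nonneg (z h : ℝ) : 0 ≤ rampMean z h := integral_nonneg (ramp_nonneg z h)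

lemma rampMean_le_one (z h : ℝ) : rampMean z h ≤ 1 := by
  have := integral_mono (μ := gaussianReal 0 1) (integrable_ramp z h _) (integrable_const 1)
    (ramp_le_one z h)
  rw [rampMean]
  simpa using this

lemma gaussianPDFReal_zero_one (x : ℝ) :
    gaussianPDFReal 0 1 x = (√(2 * Real.pi))⁻¹ * gaussWeight x := by
  simp only [gaussianPDFReal, gaussWeight]
  simp only [NNReal.coe_one, mul_one, sub_zero]
  congr 2; ring

lemma integrable_ramp_mul_gaussWeight (z h : ℝ) :
    Integrable (fun x => ramp z h x * gaussWeight x) := by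
  refine integrable_gaussWeight.bdd_mul (c := 1) (continuous_ramp z h).aestronglyMeasurable
    (Eventually.of_forall fun x => ?_)
  rw [Real.norm_eq_abs, abs_of_nonneg (ramp_nonneg z h x)]
  exact ramp_le_one z h x

lemma integral_ramp_mul_gaussWeight (z h : ℝ) :
    ∫ x, ramp z h x * gaussWeight x = √(2 * Real.pi) * rampMean z h := by
  have hp : 0 < √(2 * Real.pi) := by positivity
  rw [rampMean, integral_gaussianReal_eq_integral_smul one_ne_zero]
  simp only [gaussianPDFReal_zero_one, smul_eq_mul]
  rw [← integral_const_mul]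
  congr 1; ext x
  field_simp

/-- The centred test function multiplied by the Gaussian weight. -/
def rampKernel (z h x : ℝ) : ℝ := (ramp z h x - rampMean z h) * gaussWeight x

lemma continuous_rampKernel (z h : ℝ) : Continuous (rampKernel z h) :=
  ((continuous_ramp z h).sub continuous_const).mul continuous_gaussWeight

lemma integrable_rampKernel (z h : ℝ) : Integrable (rampKernel z h) := by
  have := (integrable_ramp_mul_gaussWeight z h).sub
    (integrable_gaussWeight.const_mul (rampMean z h))
  refine this.congr (Eventually.of_forall fun x => ?_)
  simp only [rampKernel, Pi.sub_apply]; ring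

lemma integral_rampKernel (z h : ℝ) : ∫ x, rampKernel z h x = 0 := by
  have : ∫ x, rampKernel z h x
      = ∫ x, (ramp z h x * gaussWeight x - rampMean z h * gaussWeight x) := by
    congr 1; ext x; simp only [rampKernel]; ring
  rw [this, integral_sub (integrable_ramp_mul_gaussWeight z h)
    (integrable_gaussWeight.const_mul _), integral_ramp_mul_gaussWeight, integral_const_mul,
    integral_gaussWeight]
  ring

/-- The bounded solution of Stein's equation `f' x - x f x = ramp z h x - rampMean z h`. -/
def steinSol (z h x : ℝ) : ℝ := (∫ t in Set.Iic x, rampKernel z h t) / gaussWeight x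

/-- The derivative of `steinSol z h`, expressed through Stein's equation. -/
def steinDeriv (z h x : ℝ) : ℝ := x * steinSol z h x + (ramp z h x - rampMean z h)

lemma hasDerivAt_steinSol (z h x : ℝ) : HasDerivAt (steinSol z h) (steinDeriv z h x) x := by
  have h1 := hasDerivAt_integral_Iic (continuous_rampKernel z h) (integrable_rampKernel z h) x
  have hw := (gaussWeight_pos x).ne'
  refine (h1.div (hasDerivAt_gaussWeight x) hw).congr_deriv ?_
  rw [steinDeriv, steinSol, rampKernel]
  field_simp
  ring

lemma continuous_steinSol (z h : ℝ) : Continuous (steinSol z h) :=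
  continuous_iff_continuousAt.2 fun x => (hasDerivAt_steinSol z h x).continuousAt

lemma continuous_steinDeriv (z h : ℝ) : Continuous (steinDeriv z h) := by
  have := continuous_steinSol z h
  have := continuous_ramp z h
  unfold steinDeriv
  fun_prop

lemma steinSol_mul_gaussWeight (z h x : ℝ) :
    steinSol z h x * gaussWeight x = ∫ t in Set.Iic x, rampKernel z h t := by
  rw [steinSol, div_mul_cancel₀ _ (gaussWeight_pos x).ne']

lemma tendsto_steinSol_atTop (z h : ℝ) :
    Tendsto (fun x => steinSol z h x * gaussWeight x) atTop (𝓝 0) := by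
  simp only [steinSol_mul_gaussWeight]
  have := tendsto_integral_Iic_atTop (integrable_rampKernel z h)
  rwa [integral_rampKernel] at this

lemma tendsto_steinSol_atBot (z h : ℝ) :
    Tendsto (fun x => steinSol z h x * gaussWeight x) atBot (𝓝 0) := by
  simp only [steinSol_mul_gaussWeight]
  exact tendsto_integral_Iic_zero tendsto_id

lemma steinSol_nonneg {h : ℝ} (z : ℝ) (hh : 0 < h) (x : ℝ) : 0 ≤ steinSol z h x := by
  refine div_nonneg ?_ (gaussWeight_pos x).le
  rcases le_total (rampMean z h) (ramp z h x) with hx | hx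
  · refine setIntegral_nonneg measurableSet_Iic fun t ht => ?_
    exact mul_nonneg (by linarith [ramp_antitone z hh ht]) (gaussWeight_pos t).le
  · have h1 : ∫ t in Set.Iic x, rampKernel z h t = -∫ t in Set.Ioi x, rampKernel z h t := by
      have := intervalIntegral.integral_Iic_add_Ioi (b := x)
        (integrable_rampKernel z h).integrableOn (integrable_rampKernel z h).integrableOn
      rw [integral_rampKernel] at this
      linarith
    rw [h1, ← integral_neg]
    refine setIntegral_nonneg measurableSet_Ioi fun t ht => ?_
    have := ramp_antitone z hh (le_of_lt ht)
    rw [rampKernel, neg_mul_eq_neg_mul]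
    exact mul_nonneg (by linarith) (gaussWeight_pos t).le

/-- On each half-line the solution is compared with Mills' ratio. -/
lemma steinSol_bounds_of_nonneg (z h : ℝ) {x : ℝ} (hx : 0 ≤ x) :
    steinSol z h x ≤ 1.26 ∧ x * steinSol z h x ≤ rampMean z h := by
  have h1 := stein_le_of_atTop (continuous_steinSol z h)
    (H := fun x => ramp z h x - rampMean z h)
    (fun y => (hasDerivAt_steinSol z h y).hasDerivWithinAt) (tendsto_steinSol_atTop z h)
    (B := rampMean z h) (fun y => by linarith [ramp_nonneg z h y]) x
  have hc := rampMean_nonneg z h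
  have hc1 := rampMean_le_one z h
  have hw := gaussWeight_pos x
  constructor
  · refine le_of_mul_le_mul_right (h1.trans ?_) hw
    exact (mul_le_of_le_one_left (gaussTail_nonneg x) hc1).trans (gaussTail_le x hx)
  · refine le_of_mul_le_mul_right ?_ hw
    nlinarith [mul_le_mul_of_nonneg_left h1 hx,
      mul_le_mul_of_nonneg_left (mul_gaussTail_le x) hc]

lemma steinSol_bounds_of_nonpos (z h : ℝ) {x : ℝ} (hx : x ≤ 0) :
    steinSol z h x ≤ 1.26 ∧ -x * steinSol z h x ≤ 1 - rampMean z h := by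
  have h1 := stein_le_of_atBot (continuous_steinSol z h)
    (H := fun x => ramp z h x - rampMean z h)
    (fun y => (hasDerivAt_steinSol z h y).hasDerivWithinAt) (tendsto_steinSol_atBot z h)
    (B := 1 - rampMean z h) (fun y => by linarith [ramp_le_one z h y]) x
  have hc := rampMean_nonneg z h
  have hc1 := sub_nonneg.2 (rampMean_le_one z h)
  have hw := gaussWeight_pos x
  have hx' : 0 ≤ -x := by linarith
  constructor
  · refine le_of_mul_le_mul_right (h1.trans ?_) hw
    have := gaussTail_le (-x) hx'
    rw [gaussWeight_neg] at this
    exact (mul_le_of_le_one_left (gaussTail_nonneg _) (by linarith)).trans this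
  · refine le_of_mul_le_mul_right ?_ hw
    have := mul_gaussTail_le (-x)
    rw [gaussWeight_neg] at this
    nlinarith [mul_le_mul_of_nonneg_left h1 hx', mul_le_mul_of_nonneg_left this hc1]

lemma steinSol_le (z h x : ℝ) : steinSol z h x ≤ 1.26 := by
  rcases le_total 0 x with hx | hx
  · exact (steinSol_bounds_of_nonneg z h hx).1
  · exact (steinSol_bounds_of_nonpos z h hx).1

/-- Because the test function is decreasing, the derivative of the Stein solution is bounded by
`1`, not just by `2`. -/
lemma abs_steinDeriv_le {h : ℝ} (z : ℝ) (hh : 0 < h) (x : ℝ) : |steinDeriv z h x| ≤ 1 := by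
  have h0 := steinSol_nonneg z hh x
  have h1 := ramp_nonneg z h x
  have h2 := ramp_le_one z h x
  have h3 := rampMean_nonneg z h
  have h4 := rampMean_le_one z h
  rw [abs_le, steinDeriv]
  rcases le_total 0 x with hx | hx
  · have h5 := (steinSol_bounds_of_nonneg z h hx).2
    have h6 := mul_nonneg hx h0
    constructor <;> linarith
  · have h5 := (steinSol_bounds_of_nonpos z h hx).2
    have h6 := mul_nonneg (neg_nonneg.2 hx) h0
    constructor <;> linarith

/-- The derivative `φ` of the Stein solution solves a Stein equation itself, with right-hand side
`f + ramp'`; hence `|φ'| ≤ 2 sup |f + ramp'|`. -/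
lemma abs_steinDeriv_sub_le {h : ℝ} (z : ℝ) (hh : 0 < h) (hh1 : h ≤ 1) (x y : ℝ) :
    |steinDeriv z h x - steinDeriv z h y| ≤ 2.52 / h * |x - y| := by
  set H : ℝ → ℝ := fun x => steinSol z h x + rampDeriv z h x with hH
  have hd : ∀ x, HasDerivWithinAt (steinDeriv z h) (x * steinDeriv z h x + H x) (Set.Ici x) x := by
    intro x
    refine ((((hasDerivAt_id x).mul (hasDerivAt_steinSol z h x)).hasDerivWithinAt).add
      ((hasDerivWithinAt_ramp hh x).sub_const (rampMean z h))).congr_deriv ?_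
    simp only [hH, id]; ring
  have hi : 1 ≤ 1 / h := by rw [le_div_iff₀ hh]; linarith
  have hHb : ∀ x, |H x| ≤ 1.26 / h := by
    intro x
    have h1 := steinSol_nonneg z hh x
    have h2 := steinSol_le z h x
    have h3 : (1.26 : ℝ) / h = 1.26 * (1 / h) := by ring
    rw [h3]
    simp only [hH, rampDeriv]
    rw [abs_le]
    split_ifs <;> constructor <;> linarith
  have hlim : ∀ l : Filter ℝ, Tendsto gaussWeight l (𝓝 0) →
      Tendsto (fun x => steinDeriv z h x * gaussWeight x) l (𝓝 0) := by
    intro l hl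
    refine squeeze_zero_norm (fun x => ?_) hl
    rw [norm_mul, Real.norm_eq_abs, Real.norm_eq_abs, abs_of_pos (gaussWeight_pos x)]
    exact mul_le_of_le_one_left (gaussWeight_pos x).le (abs_steinDeriv_le z hh x)
  have hb := abs_mul_stein_le (continuous_steinDeriv z h) hd (hlim _ tendsto_gaussWeight_atTop)
    (hlim _ tendsto_gaussWeight_atBot) (by positivity) hHb
  have key : ∀ a b, a ≤ b → |steinDeriv z h b - steinDeriv z h a| ≤ 2.52 / h * |b - a| := by
    intro a b hab
    have := norm_image_sub_le_of_norm_deriv_right_le_segment (f := steinDeriv z h) (a := a) (b := b)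
      (C := 2.52 / h) (continuous_steinDeriv z h).continuousOn (fun x _ => hd x) (fun x _ => ?_) b
      ⟨hab, le_rfl⟩
    · rwa [Real.norm_eq_abs, ← abs_of_nonneg (sub_nonneg.2 hab)] at this
    · rw [Real.norm_eq_abs]
      refine (abs_add_le _ _).trans ((add_le_add (hb x) (hHb x)).trans (le_of_eq ?_))
      ring
  rcases le_total x y with hxy | hxy
  · rw [abs_sub_comm, abs_sub_comm x]; exact key x y hxy
  · exact key y x hxy

/-- Local modulus of continuity of the derivative of the Stein solution: the singular contribution
`1 / h` is only present close to the interval `[z, z + h]`. -/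
lemma abs_steinDeriv_sub_le_local {h l : ℝ} (z : ℝ) (hh : 0 < h) (q x y : ℝ)
    (hx : |x - q| ≤ l) (hy : |y - q| ≤ l) :
    |steinDeriv z h x - steinDeriv z h y| ≤
      (1.26 + |q| + l + (Set.Ioc (z - l) (z + h + l)).indicator (fun _ => 1 / h) q)
        * |x - y| := by
  have hx' := abs_le.1 hx
  have hy' := abs_le.1 hy
  have h1 : |x * steinSol z h x - y * steinSol z h y| ≤ (1.26 + |q| + l) * |x - y| := by
    have := Convex.norm_image_sub_le_of_norm_hasDerivWithin_le (𝕜 := ℝ)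
      (f := fun t => t * steinSol z h t)
      (f' := fun t => steinSol z h t + t * steinDeriv z h t) (s := Set.Icc (q - l) (q + l))
      (C := 1.26 + |q| + l) (x := y) (y := x) (fun t _ => ?_) (fun t ht => ?_)
      (convex_Icc _ _) ⟨by linarith, by linarith⟩ ⟨by linarith, by linarith⟩
    · simpa only [Real.norm_eq_abs] using this
    · exact (((hasDerivAt_id t).mul (hasDerivAt_steinSol z h t)).congr_deriv
        (by simp)).hasDerivWithinAt
    · rw [Real.norm_eq_abs]
      refine (abs_add_le _ _).trans ?_
      rw [abs_of_nonneg (steinSol_nonneg z hh t), abs_mul, add_assoc]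
      refine add_le_add (steinSol_le z h t) ?_
      refine (mul_le_of_le_one_right (abs_nonneg t) (abs_steinDeriv_le z hh t)).trans ?_
      have h2 : |t - q| ≤ l := abs_le.2 ⟨by linarith [ht.1], by linarith [ht.2]⟩
      have h3 := abs_add_le q (t - q)
      rw [add_sub_cancel] at h3
      linarith
  have h2 : |ramp z h x - ramp z h y| ≤
      (Set.Ioc (z - l) (z + h + l)).indicator (fun _ => 1 / h) q * |x - y| := by
    by_cases hq : q ∈ Set.Ioc (z - l) (z + h + l)
    · rw [Set.indicator_of_mem hq]
      refine (abs_ramp_sub_le z hh x y).trans (le_of_eq (by ring))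
    · rw [Set.indicator_of_notMem hq, zero_mul]
      rw [Set.mem_Ioc, not_and_or, not_lt, not_le] at hq
      rcases hq with hq | hq
      · rw [ramp_of_le hh (by linarith), ramp_of_le hh (by linarith)]; simp
      · rw [ramp_of_ge hh (by linarith), ramp_of_ge hh (by linarith)]; simp
  have h3 : steinDeriv z h x - steinDeriv z h y
      = (x * steinSol z h x - y * steinSol z h y) + (ramp z h x - ramp z h y) := by
    simp only [steinDeriv]; ring
  rw [h3, add_mul]
  exact (abs_add_le _ _).trans (add_le_add h1 h2)

/-! ### Kolmogorov distance and smoothing -/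

lemma abs_measureReal_Iic_sub_le_one (P Q : Measure ℝ) [IsProbabilityMeasure P]
    [IsProbabilityMeasure Q] (x : ℝ) : |P.real (Set.Iic x) - Q.real (Set.Iic x)| ≤ 1 := by
  have h1 : P.real (Set.Iic x) ≤ 1 := measureReal_le_one
  have h2 : Q.real (Set.Iic x) ≤ 1 := measureReal_le_one
  have h3 : 0 ≤ P.real (Set.Iic x) := measureReal_nonneg
  have h4 : 0 ≤ Q.real (Set.Iic x) := measureReal_nonneg
  rw [abs_le]; constructor <;> linarith

lemma abs_measureReal_Iic_sub_le (P Q : Measure ℝ) [IsProbabilityMeasure P]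
    [IsProbabilityMeasure Q] (x : ℝ) :
    |P.real (Set.Iic x) - Q.real (Set.Iic x)| ≤ kolmogorovDist P Q :=
  le_ciSup (f := fun x => |P.real (Set.Iic x) - Q.real (Set.Iic x)|)
    ⟨1, by rintro _ ⟨y, rfl⟩; exact abs_measureReal_Iic_sub_le_one P Q y⟩ x

lemma kolmogorovDist_le_one (P Q : Measure ℝ) [IsProbabilityMeasure P]
    [IsProbabilityMeasure Q] : kolmogorovDist P Q ≤ 1 :=
  ciSup_le fun x => abs_measureReal_Iic_sub_le_one P Q x

lemma kolmogorovDist_nonneg (P Q : Measure ℝ) : 0 ≤ kolmogorovDist P Q :=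
  Real.iSup_nonneg fun _ => abs_nonneg _

lemma measureReal_Ioc_eq_sub (P : Measure ℝ) [IsFiniteMeasure P] {a b : ℝ} (hab : a ≤ b) :
    P.real (Set.Ioc a b) = P.real (Set.Iic b) - P.real (Set.Iic a) := by
  rw [show Set.Ioc a b = Set.Iic b \ Set.Iic a by ext; simp [and_comm],
    measureReal_sdiff (Set.Iic_subset_Iic.2 hab) measurableSet_Iic]

lemma gaussianPDFReal_le (x : ℝ) : gaussianPDFReal 0 1 x ≤ 0.4 := by
  rw [gaussianPDFReal_zero_one]
  have h1 : (2.5 : ℝ) ≤ √(2 * Real.pi) := by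
    rw [show (2.5 : ℝ) = √(2.5 ^ 2) by rw [Real.sqrt_sq (by norm_num)]]
    exact Real.sqrt_le_sqrt (by nlinarith [Real.pi_gt_d2])
  have h2 : (√(2 * Real.pi))⁻¹ ≤ 0.4 := by
    rw [show (0.4 : ℝ) = (2.5 : ℝ)⁻¹ by norm_num]
    exact inv_anti₀ (by norm_num) h1
  calc (√(2 * Real.pi))⁻¹ * gaussWeight x ≤ 0.4 * 1 :=
        mul_le_mul h2 (gaussWeight_le_one x) (gaussWeight_pos x).le (by norm_num)
    _ = 0.4 := by norm_num

/-- The standard normal density is at most `(2 π) ^ (-1 / 2) ≤ 0.4`. -/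
lemma setIntegral_gaussianReal_le {g : ℝ → ℝ} (s : Set ℝ) (hs : MeasurableSet s)
    (hg : ∀ x ∈ s, 0 ≤ g x) (hi : IntegrableOn g s volume) :
    ∫ x in s, g x ∂(gaussianReal 0 1) ≤ 0.4 * ∫ x in s, g x := by
  rw [← integral_indicator hs, integral_gaussianReal_eq_integral_smul one_ne_zero,
    ← integral_const_mul, ← integral_indicator hs]
  have hi' : Integrable (s.indicator fun x => 0.4 * g x) :=
    IntegrableOn.integrable_indicator (hi.const_mul 0.4) hs
  refine integral_mono_of_nonneg (Eventually.of_forall fun x => ?_) hi'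
    (Eventually.of_forall fun x => ?_)
  · by_cases hx : x ∈ s
    · simp only [Pi.zero_apply, Set.indicator_of_mem hx]
      exact mul_nonneg (gaussianPDFReal_nonneg _ _ _) (hg x hx)
    · simp [hx]
  · by_cases hx : x ∈ s
    · simp only [Set.indicator_of_mem hx, smul_eq_mul]
      exact mul_le_mul_of_nonneg_right (gaussianPDFReal_le x) (hg x hx)
    · simp [hx]

lemma gaussianReal_Ioc_le {a b : ℝ} (hab : a ≤ b) :
    (gaussianReal 0 1).real (Set.Ioc a b) ≤ 0.4 * (b - a) := by
  have := setIntegral_gaussianReal_le (g := fun _ => 1) (Set.Ioc a b) measurableSet_Ioc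
    (fun _ _ => zero_le_one) (integrableOn_const (by simp))
  simpa [hab] using this

/-- A concentration inequality for a law that is close to the normal law. -/
lemma measureReal_Ioc_le (P : Measure ℝ) [IsProbabilityMeasure P] {a b : ℝ} (hab : a ≤ b) :
    P.real (Set.Ioc a b) ≤ 0.4 * (b - a) + 2 * kolmogorovDist P (gaussianReal 0 1) := by
  have h1 := gaussianReal_Ioc_le hab
  rw [measureReal_Ioc_eq_sub _ hab] at h1 ⊢
  have h2 := abs_le.1 (abs_measureReal_Iic_sub_le P (gaussianReal 0 1) a)
  have h3 := abs_le.1 (abs_measureReal_Iic_sub_le P (gaussianReal 0 1) b)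
  linarith

lemma indicator_Iic_le_ramp {z h : ℝ} (hh : 0 < h) (x : ℝ) :
    (Set.Iic z).indicator (fun _ => (1 : ℝ)) x ≤ ramp z h x := by
  by_cases hx : x ∈ Set.Iic z
  · rw [Set.indicator_of_mem hx, ramp_of_le hh hx]
  · rw [Set.indicator_of_notMem hx]; exact ramp_nonneg z h x

lemma ramp_sub_le_indicator_Iic {z h : ℝ} (hh : 0 < h) (x : ℝ) :
    ramp (z - h) h x ≤ (Set.Iic z).indicator (fun _ => (1 : ℝ)) x := by
  by_cases hx : x ∈ Set.Iic z
  · rw [Set.indicator_of_mem hx]; exact ramp_le_one _ _ _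
  · rw [Set.indicator_of_notMem hx, ramp_of_ge hh]
    rw [Set.mem_Iic, not_le] at hx; linarith

lemma integral_indicator_Iic (P : Measure ℝ) (z : ℝ) :
    ∫ x, (Set.Iic z).indicator (fun _ => (1 : ℝ)) x ∂P = P.real (Set.Iic z) := by
  rw [integral_indicator measurableSet_Iic]; simp

lemma integrable_indicator_Iic (P : Measure ℝ) [IsFiniteMeasure P] (z : ℝ) :
    Integrable ((Set.Iic z).indicator (fun _ => (1 : ℝ))) P :=
  (integrable_const 1).indicator measurableSet_Iic

/-- The ramp exceeds the indicator by a triangle of area `h / 2`, which has normal measure at most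
`0.4 * h / 2`. -/
lemma rampMean_le {h : ℝ} (z : ℝ) (hh : 0 < h) :
    rampMean z h ≤ (gaussianReal 0 1).real (Set.Iic z) + 0.2 * h := by
  set g : ℝ → ℝ := fun x => (z + h - x) / h with hg
  have hgc : Continuous g := by fun_prop
  have hpt : ∀ x, ramp z h x ≤ (Set.Iic z).indicator (fun _ => (1 : ℝ)) x
      + (Set.Ioc z (z + h)).indicator g x := by
    intro x
    rcases le_or_gt x z with hx | hx
    · rw [Set.indicator_of_mem (Set.mem_Iic.2 hx),
        Set.indicator_of_notMem (fun h' => absurd h'.1 (not_lt.2 hx)), add_zero]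
      exact ramp_le_one _ _ _
    · rw [Set.indicator_of_notMem (s := Set.Iic z) (fun h' => absurd h' (not_le.2 hx)), zero_add]
      rcases le_or_gt x (z + h) with hx' | hx'
      · rw [Set.indicator_of_mem (Set.mem_Ioc.2 ⟨hx, hx'⟩), ramp_of_mem hh hx.le hx']
      · rw [Set.indicator_of_notMem (fun h' => absurd h'.2 (not_le.2 hx')), ramp_of_ge hh hx'.le]
  have hint : IntegrableOn g (Set.Ioc z (z + h)) volume :=
    (hgc.integrableOn_Icc).mono_set Set.Ioc_subset_Icc_self
  have hint' : Integrable ((Set.Ioc z (z + h)).indicator g) (gaussianReal 0 1) :=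
    ((hgc.integrableOn_Icc).mono_set Set.Ioc_subset_Icc_self).integrable_indicator
      measurableSet_Ioc
  have h1 := integral_mono (integrable_ramp z h _)
    ((integrable_indicator_Iic (gaussianReal 0 1) z).add hint') hpt
  simp only [Pi.add_apply] at h1
  rw [integral_add (integrable_indicator_Iic _ _) hint', integral_indicator_Iic,
    integral_indicator measurableSet_Ioc] at h1
  refine h1.trans (add_le_add le_rfl ?_)
  refine (setIntegral_gaussianReal_le _ measurableSet_Ioc (fun x hx => ?_) hint).trans ?_
  · exact div_nonneg (by linarith [hx.2]) hh.le
  · rw [← intervalIntegral.integral_of_le (by linarith)]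
    have h2 : ∫ x in z..(z + h), g x = h / 2 := by
      simp only [hg]
      rw [intervalIntegral.integral_div, intervalIntegral.integral_sub (by simp) (by simp),
        integral_id, intervalIntegral.integral_const, smul_eq_mul]
      field_simp; ring
    rw [h2]; linarith

lemma le_rampMean {h : ℝ} (z : ℝ) (hh : 0 < h) :
    (gaussianReal 0 1).real (Set.Iic z) - 0.2 * h ≤ rampMean (z - h) h := by
  set g : ℝ → ℝ := fun x => (x - (z - h)) / h with hg
  have hgc : Continuous g := by fun_prop
  have hpt : ∀ x, (Set.Iic z).indicator (fun _ => (1 : ℝ)) x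
      ≤ ramp (z - h) h x + (Set.Ioc (z - h) z).indicator g x := by
    intro x
    rcases le_or_gt x z with hx | hx
    · rw [Set.indicator_of_mem (Set.mem_Iic.2 hx)]
      rcases le_or_gt x (z - h) with hx' | hx'
      · rw [Set.indicator_of_notMem (fun h' => absurd h'.1 (not_lt.2 hx')), ramp_of_le hh hx',
          add_zero]
      · rw [Set.indicator_of_mem (Set.mem_Ioc.2 ⟨hx', hx⟩), ramp_of_mem hh hx'.le (by linarith)]
        refine le_of_eq ?_
        simp only [hg]; field_simp; ring
    · rw [Set.indicator_of_notMem (s := Set.Iic z) (fun h' => absurd h' (not_le.2 hx)),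
        Set.indicator_of_notMem (fun h' => absurd h'.2 (not_le.2 hx)), add_zero]
      exact ramp_nonneg _ _ _
  have hint : IntegrableOn g (Set.Ioc (z - h) z) volume :=
    (hgc.integrableOn_Icc).mono_set Set.Ioc_subset_Icc_self
  have hint' : Integrable ((Set.Ioc (z - h) z).indicator g) (gaussianReal 0 1) :=
    ((hgc.integrableOn_Icc).mono_set Set.Ioc_subset_Icc_self).integrable_indicator
      measurableSet_Ioc
  have h1 := integral_mono (integrable_indicator_Iic (gaussianReal 0 1) z)
    ((integrable_ramp (z - h) h _).add hint') hpt
  simp only [Pi.add_apply] at h1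
  rw [integral_add (integrable_ramp _ _ _) hint', integral_indicator_Iic,
    integral_indicator measurableSet_Ioc] at h1
  have h3 : ∫ x in Set.Ioc (z - h) z, g x ∂(gaussianReal 0 1) ≤ 0.2 * h := by
    refine (setIntegral_gaussianReal_le _ measurableSet_Ioc (fun x hx => ?_) hint).trans ?_
    · exact div_nonneg (by linarith [hx.1]) hh.le
    · rw [← intervalIntegral.integral_of_le (by linarith)]
      have h2 : ∫ x in (z - h)..z, g x = h / 2 := by
        simp only [hg]
        rw [intervalIntegral.integral_div, intervalIntegral.integral_sub (by simp) (by simp),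
          integral_id, intervalIntegral.integral_const, smul_eq_mul]
        field_simp; ring
      rw [h2]; linarith
  rw [rampMean]
  linarith

/-- Smoothing inequality: a bound for the test functions `ramp z h`, uniform in `z`, bounds the
Kolmogorov distance to the standard normal law up to `0.2 * h`. -/
lemma kolmogorovDist_le_of_ramp (P : Measure ℝ) [IsProbabilityMeasure P] {h R : ℝ} (hh : 0 < h)
    (hR : ∀ z, |∫ x, ramp z h x ∂P - rampMean z h| ≤ R) :
    kolmogorovDist P (gaussianReal 0 1) ≤ 0.2 * h + R := by
  refine ciSup_le fun z => ?_
  have h1 := integral_mono (integrable_indicator_Iic P z) (integrable_ramp z h P)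
    (indicator_Iic_le_ramp hh)
  have h2 := integral_mono (integrable_ramp (z - h) h P) (integrable_indicator_Iic P z)
    (ramp_sub_le_indicator_Iic hh)
  rw [integral_indicator_Iic] at h1 h2
  have h3 := abs_le.1 (hR z)
  have h4 := abs_le.1 (hR (z - h))
  have h5 := rampMean_le z hh
  have h6 := le_rampMean z hh
  rw [abs_le]; constructor <;> linarith

/-- Translations change the Kolmogorov distance to the normal law at most by the translation length
times the maximum of the normal density. -/
lemma kolmogorovDist_map_add_const_le {Ω : Type*} [MeasurableSpace Ω] (μ : Measure Ω)
    [IsProbabilityMeasure μ] {U : Ω → ℝ} (hU : Measurable U) (c : ℝ) :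
    kolmogorovDist (μ.map fun ω => U ω + c) (gaussianReal 0 1)
      ≤ kolmogorovDist (μ.map U) (gaussianReal 0 1) + 0.4 * |c| := by
  have : IsProbabilityMeasure (μ.map U) := Measure.isProbabilityMeasure_map hU.aemeasurable
  refine ciSup_le fun x => ?_
  have h1 : (μ.map fun ω => U ω + c).real (Set.Iic x) = (μ.map U).real (Set.Iic (x - c)) := by
    rw [map_measureReal_apply (hU.add_const c) measurableSet_Iic,
      map_measureReal_apply hU measurableSet_Iic]
    congr 1; ext ω; simp [le_sub_iff_add_le]
  rw [h1]
  have h2 := abs_measureReal_Iic_sub_le (μ.map U) (gaussianReal 0 1) (x - c)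
  have h3 : |(gaussianReal 0 1).real (Set.Iic (x - c)) - (gaussianReal 0 1).real (Set.Iic x)|
      ≤ 0.4 * |c| := by
    rcases le_total 0 c with hc | hc
    · have h4 := gaussianReal_Ioc_le (show x - c ≤ x by linarith)
      have h5 := measureReal_Ioc_eq_sub (gaussianReal 0 1) (show x - c ≤ x by linarith)
      have h6 : 0 ≤ (gaussianReal 0 1).real (Set.Ioc (x - c) x) := measureReal_nonneg
      rw [abs_of_nonneg hc, abs_le]
      constructor <;> linarith
    · have h4 := gaussianReal_Ioc_le (show x ≤ x - c by linarith)
      have h5 := measureReal_Ioc_eq_sub (gaussianReal 0 1) (show x ≤ x - c by linarith)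
      have h6 : 0 ≤ (gaussianReal 0 1).real (Set.Ioc x (x - c)) := measureReal_nonneg
      rw [abs_of_nonpos hc, abs_le]
      constructor <;> linarith
  have h4 := abs_sub_le ((μ.map U).real (Set.Iic (x - c)))
    ((gaussianReal 0 1).real (Set.Iic (x - c))) ((gaussianReal 0 1).real (Set.Iic x))
  linarith

/-! ### Sums with a dependency graph: Stein's expansion -/

section Neighbourhoods

variable {ι Ω : Type*} [Fintype ι]

open scoped Classical in
/-- The closed neighbourhood of a set `A` of vertices: `A` together with all its neighbours. -/
def nbhd (G : SimpleGraph ι) (A : Set ι) : Finset ι :=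
  Finset.univ.filter fun w => ∃ v ∈ A, w = v ∨ G.Adj v w

/-- The sum of the variables with index outside the closed neighbourhood of `A`. It is independent
of the variables with index in `A`. -/
def restSum (G : SimpleGraph ι) (y : ι → Ω → ℝ) (A : Set ι) (ω : Ω) : ℝ :=
  ∑ x, y x ω - ∑ x ∈ nbhd G A, y x ω

/-- The sum of the absolute values of the variables in the closed neighbourhood of `A`. -/
def absSum (G : SimpleGraph ι) (y : ι → Ω → ℝ) (A : Set ι) (ω : Ω) : ℝ :=
  ∑ x ∈ nbhd G A, |y x ω|

variable {G : SimpleGraph ι} {y : ι → Ω → ℝ}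

lemma mem_nbhd {A : Set ι} {w : ι} : w ∈ nbhd G A ↔ ∃ v ∈ A, w = v ∨ G.Adj v w := by
  simp [nbhd]

lemma mem_nbhd_singleton {v w : ι} : w ∈ nbhd G {v} ↔ w = v ∨ G.Adj v w := by
  simp [mem_nbhd]

lemma mem_nbhd_comm {v w : ι} : w ∈ nbhd G {v} ↔ v ∈ nbhd G {w} := by
  rw [mem_nbhd_singleton, mem_nbhd_singleton, eq_comm, G.adj_comm]

lemma nbhd_mono {A B : Set ι} (h : A ⊆ B) : nbhd G A ⊆ nbhd G B := fun w hw => by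
  obtain ⟨v, hv, h'⟩ := mem_nbhd.1 hw
  exact mem_nbhd.2 ⟨v, h hv, h'⟩

lemma mem_nbhd_insert {v w : ι} {A : Set ι} :
    w ∈ nbhd G (insert v A) ↔ w ∈ nbhd G {v} ∨ w ∈ nbhd G A := by
  simp [mem_nbhd]

lemma sum_nbhd_insert_le {a : ι → ℝ} (ha : ∀ i, 0 ≤ a i) (v : ι) (A : Set ι) :
    ∑ x ∈ nbhd G (insert v A), a x ≤ ∑ x ∈ nbhd G {v}, a x + ∑ x ∈ nbhd G A, a x := by
  classical
  have h : nbhd G (insert v A) = nbhd G {v} ∪ nbhd G A := by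
    ext w; rw [mem_nbhd_insert, Finset.mem_union]
  rw [h, ← Finset.sum_union_inter]
  exact le_add_of_nonneg_right (Finset.sum_nonneg fun i _ => ha i)

lemma card_nbhd_insert_le (v : ι) (A : Set ι) :
    ((nbhd G (insert v A)).card : ℝ) ≤ (nbhd G {v}).card + (nbhd G A).card := by
  have := sum_nbhd_insert_le (G := G) (a := fun _ => 1) (fun _ => zero_le_one) v A
  simpa using this

lemma absSum_nonneg (A : Set ι) (ω : Ω) : 0 ≤ absSum G y A ω :=
  Finset.sum_nonneg fun _ _ => abs_nonneg _

lemma sum_sub_restSum (A : Set ι) (ω : Ω) :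
    ∑ x, y x ω - restSum G y A ω = ∑ x ∈ nbhd G A, y x ω := by
  rw [restSum]; ring

lemma abs_sum_sub_restSum_le (A : Set ι) (ω : Ω) :
    |∑ x, y x ω - restSum G y A ω| ≤ absSum G y A ω := by
  rw [sum_sub_restSum]; exact Finset.abs_sum_le_sum_abs _ _

lemma abs_restSum_sub_restSum_le {A B : Set ι} (h : A ⊆ B) (ω : Ω) :
    |restSum G y A ω - restSum G y B ω| ≤ absSum G y B ω := by
  classical
  have h1 : restSum G y A ω - restSum G y B ω = ∑ x ∈ nbhd G B \ nbhd G A, y x ω := by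
    rw [restSum, restSum, ← Finset.sum_sdiff (nbhd_mono (G := G) h)]; ring
  rw [h1]
  refine (Finset.abs_sum_le_sum_abs _ _).trans ?_
  exact Finset.sum_le_sum_of_subset_of_nonneg Finset.sdiff_subset fun _ _ _ => abs_nonneg _

lemma abs_restSum_sub_restSum_pair_le (v u : ι) (ω : Ω) :
    |restSum G y {v} ω - restSum G y {v, u} ω| ≤ absSum G y {u} ω := by
  classical
  have h : ({v} : Set ι) ⊆ {v, u} := by simp
  have h1 : restSum G y {v} ω - restSum G y {v, u} ω
      = ∑ x ∈ nbhd G {v, u} \ nbhd G {v}, y x ω := by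
    rw [restSum, restSum, ← Finset.sum_sdiff (nbhd_mono (G := G) h)]; ring
  rw [h1]
  refine (Finset.abs_sum_le_sum_abs _ _).trans ?_
  refine Finset.sum_le_sum_of_subset_of_nonneg (fun w hw => ?_) fun _ _ _ => abs_nonneg _
  rw [Finset.mem_sdiff, mem_nbhd_insert] at hw
  exact hw.1.resolve_left hw.2

variable [MeasurableSpace Ω] {μ : Measure Ω}

lemma measurable_restSum (hm : ∀ v, Measurable (y v)) (A : Set ι) :
    Measurable (restSum G y A) := by
  unfold restSum
  fun_prop

lemma measurable_absSum (hm : ∀ v, Measurable (y v)) (A : Set ι) :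
    Measurable (absSum G y A) := by
  unfold absSum
  have := fun v => (hm v).abs
  fun_prop

/-- Functions of the variables in `A` are independent of functions of `restSum G y A`. -/
lemma indepFun_restSum (hG : IsDependencyGraph G y μ) (A : Set ι) {F : (A → ℝ) → ℝ}
    (hF : Measurable F) {Ψ : ℝ → ℝ} (hΨ : Measurable Ψ) :
    IndepFun (fun ω => F fun i => y i ω) (fun ω => Ψ (restSum G y A ω)) μ := by
  classical
  set B : Set ι := {x | x ∉ nbhd G A} with hB
  have h := hG A B ?_ ?_
  · have h2 : (fun ω => Ψ (restSum G y A ω))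
        = (fun z : B → ℝ => Ψ (∑ j, z j)) ∘ fun ω (j : B) => y j ω := by
      ext ω
      simp only [Function.comp_apply]
      congr 1
      rw [restSum, ← Finset.sum_compl_add_sum (nbhd G A) (fun x => y x ω), add_sub_cancel_right]
      exact Finset.sum_subtype _ (by simp [hB]) fun x => y x ω
    rw [h2]
    exact h.comp hF (hΨ.comp (by fun_prop))
  · rw [Set.disjoint_left]
    intro a ha hb
    exact hb (mem_nbhd.2 ⟨a, ha, Or.inl rfl⟩)
  · intro i hi j hj hadj
    exact hj (mem_nbhd.2 ⟨i, hi, Or.inr hadj⟩)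

/-- Factorisation of expectations over `A` and the complement of its neighbourhood. -/
lemma integral_mul_restSum (hG : IsDependencyGraph G y μ) (hm : ∀ v, Measurable (y v))
    (A : Set ι) {F : (A → ℝ) → ℝ} (hF : Measurable F) {Ψ : ℝ → ℝ} (hΨ : Measurable Ψ) :
    ∫ ω, F (fun i => y i ω) * Ψ (restSum G y A ω) ∂μ
      = (∫ ω, F (fun i => y i ω) ∂μ) * ∫ ω, Ψ (restSum G y A ω) ∂μ := by
  refine (indepFun_restSum hG A hF hΨ).integral_fun_mul_eq_mul_integral ?_ ?_
  · exact (hF.comp (measurable_pi_lambda _ fun i => hm i)).aestronglyMeasurable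
  · exact (hΨ.comp (measurable_restSum hm A)).aestronglyMeasurable

end Neighbourhoods

section Expansion

variable {ι Ω : Type*} [Fintype ι] [MeasurableSpace Ω] {μ : Measure Ω}
  {G : SimpleGraph ι} {y : ι → Ω → ℝ}

lemma integrable_mul_of_abs_le {X Y : Ω → ℝ} {C : ℝ} (hX : Integrable X μ) (hY : Measurable Y)
    (hC : ∀ ω, |Y ω| ≤ C) : Integrable (fun ω => X ω * Y ω) μ :=
  hX.mul_bdd hY.aestronglyMeasurable (Eventually.of_forall hC)

/-- Only pairs of dependent variables contribute to the second moment of the sum. -/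
lemma integral_sum_sq (hG : IsDependencyGraph G y μ) (hm : ∀ v, Measurable (y v))
    (h2 : ∀ v, MemLp (y v) 2 μ) (h0 : ∀ v, ∫ ω, y v ω ∂μ = 0) :
    ∫ ω, (∑ v, y v ω) ^ 2 ∂μ = ∑ v, ∑ u ∈ nbhd G {v}, ∫ ω, y v ω * y u ω ∂μ := by
  classical
  have hi : ∀ v u, Integrable (fun ω => y v ω * y u ω) μ := fun v u => (h2 v).integrable_mul (h2 u)
  have h1 : ∀ ω, (∑ v, y v ω) ^ 2 = ∑ v, ∑ u, y v ω * y u ω := fun ω => by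
    rw [sq, Finset.sum_mul_sum]
  simp only [h1]
  rw [integral_finsetSum _ fun v _ => integrable_finsetSum _ fun u _ => hi v u]
  refine Finset.sum_congr rfl fun v _ => ?_
  rw [integral_finsetSum _ fun u _ => hi v u]
  refine (Finset.sum_subset (Finset.subset_univ _) fun u _ hu => ?_).symm
  have hne : v ∉ ({u} : Set ι) := fun h => hu (mem_nbhd_singleton.2 (Or.inl h.symm))
  have hind := hG {v} {u} (Set.disjoint_singleton_left.2 hne) (by
    rintro i rfl j rfl hadj
    exact hu (mem_nbhd_singleton.2 (Or.inr hadj)))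
  have hind' : IndepFun (y v) (y u) μ :=
    hind.comp (φ := fun z : (({v} : Set ι) → ℝ) => z ⟨v, rfl⟩)
      (ψ := fun z : (({u} : Set ι) → ℝ) => z ⟨u, rfl⟩) (by fun_prop) (by fun_prop)
  rw [hind'.integral_fun_mul_eq_mul_integral (hm v).aestronglyMeasurable
    (hm u).aestronglyMeasurable, h0 v, zero_mul]

/-- Stein's expansion of `E [φ U - U f U]`, where `U = ∑ y v` has unit variance and `φ = f'`, along
the neighbourhoods of the dependency graph. -/
lemma abs_integral_stein_le [IsProbabilityMeasure μ] (hG : IsDependencyGraph G y μ)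
    (hm : ∀ v, Measurable (y v))
    (h2 : ∀ v, MemLp (y v) 2 μ) (h0 : ∀ v, ∫ ω, y v ω ∂μ = 0)
    (h1 : ∫ ω, (∑ v, y v ω) ^ 2 ∂μ = 1) {f φ : ℝ → ℝ} (hf : Continuous f) (hφ : Continuous φ)
    {C C' : ℝ} (hfC : ∀ x, |f x| ≤ C) (hφC : ∀ x, |φ x| ≤ C') :
    |∫ ω, (φ (∑ v, y v ω) - (∑ v, y v ω) * f (∑ v, y v ω)) ∂μ| ≤
      ∑ v, ∫ ω, |y v ω| * |f (∑ v, y v ω) - f (restSum G y {v} ω)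
          - (∑ v, y v ω - restSum G y {v} ω) * φ (restSum G y {v} ω)| ∂μ
      + ∑ v, ∑ u ∈ nbhd G {v}, (∫ ω, |y v ω * y u ω|
            * |φ (restSum G y {v} ω) - φ (restSum G y {v, u} ω)| ∂μ
          + (∫ ω, |y v ω * y u ω| ∂μ)
            * ∫ ω, |φ (restSum G y {v, u} ω) - φ (∑ v, y v ω)| ∂μ) := by
  set U : Ω → ℝ := fun ω => ∑ v, y v ω with hU
  have hUm : Measurable U := by simp only [hU]; fun_prop
  have hRm : ∀ A, Measurable (restSum G y A) := measurable_restSum hm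
  have hy1 : ∀ v, Integrable (y v) μ := fun v => (h2 v).integrable (by norm_num)
  have hyy : ∀ v u, Integrable (fun ω => y v ω * y u ω) μ :=
    fun v u => (h2 v).integrable_mul (h2 u)
  have hfm := hf.measurable
  have hφm := hφ.measurable
  -- the Taylor remainder of `f` at `restSum G y {v}`
  set τ : ι → Ω → ℝ := fun v ω => f (U ω) - f (restSum G y {v} ω)
    - (U ω - restSum G y {v} ω) * φ (restSum G y {v} ω) with hτ
  have hφU : Integrable (fun ω => φ (U ω)) μ :=
    Integrable.of_bound (hφm.comp hUm).aestronglyMeasurable C' (Eventually.of_forall fun ω => hφC _)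
  have hφR : ∀ A, Integrable (fun ω => φ (restSum G y A ω)) μ := fun A =>
    Integrable.of_bound (hφm.comp (hRm A)).aestronglyMeasurable C'
      (Eventually.of_forall fun ω => hφC _)
  have hyf : ∀ v, Integrable (fun ω => y v ω * f (U ω)) μ := fun v =>
    integrable_mul_of_abs_le (hy1 v) (hfm.comp hUm) fun ω => hfC _
  have hyfR : ∀ v A, Integrable (fun ω => y v ω * f (restSum G y A ω)) μ := fun v A =>
    integrable_mul_of_abs_le (hy1 v) (hfm.comp (hRm A)) fun ω => hfC _
  have hyyφ : ∀ v u A, Integrable (fun ω => y v ω * y u ω * φ (restSum G y A ω)) μ := fun v u A =>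
    integrable_mul_of_abs_le (hyy v u) (hφm.comp (hRm A)) fun ω => hφC _
  have hηφ : ∀ v, Integrable (fun ω => ∑ u ∈ nbhd G {v},
      y v ω * y u ω * φ (restSum G y {v} ω)) μ := fun v =>
    integrable_finsetSum _ fun u _ => hyyφ v u {v}
  have hτeq : ∀ v ω, y v ω * τ v ω = y v ω * f (U ω) - y v ω * f (restSum G y {v} ω)
      - ∑ u ∈ nbhd G {v}, y v ω * y u ω * φ (restSum G y {v} ω) := by
    intro v ω
    simp only [hτ, hU]
    rw [sum_sub_restSum, ← Finset.sum_mul, ← Finset.mul_sum]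
    ring
  have hyτ : ∀ v, Integrable (fun ω => y v ω * τ v ω) μ := fun v => by
    simp only [hτeq]; exact ((hyf v).sub (hyfR v {v})).sub (hηφ v)
  have hzero : ∀ v, ∫ ω, y v ω * f (restSum G y {v} ω) ∂μ = 0 := by
    intro v
    have := integral_mul_restSum hG hm {v} (F := fun z => z ⟨v, rfl⟩) (by fun_prop) hfm
    rw [this, h0 v, zero_mul]
  have hprod : ∀ v u, ∫ ω, y v ω * y u ω * φ (restSum G y {v, u} ω) ∂μ
      = (∫ ω, y v ω * y u ω ∂μ) * ∫ ω, φ (restSum G y {v, u} ω) ∂μ := by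
    intro v u
    exact integral_mul_restSum hG hm {v, u}
      (F := fun z => z ⟨v, by simp⟩ * z ⟨u, by simp⟩) (by fun_prop) hφm
  have hterm : ∀ v, ∫ ω, y v ω * f (U ω) ∂μ = ∫ ω, y v ω * τ v ω ∂μ
      + ∑ u ∈ nbhd G {v}, ∫ ω, y v ω * y u ω * φ (restSum G y {v} ω) ∂μ := by
    intro v
    have hs : Integrable (fun ω => y v ω * f (U ω) - y v ω * f (restSum G y {v} ω)) μ :=
      (hyf v).sub (hyfR v {v})
    simp only [hτeq]
    rw [integral_sub hs (hηφ v), integral_sub (hyf v) (hyfR v {v}),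
      hzero v, integral_finsetSum _ fun u _ => hyyφ v u {v}]
    ring
  have hUf : ∫ ω, U ω * f (U ω) ∂μ = ∑ v, ∫ ω, y v ω * f (U ω) ∂μ := by
    rw [← integral_finsetSum _ fun v _ => hyf v]
    congr 1; ext ω; simp only [hU]; rw [Finset.sum_mul]
  have hUfi : Integrable (fun ω => U ω * f (U ω)) μ := by
    have : (fun ω => U ω * f (U ω)) = fun ω => ∑ v, y v ω * f (U ω) := by
      ext ω; simp only [hU]; rw [Finset.sum_mul]
    rw [this]; exact integrable_finsetSum _ fun v _ => hyf v
  have hone : ∫ ω, φ (U ω) ∂μ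
      = ∑ v, ∑ u ∈ nbhd G {v}, (∫ ω, y v ω * y u ω ∂μ) * ∫ ω, φ (U ω) ∂μ := by
    simp only [← Finset.sum_mul]
    rw [← integral_sum_sq hG hm h2 h0, h1, one_mul]
  have hmain : ∫ ω, (φ (U ω) - U ω * f (U ω)) ∂μ = -∑ v, ∫ ω, y v ω * τ v ω ∂μ
      - ∑ v, ∑ u ∈ nbhd G {v},
        (∫ ω, y v ω * y u ω * (φ (restSum G y {v} ω) - φ (restSum G y {v, u} ω)) ∂μ
          + (∫ ω, y v ω * y u ω ∂μ) * ∫ ω, (φ (restSum G y {v, u} ω) - φ (U ω)) ∂μ) := by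
    rw [integral_sub hφU hUfi, hUf, hone, Finset.sum_congr rfl fun v _ => hterm v,
      Finset.sum_add_distrib, ← sub_sub, sub_right_comm, ← Finset.sum_sub_distrib,
      sub_eq_add_neg, add_comm, sub_eq_add_neg, ← Finset.sum_neg_distrib]
    congr 1
    rw [← Finset.sum_neg_distrib]
    refine Finset.sum_congr rfl fun v _ => ?_
    rw [← Finset.sum_sub_distrib, ← Finset.sum_neg_distrib]
    refine Finset.sum_congr rfl fun u _ => ?_
    simp only [mul_sub]
    rw [integral_sub (hyyφ v u {v}) (hyyφ v u {v, u}), hprod, integral_sub (hφR _) hφU]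
    ring
  rw [hmain]
  have habs : ∀ a b : ℝ, |-a - b| ≤ |a| + |b| := fun a b => by
    rw [← neg_add', abs_neg]; exact abs_add_le a b
  refine (habs _ _).trans (add_le_add ?_ ?_)
  · refine (Finset.abs_sum_le_sum_abs _ _).trans (Finset.sum_le_sum fun v _ => ?_)
    refine abs_integral_le_integral_abs.trans (le_of_eq ?_)
    simp only [abs_mul]; rfl
  · refine (Finset.abs_sum_le_sum_abs _ _).trans (Finset.sum_le_sum fun v _ => ?_)
    refine (Finset.abs_sum_le_sum_abs _ _).trans (Finset.sum_le_sum fun u _ => ?_)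
    refine (abs_add_le _ _).trans (add_le_add ?_ ?_)
    · refine abs_integral_le_integral_abs.trans (le_of_eq ?_)
      congr 1; ext ω; rw [abs_mul]
    · rw [abs_mul]
      exact mul_le_mul abs_integral_le_integral_abs abs_integral_le_integral_abs (abs_nonneg _)
        (integral_nonneg fun _ => abs_nonneg _)

end Expansion

/-! ### Taylor remainders and Young's inequality -/

section Taylor

variable {f φ : ℝ → ℝ}

lemma abs_taylor_le_of_abs_sub_le (hf : ∀ x, HasDerivAt f (φ x) x) {a b M : ℝ}
    (hM : ∀ t, |t - a| ≤ |b - a| → |φ t - φ a| ≤ M) :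
    |f b - f a - (b - a) * φ a| ≤ |b - a| * M := by
  have h := Convex.norm_image_sub_le_of_norm_hasDerivWithin_le (𝕜 := ℝ)
    (f := fun t => f t - t * φ a) (f' := fun t => φ t - φ a) (s := Set.uIcc a b) (C := M)
    (x := a) (y := b)
    (fun t _ => (((hf t).sub ((hasDerivAt_id t).mul_const (φ a))).congr_deriv
      (by simp)).hasDerivWithinAt)
    (fun t ht => hM t (Set.abs_sub_left_of_mem_uIcc ht)) (convex_uIcc a b) Set.left_mem_uIcc
    Set.right_mem_uIcc
  rw [Real.norm_eq_abs, Real.norm_eq_abs, mul_comm M] at h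
  refine le_trans (le_of_eq ?_) h
  congr 1; ring

lemma abs_taylor_le_of_lipschitz (hf : ∀ x, HasDerivAt f (φ x) x) {a b L : ℝ}
    (hL : ∀ s ∈ Set.Icc (0 : ℝ) 1, |φ (a + s * (b - a)) - φ a| ≤ L * (s * |b - a|)) :
    |f b - f a - (b - a) * φ a| ≤ 1 / 2 * (b - a) ^ 2 * L := by
  set F : ℝ → ℝ := fun s => f (a + s * (b - a)) - f a - s * (b - a) * φ a with hF
  have hFd : ∀ s, HasDerivAt F ((b - a) * (φ (a + s * (b - a)) - φ a)) s := by
    intro s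
    have h1 : HasDerivAt (fun s : ℝ => a + s * (b - a)) (b - a) s :=
      (((hasDerivAt_id s).mul_const (b - a)).const_add a).congr_deriv (by simp)
    have h2 : HasDerivAt (fun s : ℝ => s * (b - a) * φ a) ((b - a) * φ a) s :=
      (((hasDerivAt_id s).mul_const (b - a)).mul_const (φ a)).congr_deriv (by simp)
    exact ((((hf _).comp s h1).sub_const (f a)).sub h2).congr_deriv (by ring)
  have hBd : ∀ s, HasDerivAt (fun s : ℝ => 1 / 2 * (b - a) ^ 2 * L * s ^ 2)
      ((b - a) ^ 2 * L * s) s := fun s =>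
    (((hasDerivAt_id s).pow 2).const_mul (1 / 2 * (b - a) ^ 2 * L)).congr_deriv (by simp; ring)
  have h := image_norm_le_of_norm_deriv_right_le_deriv_boundary (a := 0) (b := 1) (f := F)
    (fun s _ => (hFd s).continuousAt.continuousWithinAt) (fun s _ => (hFd s).hasDerivWithinAt)
    (B := fun s => 1 / 2 * (b - a) ^ 2 * L * s ^ 2) (by simp [hF]) hBd (fun s hs => ?_)
    (x := 1) ⟨zero_le_one, le_rfl⟩
  · simpa [hF] using h
  · rw [Real.norm_eq_abs, abs_mul]
    refine (mul_le_mul_of_nonneg_left (hL s ⟨hs.1, hs.2.le⟩) (abs_nonneg _)).trans (le_of_eq ?_)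
    rw [← sq_abs (b - a)]; ring

end Taylor

section Young

lemma young_four {p a b c t : ℝ} (hp : 3 ≤ p) (ha : 0 ≤ a) (hb : 0 ≤ b) (hc : 0 ≤ c)
    (ht : 0 ≤ t) :
    a * b * c * t ^ (p - 3) ≤ (a ^ p + b ^ p + c ^ p) / p + (p - 3) / p * t ^ p := by
  have hp0 : 0 < p := by linarith
  have h := Real.geom_mean_le_arith_mean4_weighted (w₁ := 1 / p) (w₂ := 1 / p) (w₃ := 1 / p)
    (w₄ := (p - 3) / p) (by positivity) (by positivity) (by positivity)
    (div_nonneg (by linarith) hp0.le) (Real.rpow_nonneg ha p) (Real.rpow_nonneg hb p)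
    (Real.rpow_nonneg hc p) (Real.rpow_nonneg ht p) (by field_simp; ring)
  rw [← Real.rpow_mul ha, ← Real.rpow_mul hb, ← Real.rpow_mul hc, ← Real.rpow_mul ht,
    mul_one_div_cancel hp0.ne', mul_div_cancel₀ _ hp0.ne', Real.rpow_one, Real.rpow_one,
    Real.rpow_one] at h
  refine h.trans (le_of_eq (by ring))

lemma young_three {p a b t : ℝ} (hp : 2 ≤ p) (ha : 0 ≤ a) (hb : 0 ≤ b) (ht : 0 ≤ t) :
    a * b * t ^ (p - 2) ≤ (a ^ p + b ^ p) / p + (p - 2) / p * t ^ p := by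
  have hp0 : 0 < p := by linarith
  have h := Real.geom_mean_le_arith_mean3_weighted (w₁ := 1 / p) (w₂ := 1 / p)
    (w₃ := (p - 2) / p) (by positivity) (by positivity)
    (div_nonneg (by linarith) hp0.le) (Real.rpow_nonneg ha p) (Real.rpow_nonneg hb p)
    (Real.rpow_nonneg ht p) (by field_simp; ring)
  rw [← Real.rpow_mul ha, ← Real.rpow_mul hb, ← Real.rpow_mul ht,
    mul_one_div_cancel hp0.ne', mul_div_cancel₀ _ hp0.ne', Real.rpow_one, Real.rpow_one] at h
  refine h.trans (le_of_eq (by ring))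

lemma young_two {p a t : ℝ} (hp : 1 ≤ p) (ha : 0 ≤ a) (ht : 0 ≤ t) :
    a * t ^ (p - 1) ≤ a ^ p / p + (p - 1) / p * t ^ p := by
  have hp0 : 0 < p := by linarith
  have h := Real.geom_mean_le_arith_mean2_weighted (w₁ := 1 / p) (w₂ := (p - 1) / p)
    (by positivity) (div_nonneg (by linarith) hp0.le) (Real.rpow_nonneg ha p)
    (Real.rpow_nonneg ht p) (by field_simp; ring)
  rw [← Real.rpow_mul ha, ← Real.rpow_mul ht,
    mul_one_div_cancel hp0.ne', mul_div_cancel₀ _ hp0.ne', Real.rpow_one] at h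
  refine h.trans (le_of_eq (by ring))

variable {Ω : Type*} [MeasurableSpace Ω] {μ : Measure Ω} [IsProbabilityMeasure μ]

/-- A pointwise bound for `F ω * G ω'` on the product space bounds the product of the
expectations. -/
lemma integral_mul_integral_le {F G H K : Ω → ℝ} (hF : Integrable F μ) (hG : Integrable G μ)
    (hH : Integrable H μ) (hK : Integrable K μ) (h : ∀ ω ω', F ω * G ω' ≤ H ω + K ω') :
    (∫ ω, F ω ∂μ) * ∫ ω, G ω ∂μ ≤ ∫ ω, H ω ∂μ + ∫ ω, K ω ∂μ := by
  have h1 : ∀ ω', (∫ ω, F ω ∂μ) * G ω' ≤ ∫ ω, H ω ∂μ + K ω' := fun ω' => by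
    have := integral_mono (hF.mul_const (G ω')) (hH.add (integrable_const (K ω')))
      fun ω => h ω ω'
    rw [integral_mul_const] at this
    simp only [Pi.add_apply] at this
    rw [integral_add hH (integrable_const _)] at this
    simpa using this
  have h2 := integral_mono (hG.const_mul (∫ ω, F ω ∂μ))
    ((integrable_const (∫ ω, H ω ∂μ)).add hK) h1
  rw [integral_const_mul] at h2
  simp only [Pi.add_apply] at h2
  rw [integral_add (integrable_const _) hK] at h2
  simpa using h2

omit [IsProbabilityMeasure μ] in
lemma integrable_of_nonneg_of_le {F H : Ω → ℝ} (hm : Measurable F) (h0 : ∀ ω, 0 ≤ F ω)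
    (hH : Integrable H μ) (h : ∀ ω, F ω ≤ H ω) : Integrable F μ :=
  hH.mono' hm.aestronglyMeasurable (Eventually.of_forall fun ω => by
    rw [Real.norm_eq_abs, abs_of_nonneg (h0 ω)]; exact h ω)

end Young

/-! ### Counting in graphs of bounded degree -/

section Counting

variable {ι : Type*} [Fintype ι] {G : SimpleGraph ι} {D : ℝ}

lemma sum_sum_nbhd_comm (F : ι → ι → ℝ) :
    ∑ v, ∑ u ∈ nbhd G {v}, F v u = ∑ v, ∑ u ∈ nbhd G {v}, F u v :=
  Finset.sum_comm' fun v u => by simp [mem_nbhd_comm (v := v)]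

lemma sum_sum_nbhd_left_le (hD : ∀ v, ((nbhd G {v}).card : ℝ) ≤ D) {a : ι → ℝ}
    (ha : ∀ v, 0 ≤ a v) : ∑ v, ∑ _u ∈ nbhd G {v}, a v ≤ D * ∑ v, a v := by
  rw [Finset.mul_sum]
  refine Finset.sum_le_sum fun v _ => ?_
  rw [Finset.sum_const, nsmul_eq_mul]
  exact mul_le_mul_of_nonneg_right (hD v) (ha v)

lemma sum_sum_nbhd_right_le (hD : ∀ v, ((nbhd G {v}).card : ℝ) ≤ D) {a : ι → ℝ}
    (ha : ∀ v, 0 ≤ a v) : ∑ v, ∑ u ∈ nbhd G {v}, a u ≤ D * ∑ v, a v := by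
  rw [sum_sum_nbhd_comm fun _ u => a u]
  exact sum_sum_nbhd_left_le hD ha

/-- Summation over pairs of neighbours of a common vertex. -/
lemma sum_star_le (hD : ∀ v, ((nbhd G {v}).card : ℝ) ≤ D) (hD0 : 0 ≤ D) {a : ι → ℝ}
    (ha : ∀ v, 0 ≤ a v) :
    ∑ v, ∑ u ∈ nbhd G {v}, ∑ w ∈ nbhd G {v}, (a v + a u + a w) ≤ 3 * D ^ 2 * ∑ v, a v := by
  have h1 : ∀ v, ∑ u ∈ nbhd G {v}, ∑ w ∈ nbhd G {v}, (a v + a u + a w)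
      = (nbhd G {v}).card * (∑ _u ∈ nbhd G {v}, a v)
        + 2 * ((nbhd G {v}).card * ∑ u ∈ nbhd G {v}, a u) := by
    intro v
    simp only [Finset.sum_add_distrib, Finset.sum_const, nsmul_eq_mul, ← Finset.mul_sum]
    ring
  rw [Finset.sum_congr rfl fun v _ => h1 v, Finset.sum_add_distrib, ← Finset.mul_sum]
  have h2 : ∀ b : ι → ι → ℝ, (∀ v u, 0 ≤ b v u) →
      ∑ v, ((nbhd G {v}).card : ℝ) * ∑ u ∈ nbhd G {v}, b v u
        ≤ D * ∑ v, ∑ u ∈ nbhd G {v}, b v u := by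
    intro b hb
    rw [Finset.mul_sum]
    exact Finset.sum_le_sum fun v _ =>
      mul_le_mul_of_nonneg_right (hD v) (Finset.sum_nonneg fun u _ => hb v u)
  have h3 := (h2 (fun v _ => a v) fun v _ => ha v).trans
    (mul_le_mul_of_nonneg_left (sum_sum_nbhd_left_le hD ha) hD0)
  have h4 := (h2 (fun _ u => a u) fun _ u => ha u).trans
    (mul_le_mul_of_nonneg_left (sum_sum_nbhd_right_le hD ha) hD0)
  nlinarith

/-- Summation over paths of length two. -/
lemma sum_chain_le (hD : ∀ v, ((nbhd G {v}).card : ℝ) ≤ D) (hD0 : 0 ≤ D) {a : ι → ℝ}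
    (ha : ∀ v, 0 ≤ a v) :
    ∑ v, ∑ u ∈ nbhd G {v}, ∑ w ∈ nbhd G {u}, (a v + a u + a w) ≤ 3 * D ^ 2 * ∑ v, a v := by
  rw [sum_sum_nbhd_comm fun v u => ∑ w ∈ nbhd G {u}, (a v + a u + a w)]
  refine le_trans (le_of_eq ?_) (sum_star_le hD hD0 ha)
  refine Finset.sum_congr rfl fun v _ => Finset.sum_congr rfl fun u _ =>
    Finset.sum_congr rfl fun w _ => by ring

lemma sum_nbhd_triple_le {a : ι → ℝ} (ha : ∀ v, 0 ≤ a v) (v u w : ι) :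
    ∑ x ∈ nbhd G {v, u, w}, a x
      ≤ ∑ x ∈ nbhd G {v}, a x + ∑ x ∈ nbhd G {u}, a x + ∑ x ∈ nbhd G {w}, a x := by
  have h1 := sum_nbhd_insert_le (G := G) ha v {u, w}
  have h2 := sum_nbhd_insert_le (G := G) ha u {w}
  linarith

lemma card_nbhd_triple_le (hD : ∀ v, ((nbhd G {v}).card : ℝ) ≤ D) (v u w : ι) :
    ((nbhd G {v, u, w}).card : ℝ) ≤ 3 * D := by
  have h1 := card_nbhd_insert_le (G := G) v {u, w}
  have h2 := card_nbhd_insert_le (G := G) u {w}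
  linarith [hD v, hD u, hD w]

lemma card_nbhd_pair_le (hD : ∀ v, ((nbhd G {v}).card : ℝ) ≤ D) (v u : ι) :
    ((nbhd G {v, u}).card : ℝ) ≤ 2 * D := by
  have h1 := card_nbhd_insert_le (G := G) v {u}
  linarith [hD v, hD u]

/-- Jensen's inequality for the absolute sum over a neighbourhood with at most `K` elements. -/
lemma absSum_div_rpow_le {Ω : Type*} {y : ι → Ω → ℝ} {A : Set ι} {K p : ℝ} (hK0 : 0 < K)
    (hK : ((nbhd G A).card : ℝ) ≤ K) (hp : 1 ≤ p) (ω : Ω) :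
    (absSum G y A ω / K) ^ p ≤ 1 / K * ∑ x ∈ nbhd G A, |y x ω| ^ p := by
  have h := Real.rpow_sum_le_const_mul_sum_rpow (nbhd G A) (fun x => y x ω) hp
  have h2 : ((nbhd G A).card : ℝ) ^ (p - 1) ≤ K ^ (p - 1) :=
    Real.rpow_le_rpow (Nat.cast_nonneg _) hK (by linarith)
  have h3 : 0 ≤ ∑ x ∈ nbhd G A, |y x ω| ^ p :=
    Finset.sum_nonneg fun x _ => Real.rpow_nonneg (abs_nonneg _) _
  rw [Real.div_rpow (absSum_nonneg A ω) hK0.le, div_le_iff₀ (Real.rpow_pos_of_pos hK0 p)]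
  refine (h.trans (mul_le_mul_of_nonneg_right h2 h3)).trans (le_of_eq ?_)
  rw [Real.rpow_sub_one hK0.ne']
  ring

end Counting

/-! ### Decoupled moment bounds -/

section Decoupling

variable {Ω : Type*} [MeasurableSpace Ω] {μ : Measure Ω} [IsProbabilityMeasure μ]

/-- Four versions of Young's inequality for the expectation of `a b c t ^ (p - 3)`: the product may
be split into expectations of products over independent copies. -/
lemma decoupled_young_four {p : ℝ} (hp : 3 ≤ p) {a b c t : Ω → ℝ} (ha : ∀ ω, 0 ≤ a ω)
    (hb : ∀ ω, 0 ≤ b ω) (hc : ∀ ω, 0 ≤ c ω) (ht : ∀ ω, 0 ≤ t ω) (ham : Measurable a)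
    (hbm : Measurable b) (hcm : Measurable c) (htm : Measurable t)
    (hai : Integrable (fun ω => a ω ^ p) μ) (hbi : Integrable (fun ω => b ω ^ p) μ)
    (hci : Integrable (fun ω => c ω ^ p) μ) (hti : Integrable (fun ω => t ω ^ p) μ) {R : ℝ}
    (hR : R = (∫ ω, a ω ^ p ∂μ + ∫ ω, b ω ^ p ∂μ + ∫ ω, c ω ^ p ∂μ) / p
      + (p - 3) / p * ∫ ω, t ω ^ p ∂μ) :
    (Integrable (fun ω => a ω * b ω * c ω * t ω ^ (p - 3)) μ ∧
      ∫ ω, a ω * b ω * c ω * t ω ^ (p - 3) ∂μ ≤ R) ∧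
    (∫ ω, a ω * b ω * c ω ∂μ) * ∫ ω, t ω ^ (p - 3) ∂μ ≤ R ∧
    (∫ ω, a ω * b ω ∂μ) * ∫ ω, c ω * t ω ^ (p - 3) ∂μ ≤ R ∧
    (∫ ω, a ω * b ω ∂μ) * ((∫ ω, c ω ∂μ) * ∫ ω, t ω ^ (p - 3) ∂μ) ≤ R ∧
    Integrable (fun ω => a ω * b ω * c ω) μ ∧ Integrable (fun ω => a ω * b ω) μ ∧
    Integrable (fun ω => c ω * t ω ^ (p - 3)) μ ∧ Integrable (fun ω => t ω ^ (p - 3)) μ ∧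
    Integrable c μ := by
  have hp0 : 0 < p := by linarith
  have hq : 0 ≤ (p - 3) / p := div_nonneg (by linarith) hp0.le
  have htp : ∀ ω, 0 ≤ t ω ^ (p - 3) := fun ω => Real.rpow_nonneg (ht ω) _
  have htpm : Measurable fun ω => t ω ^ (p - 3) := htm.pow_const _
  have hH : Integrable (fun ω => (a ω ^ p + b ω ^ p + c ω ^ p) / p + (p - 3) / p * t ω ^ p) μ :=
    (((hai.add hbi).add hci).div_const p).add (hti.const_mul _)
  have habc : Integrable (fun ω => (a ω ^ p + b ω ^ p + c ω ^ p) / p) μ :=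
    ((hai.add hbi).add hci).div_const p
  have hab : Integrable (fun ω => (a ω ^ p + b ω ^ p) / p) μ := (hai.add hbi).div_const p
  have hct : Integrable (fun ω => c ω ^ p / p + (p - 3) / p * t ω ^ p) μ :=
    (hci.div_const p).add (hti.const_mul _)
  have i1 : Integrable (fun ω => a ω * b ω * c ω * t ω ^ (p - 3)) μ := by
    refine integrable_of_nonneg_of_le (by fun_prop) (fun ω => ?_) hH fun ω =>
      young_four hp (ha ω) (hb ω) (hc ω) (ht ω)
    exact mul_nonneg (mul_nonneg (mul_nonneg (ha ω) (hb ω)) (hc ω)) (htp ω)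
  have i2 : Integrable (fun ω => a ω * b ω * c ω) μ := by
    refine integrable_of_nonneg_of_le (by fun_prop)
      (fun ω => mul_nonneg (mul_nonneg (ha ω) (hb ω)) (hc ω))
      (habc.add (integrable_const ((p - 3) / p))) fun ω => ?_
    simpa using young_four hp (ha ω) (hb ω) (hc ω) zero_le_one
  have i3 : Integrable (fun ω => a ω * b ω) μ := by
    refine integrable_of_nonneg_of_le (by fun_prop)
      (fun ω => mul_nonneg (ha ω) (hb ω))
      (((hai.add hbi).add (integrable_const 1)).div_const p |>.add
        (integrable_const ((p - 3) / p))) fun ω => ?_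
    simpa using young_four hp (ha ω) (hb ω) zero_le_one zero_le_one
  have i4 : Integrable (fun ω => c ω * t ω ^ (p - 3)) μ := by
    refine integrable_of_nonneg_of_le (by fun_prop)
      (fun ω => mul_nonneg (hc ω) (htp ω))
      ((((integrable_const (1 + 1)).add hci).div_const p).add (hti.const_mul ((p - 3) / p)))
      fun ω => ?_
    simpa using young_four hp zero_le_one zero_le_one (hc ω) (ht ω)
  have i5 : Integrable (fun ω => t ω ^ (p - 3)) μ := by
    refine integrable_of_nonneg_of_le (by fun_prop) htp
      ((integrable_const ((1 + 1 + 1) / p)).add (hti.const_mul ((p - 3) / p))) fun ω => ?_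
    simpa using young_four hp zero_le_one zero_le_one zero_le_one (ht ω)
  have i6 : Integrable c μ := by
    refine integrable_of_nonneg_of_le (by fun_prop) hc
      ((((integrable_const (1 + 1)).add hci).div_const p).add (integrable_const ((p - 3) / p)))
      fun ω => ?_
    simpa using young_four hp zero_le_one zero_le_one (hc ω) zero_le_one
  have e1 : ∫ ω, (a ω ^ p + b ω ^ p + c ω ^ p) / p ∂μ
      = (∫ ω, a ω ^ p ∂μ + ∫ ω, b ω ^ p ∂μ + ∫ ω, c ω ^ p ∂μ) / p := by
    rw [integral_div, integral_add (f := fun ω => a ω ^ p + b ω ^ p) (hai.add hbi) hci,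
      integral_add hai hbi]
  have e2 : ∫ ω, (a ω ^ p + b ω ^ p) / p ∂μ = (∫ ω, a ω ^ p ∂μ + ∫ ω, b ω ^ p ∂μ) / p := by
    rw [integral_div, integral_add hai hbi]
  have e3 : ∫ ω, (c ω ^ p / p + (p - 3) / p * t ω ^ p) ∂μ
      = (∫ ω, c ω ^ p ∂μ) / p + (p - 3) / p * ∫ ω, t ω ^ p ∂μ := by
    rw [integral_add (hci.div_const p) (hti.const_mul _), integral_div, integral_const_mul]
  refine ⟨⟨i1, ?_⟩, ?_, ?_, ?_, i2, i3, i4, i5, i6⟩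
  · have := integral_mono i1 hH fun ω => young_four hp (ha ω) (hb ω) (hc ω) (ht ω)
    refine this.trans (le_of_eq ?_)
    rw [integral_add habc (hti.const_mul _), e1, integral_const_mul, hR]
  · refine (integral_mul_integral_le i2 i5 habc (hti.const_mul ((p - 3) / p)) fun ω ω' =>
      young_four hp (ha ω) (hb ω) (hc ω) (ht ω')).trans (le_of_eq ?_)
    rw [e1, integral_const_mul, hR]
  · refine (integral_mul_integral_le i3 i4 hab hct fun ω ω' => ?_).trans (le_of_eq ?_)
    · have := young_four hp (ha ω) (hb ω) (hc ω') (ht ω')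
      rw [← mul_assoc]
      refine this.trans (le_of_eq (by ring))
    · rw [e2, e3, hR]; ring
  · -- decouple `c` from `t` for a frozen value of `a * b`, then integrate over `a * b`
    have h1 : ∀ ω, a ω * b ω * ((∫ ω, c ω ∂μ) * ∫ ω, t ω ^ (p - 3) ∂μ)
        ≤ (a ω ^ p + b ω ^ p) / p + ((∫ ω, c ω ^ p ∂μ) / p + (p - 3) / p * ∫ ω, t ω ^ p ∂μ) := by
      intro ω
      have := integral_mul_integral_le (i6.const_mul (a ω * b ω)) i5
        ((integrable_const ((a ω ^ p + b ω ^ p) / p)).add (hci.div_const p))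
        (hti.const_mul ((p - 3) / p)) fun ω' ω'' => by
          refine (young_four hp (ha ω) (hb ω) (hc ω') (ht ω'')).trans (le_of_eq ?_)
          simp only [Pi.add_apply]; ring
      simp only [Pi.add_apply] at this
      have e4 : ∫ ω, c ω ^ p / p ∂μ = (∫ ω, c ω ^ p ∂μ) / p := integral_div _ _
      rw [integral_const_mul, integral_add (integrable_const _) (hci.div_const p), e4,
        integral_const_mul] at this
      simp only [integral_const, probReal_univ, one_smul] at this
      linarith
    have h2 := integral_mono (i3.mul_const _) (hab.add (integrable_const _)) h1
    simp only [Pi.add_apply] at h2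
    rw [integral_mul_const, integral_add hab (integrable_const _), e2] at h2
    simp only [integral_const, probReal_univ, one_smul] at h2
    rw [hR]
    refine h2.trans (le_of_eq (by ring))

end Decoupling

/-! ### Normal approximation under moments of order between two and three -/

section StandardSum

variable {ι Ω : Type*} [Fintype ι] [MeasurableSpace Ω] {μ : Measure Ω} [IsProbabilityMeasure μ]
  {G : SimpleGraph ι} {y : ι → Ω → ℝ}

/-- Stein's equation turns the smoothing error into an expectation that involves the law of `U`
only. -/
lemma integral_ramp_map_sub {U : Ω → ℝ} (hU : Measurable U) (z h : ℝ) :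
    ∫ x, ramp z h x ∂(μ.map U) - rampMean z h
      = ∫ ω, (steinDeriv z h (U ω) - U ω * steinSol z h (U ω)) ∂μ := by
  have hp : IsProbabilityMeasure (μ.map U) := Measure.isProbabilityMeasure_map hU.aemeasurable
  rw [integral_map hU.aemeasurable (continuous_ramp z h).aestronglyMeasurable]
  have h1 : ∀ ω, steinDeriv z h (U ω) - U ω * steinSol z h (U ω)
      = ramp z h (U ω) - rampMean z h := fun ω => by rw [steinDeriv]; ring
  simp only [h1]
  have hi : Integrable (fun ω => ramp z h (U ω)) μ :=
    (integrable_map_measure (continuous_ramp z h).aestronglyMeasurable hU.aemeasurable).1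
      (integrable_ramp z h _)
  rw [integral_sub hi (integrable_const _)]
  simp

omit [IsProbabilityMeasure μ] in
lemma integrable_abs_rpow {X : Ω → ℝ} {p : ℝ} (hp : 0 < p)
    (hX : MemLp X (ENNReal.ofReal p) μ) : Integrable (fun ω => |X ω| ^ p) μ := by
  have := hX.integrable_norm_rpow (by simpa using hp) ENNReal.ofReal_ne_top
  simpa [ENNReal.toReal_ofReal hp.le] using this

omit [IsProbabilityMeasure μ] in
lemma integrable_absSum_div_rpow (hm : ∀ v, Measurable (y v)) {p K : ℝ} (hp : 1 ≤ p)
    (hy : ∀ v, Integrable (fun ω => |y v ω| ^ p) μ) {A : Set ι} (hK0 : 0 < K)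
    (hK : ((nbhd G A).card : ℝ) ≤ K) :
    Integrable (fun ω => (absSum G y A ω / K) ^ p) μ ∧
      ∫ ω, (absSum G y A ω / K) ^ p ∂μ
        ≤ 1 / K * ∑ x ∈ nbhd G A, ∫ ω, |y x ω| ^ p ∂μ := by
  have hs : Integrable (fun ω => 1 / K * ∑ x ∈ nbhd G A, |y x ω| ^ p) μ :=
    (integrable_finsetSum _ fun x _ => hy x).const_mul _
  have hi : Integrable (fun ω => (absSum G y A ω / K) ^ p) μ := by
    refine integrable_of_nonneg_of_le ?_ (fun ω => ?_) hs fun ω =>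
      absSum_div_rpow_le hK0 hK hp ω
    · exact ((measurable_absSum hm A).div_const K).pow_const p
    · exact Real.rpow_nonneg (div_nonneg (absSum_nonneg A ω) hK0.le) _
  refine ⟨hi, (integral_mono hi hs fun ω => absSum_div_rpow_le hK0 hK hp ω).trans (le_of_eq ?_)⟩
  rw [integral_const_mul, integral_finsetSum _ fun x _ => hy x]

/-- Interpolation between the bound and the Lipschitz bound for the derivative of the Stein
solution. -/
lemma abs_steinDeriv_sub_le_rpow {h : ℝ} (z : ℝ) (hh : 0 < h) (hh1 : h ≤ 1) {q : ℝ} (hq : 0 ≤ q)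
    (hq1 : q ≤ 1) (x x' : ℝ) :
    |steinDeriv z h x - steinDeriv z h x'| ≤ 2 * (1.26 / h) ^ q * |x - x'| ^ q := by
  rw [mul_assoc, ← Real.mul_rpow (by positivity) (abs_nonneg _)]
  set s := 1.26 / h * |x - x'| with hs
  have hs0 : 0 ≤ s := by positivity
  rcases le_total s 1 with h1 | h1
  · have h2 : s ≤ s ^ q := by
      rcases hs0.eq_or_lt with h0 | h0
      · rw [← h0]; exact Real.rpow_nonneg le_rfl _
      · calc s = s ^ (1 : ℝ) := (Real.rpow_one s).symm
          _ ≤ s ^ q := Real.rpow_le_rpow_of_exponent_ge h0 h1 hq1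
    refine (abs_steinDeriv_sub_le z hh hh1 x x').trans ?_
    have : 2.52 / h * |x - x'| = 2 * s := by rw [hs]; ring
    linarith
  · have h2 : 1 ≤ s ^ q := Real.one_le_rpow h1 hq
    have h3 := abs_sub (steinDeriv z h x) (steinDeriv z h x')
    linarith [abs_steinDeriv_le z hh x, abs_steinDeriv_le z hh x']

/-- Moments of order `p ∈ (2, 3]` only control the Hölder modulus of the derivative of the Stein
solution; the resulting error for a smoothing width `h` is of order `h ^ (2 - p)`. -/
lemma abs_integral_ramp_sub_le (hG : IsDependencyGraph G y μ) (hm : ∀ v, Measurable (y v))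
    {p : ℝ} (hp : 2 < p) (hp3 : p ≤ 3) (hy : ∀ v, MemLp (y v) (ENNReal.ofReal p) μ)
    (h0 : ∀ v, ∫ ω, y v ω ∂μ = 0) (h1 : ∫ ω, (∑ v, y v ω) ^ 2 ∂μ = 1) {D : ℝ} (hD0 : 0 < D)
    (hD : ∀ v, ((nbhd G {v}).card : ℝ) ≤ D) {h : ℝ} (hh : 0 < h) (hh1 : h ≤ 1) (z : ℝ) :
    |∫ x, ramp z h x ∂(μ.map fun ω => ∑ v, y v ω) - rampMean z h| ≤
      8 * (1.26 / h) ^ (p - 2) * D ^ (p - 1) * ∑ v, ∫ ω, |y v ω| ^ p ∂μ := by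
  have hp0 : 0 < p := by linarith
  have hyp : ∀ v, Integrable (fun ω => |y v ω| ^ p) μ := fun v => integrable_abs_rpow hp0 (hy v)
  have hy2 : ∀ v, MemLp (y v) 2 μ := fun v => (hy v).mono_exponent (by
    rw [show (2 : ℝ≥0∞) = ENNReal.ofReal 2 by simp]; exact ENNReal.ofReal_le_ofReal hp.le)
  set U : Ω → ℝ := fun ω => ∑ v, y v ω with hU
  have hUm : Measurable U := by simp only [hU]; fun_prop
  set M : ι → ℝ := fun v => ∫ ω, |y v ω| ^ p ∂μ with hM
  have hM0 : ∀ v, 0 ≤ M v := fun v => integral_nonneg fun ω => Real.rpow_nonneg (abs_nonneg _) _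
  set S : ι → ℝ := fun v => ∑ x ∈ nbhd G {v}, M x with hS
  have hS0 : ∀ v, 0 ≤ S v := fun v => Finset.sum_nonneg fun x _ => hM0 x
  have hSM : ∑ v, S v ≤ D * ∑ v, M v := sum_sum_nbhd_right_le hD hM0
  have hβ0 : 0 ≤ ∑ v, M v := Finset.sum_nonneg fun v _ => hM0 v
  rw [integral_ramp_map_sub hUm]
  refine (abs_integral_stein_le hG hm hy2 h0 h1 (continuous_steinSol z h)
    (continuous_steinDeriv z h) (C := 1.26) (C' := 1)
    (fun x => by rw [abs_of_nonneg (steinSol_nonneg z hh x)]; exact steinSol_le z h x)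
    (abs_steinDeriv_le z hh)).trans ?_
  set C : ℝ := 2 * (1.26 / h) ^ (p - 2) with hC
  have hC0 : 0 ≤ C := by positivity
  have hφ : ∀ x x' s, |x - x'| ≤ s →
      |steinDeriv z h x - steinDeriv z h x'| ≤ C * s ^ (p - 2) := by
    intro x x' s hs
    refine (abs_steinDeriv_sub_le_rpow z hh hh1 (q := p - 2) (by linarith) (by linarith) x x').trans
      (mul_le_mul_of_nonneg_left ?_ hC0)
    exact Real.rpow_le_rpow (abs_nonneg _) hs (by linarith)
  have hmS : ∀ A, Measurable (absSum G y A) := measurable_absSum hm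
  have hmφ := (continuous_steinDeriv z h).measurable
  have hmR : ∀ A, Measurable (restSum G y A) := measurable_restSum hm
  -- the Taylor remainders
  have hT1 : ∀ v, ∫ ω, |y v ω| * |steinSol z h (∑ v, y v ω) - steinSol z h (restSum G y {v} ω)
      - (∑ v, y v ω - restSum G y {v} ω) * steinDeriv z h (restSum G y {v} ω)| ∂μ
      ≤ C * D ^ (p - 1) * (M v / p + (p - 1) / p * (1 / D * S v)) := by
    intro v
    obtain ⟨ht, ht'⟩ := integrable_absSum_div_rpow hm (by linarith : 1 ≤ p) hyp (A := {v}) hD0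
      (hD v)
    have hi : Integrable (fun ω => C * D ^ (p - 1)
        * (|y v ω| ^ p / p + (p - 1) / p * (absSum G y {v} ω / D) ^ p)) μ :=
      (((hyp v).div_const p).add (ht.const_mul _)).const_mul _
    refine (integral_mono_of_nonneg (Eventually.of_forall fun ω => by positivity) hi
      (Eventually.of_forall fun ω => ?_)).trans ?_
    · simp only
      have hη := abs_sum_sub_restSum_le (G := G) (y := y) {v} ω
      have hS1 := absSum_nonneg (G := G) (y := y) {v} ω
      have h2 := abs_taylor_le_of_abs_sub_le (hasDerivAt_steinSol z h)
        (a := restSum G y {v} ω) (b := ∑ v, y v ω)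
        (M := C * absSum G y {v} ω ^ (p - 2)) (fun t ht => hφ _ _ _ (ht.trans hη))
      have h3 : |∑ v, y v ω - restSum G y {v} ω| * (C * absSum G y {v} ω ^ (p - 2))
          ≤ C * absSum G y {v} ω ^ (p - 1) := by
        refine (mul_le_mul_of_nonneg_right hη
          (mul_nonneg hC0 (Real.rpow_nonneg hS1 _))).trans (le_of_eq ?_)
        rw [show p - 1 = 1 + (p - 2) by ring, Real.rpow_add' hS1 (by linarith), Real.rpow_one]
        ring
      have h4 := young_two (p := p) (by linarith) (abs_nonneg (y v ω))
        (div_nonneg hS1 hD0.le)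
      rw [Real.div_rpow hS1 hD0.le] at h4
      have hDp : 0 < D ^ (p - 1) := Real.rpow_pos_of_pos hD0 _
      calc _ ≤ |y v ω| * (C * absSum G y {v} ω ^ (p - 1)) :=
            mul_le_mul_of_nonneg_left (h2.trans h3) (abs_nonneg _)
        _ = C * D ^ (p - 1) * (|y v ω| * (absSum G y {v} ω ^ (p - 1) / D ^ (p - 1))) := by
            field_simp
        _ ≤ _ := mul_le_mul_of_nonneg_left h4 (by positivity)
    · rw [integral_const_mul, integral_add ((hyp v).div_const p) (ht.const_mul _), integral_div,
        integral_const_mul]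
      have : 0 ≤ (p - 1) / p := div_nonneg (by linarith) hp0.le
      gcongr
  -- the fluctuation terms
  have hyoung : ∀ v u (A : Set ι) K, 0 < K → ((nbhd G A).card : ℝ) ≤ K →
      (∫ ω, |y v ω * y u ω| * (C * absSum G y A ω ^ (p - 2)) ∂μ ≤
        C * K ^ (p - 2) * ((M v + M u) / p + (p - 2) / p * (1 / K * ∑ x ∈ nbhd G A, M x))) ∧
      ((∫ ω, |y v ω * y u ω| ∂μ) * ∫ ω, C * absSum G y A ω ^ (p - 2) ∂μ ≤
        C * K ^ (p - 2) * ((M v + M u) / p + (p - 2) / p * (1 / K * ∑ x ∈ nbhd G A, M x))) ∧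
      Integrable (fun ω => |y v ω * y u ω| * (C * absSum G y A ω ^ (p - 2))) μ ∧
      Integrable (fun ω => C * absSum G y A ω ^ (p - 2)) μ := by
    intro v u A K hK0 hK
    obtain ⟨ht, ht'⟩ := integrable_absSum_div_rpow hm (by linarith : 1 ≤ p) hyp (A := A) hK0 hK
    have hKp : 0 < K ^ (p - 2) := Real.rpow_pos_of_pos hK0 _
    have hq : 0 ≤ (p - 2) / p := div_nonneg (by linarith) hp0.le
    have hab : Integrable (fun ω => (|y v ω| ^ p + |y u ω| ^ p) / p) μ :=
      ((hyp v).add (hyp u)).div_const p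
    have hab' : ∫ ω, (|y v ω| ^ p + |y u ω| ^ p) / p ∂μ = (M v + M u) / p := by
      rw [integral_div, integral_add (hyp v) (hyp u)]
    have hpt : ∀ ω ω', |y v ω * y u ω| * (C * absSum G y A ω' ^ (p - 2))
        ≤ C * K ^ (p - 2) * ((|y v ω| ^ p + |y u ω| ^ p) / p
          + (p - 2) / p * (absSum G y A ω' / K) ^ p) := by
      intro ω ω'
      have hS1 := absSum_nonneg (G := G) (y := y) A ω'
      have h4 := young_three (p := p) hp.le (abs_nonneg (y v ω)) (abs_nonneg (y u ω))
        (div_nonneg hS1 hK0.le)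
      rw [Real.div_rpow hS1 hK0.le] at h4
      calc _ = C * K ^ (p - 2)
            * (|y v ω| * |y u ω| * (absSum G y A ω' ^ (p - 2) / K ^ (p - 2))) := by
            rw [abs_mul]; field_simp
        _ ≤ _ := mul_le_mul_of_nonneg_left h4 (by positivity)
    have hrhs : Integrable (fun ω => C * K ^ (p - 2) * ((|y v ω| ^ p + |y u ω| ^ p) / p
          + (p - 2) / p * (absSum G y A ω / K) ^ p)) μ := (hab.add (ht.const_mul _)).const_mul _
    have hi1 : Integrable (fun ω => |y v ω * y u ω| * (C * absSum G y A ω ^ (p - 2))) μ := by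
      refine integrable_of_nonneg_of_le ?_ (fun ω => ?_) hrhs fun ω => hpt ω ω
      · have := (hmS A).pow_const (p - 2)
        have := ((hm v).mul (hm u)).abs
        exact Measurable.mul this (by fun_prop)
      · exact mul_nonneg (abs_nonneg _)
          (mul_nonneg hC0 (Real.rpow_nonneg (absSum_nonneg A ω) _))
    have hi2 : Integrable (fun ω => C * absSum G y A ω ^ (p - 2)) μ := by
      refine integrable_of_nonneg_of_le ((hmS A).pow_const (p - 2) |>.const_mul C)
        (fun ω => mul_nonneg hC0 (Real.rpow_nonneg (absSum_nonneg A ω) _))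
        (((integrable_const ((1 + 1) / p)).add (ht.const_mul ((p - 2) / p))).const_mul
          (C * K ^ (p - 2))) fun ω => ?_
      have hS1 := absSum_nonneg (G := G) (y := y) A ω
      have h4 := young_three (p := p) hp.le zero_le_one zero_le_one
        (div_nonneg hS1 hK0.le)
      rw [Real.div_rpow hS1 hK0.le] at h4
      simp only [one_mul, Real.one_rpow] at h4
      calc _ = C * K ^ (p - 2) * (absSum G y A ω ^ (p - 2) / K ^ (p - 2)) := by field_simp
        _ ≤ C * K ^ (p - 2) * _ := mul_le_mul_of_nonneg_left h4 (by positivity)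
        _ = _ := by simp only [Pi.add_apply]
    refine ⟨?_, ?_, hi1, hi2⟩
    · refine (integral_mono hi1 hrhs fun ω => hpt ω ω).trans ?_
      rw [integral_const_mul, integral_add hab (ht.const_mul _), hab', integral_const_mul]
      gcongr
    · refine (integral_mul_integral_le (((hy2 v).integrable_mul (hy2 u)).abs) hi2
        (hab.const_mul (C * K ^ (p - 2)))
        ((ht.const_mul ((p - 2) / p)).const_mul (C * K ^ (p - 2))) fun ω ω' => ?_).trans ?_
      · refine (hpt ω ω').trans (le_of_eq (by ring))
      · rw [integral_const_mul, integral_const_mul, integral_const_mul, hab', ← mul_add]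
        gcongr
  have hT2 : ∀ v u, ∫ ω, |y v ω * y u ω|
        * |steinDeriv z h (restSum G y {v} ω) - steinDeriv z h (restSum G y {v, u} ω)| ∂μ
      ≤ C * D ^ (p - 2) * ((M v + M u) / p + (p - 2) / p * (1 / D * S u)) := by
    intro v u
    obtain ⟨k1, -, k3, -⟩ := hyoung v u {u} D hD0 (hD u)
    refine (integral_mono_of_nonneg (Eventually.of_forall fun ω => by positivity) k3
      (Eventually.of_forall fun ω => ?_)).trans k1
    exact mul_le_mul_of_nonneg_left (hφ _ _ _ (abs_restSum_sub_restSum_pair_le v u ω))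
      (abs_nonneg _)
  have hT3 : ∀ v u, (∫ ω, |y v ω * y u ω| ∂μ)
        * ∫ ω, |steinDeriv z h (restSum G y {v, u} ω) - steinDeriv z h (∑ v, y v ω)| ∂μ
      ≤ C * (2 * D ^ (p - 2)) * ((M v + M u) / p + (p - 2) / p * (1 / (2 * D) * (S v + S u))) := by
    intro v u
    obtain ⟨-, k2, -, k4⟩ := hyoung v u {v, u} (2 * D) (by positivity) (card_nbhd_pair_le hD v u)
    refine (mul_le_mul_of_nonneg_left (integral_mono_of_nonneg
      (Eventually.of_forall fun ω => by positivity) k4 (Eventually.of_forall fun ω => ?_))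
      (integral_nonneg fun _ => abs_nonneg _)).trans (k2.trans ?_)
    · refine hφ _ _ _ ?_
      rw [abs_sub_comm]; exact abs_sum_sub_restSum_le _ ω
    · have h5 : (2 * D) ^ (p - 2) ≤ 2 * D ^ (p - 2) := by
        rw [Real.mul_rpow (by norm_num) hD0.le]
        refine mul_le_mul_of_nonneg_right ?_ (Real.rpow_nonneg hD0.le _)
        calc (2 : ℝ) ^ (p - 2) ≤ 2 ^ (1 : ℝ) :=
              Real.rpow_le_rpow_of_exponent_le (by norm_num) (by linarith)
          _ = 2 := Real.rpow_one 2
      have h6 : ∑ x ∈ nbhd G {v, u}, M x ≤ S v + S u := sum_nbhd_insert_le hM0 v {u}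
      have hq : 0 ≤ (p - 2) / p := div_nonneg (by linarith) hp0.le
      have h7 : 0 ≤ (M v + M u) / p := div_nonneg (add_nonneg (hM0 v) (hM0 u)) hp0.le
      have h8 : 0 ≤ ∑ x ∈ nbhd G {v, u}, M x := Finset.sum_nonneg fun x _ => hM0 x
      have h9 : 0 ≤ S v + S u := add_nonneg (hS0 v) (hS0 u)
      gcongr
  have hsum1 : ∑ v, C * D ^ (p - 1) * (M v / p + (p - 1) / p * (1 / D * S v))
      ≤ C * D ^ (p - 1) * ∑ v, M v := by
    rw [← Finset.mul_sum, Finset.sum_add_distrib, ← Finset.sum_div, ← Finset.mul_sum,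
      ← Finset.mul_sum]
    refine mul_le_mul_of_nonneg_left ?_ (by positivity)
    have h5 : 1 / D * ∑ v, S v ≤ ∑ v, M v := by
      rw [one_div_mul_eq_div, div_le_iff₀ hD0, mul_comm]; exact hSM
    have hq : 0 ≤ (p - 1) / p := div_nonneg (by linarith) hp0.le
    refine (add_le_add le_rfl (mul_le_mul_of_nonneg_left h5 hq)).trans (le_of_eq ?_)
    field_simp; ring
  have hMM : ∑ v, ∑ u ∈ nbhd G {v}, (M v + M u) ≤ 2 * (D * ∑ v, M v) := by
    simp only [Finset.sum_add_distrib]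
    have := sum_sum_nbhd_left_le hD hM0
    have := sum_sum_nbhd_right_le hD hM0
    simp only [Finset.sum_const] at *
    linarith
  have hSr : ∑ v, ∑ u ∈ nbhd G {v}, S u ≤ D * (D * ∑ v, M v) :=
    (sum_sum_nbhd_right_le hD hS0).trans (mul_le_mul_of_nonneg_left hSM hD0.le)
  have hSl : ∑ v, ∑ _u ∈ nbhd G {v}, S v ≤ D * (D * ∑ v, M v) :=
    (sum_sum_nbhd_left_le hD hS0).trans (mul_le_mul_of_nonneg_left hSM hD0.le)
  have hq : 0 ≤ (p - 2) / p := div_nonneg (by linarith) hp0.le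
  have hDD : D ^ (p - 1) = D ^ (p - 2) * D := by
    rw [show p - 1 = (p - 2) + 1 by ring, Real.rpow_add hD0, Real.rpow_one]
  have hDq : 0 < D ^ (p - 2) := Real.rpow_pos_of_pos hD0 _
  have hsum2 : ∑ v, ∑ u ∈ nbhd G {v},
      C * D ^ (p - 2) * ((M v + M u) / p + (p - 2) / p * (1 / D * S u))
      ≤ C * D ^ (p - 1) * ∑ v, M v := by
    simp only [← Finset.mul_sum, Finset.sum_add_distrib (f := fun u => (_ : ℝ) / p),
      ← Finset.sum_div]
    rw [hDD]
    calc _ ≤ C * D ^ (p - 2) * (2 * (D * ∑ v, M v) / p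
            + (p - 2) / p * (1 / D * (D * (D * ∑ v, M v)))) := by
          gcongr
      _ = _ := by field_simp; ring
  have hsum3 : ∑ v, ∑ u ∈ nbhd G {v},
      C * (2 * D ^ (p - 2)) * ((M v + M u) / p + (p - 2) / p * (1 / (2 * D) * (S v + S u)))
      ≤ 2 * (C * D ^ (p - 1) * ∑ v, M v) := by
    have h5 : ∑ v, ∑ u ∈ nbhd G {v}, (S v + S u) ≤ 2 * (D * (D * ∑ v, M v)) := by
      simp only [Finset.sum_add_distrib]; linarith
    simp only [← Finset.mul_sum, Finset.sum_add_distrib (f := fun u => (_ : ℝ) / p),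
      ← Finset.sum_div]
    rw [hDD]
    calc _ ≤ C * (2 * D ^ (p - 2)) * (2 * (D * ∑ v, M v) / p
            + (p - 2) / p * (1 / (2 * D) * (2 * (D * (D * ∑ v, M v))))) := by
          gcongr
      _ = _ := by field_simp; ring
  calc _ ≤ ∑ v, C * D ^ (p - 1) * (M v / p + (p - 1) / p * (1 / D * S v))
        + ∑ v, ∑ u ∈ nbhd G {v},
          (C * D ^ (p - 2) * ((M v + M u) / p + (p - 2) / p * (1 / D * S u))
          + C * (2 * D ^ (p - 2))
            * ((M v + M u) / p + (p - 2) / p * (1 / (2 * D) * (S v + S u)))) := by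
        refine add_le_add (Finset.sum_le_sum fun v _ => hT1 v)
          (Finset.sum_le_sum fun v _ => Finset.sum_le_sum fun u _ => ?_)
        exact add_le_add (hT2 v u) (hT3 v u)
    _ ≤ C * D ^ (p - 1) * ∑ v, M v
        + (C * D ^ (p - 1) * ∑ v, M v + 2 * (C * D ^ (p - 1) * ∑ v, M v)) := by
        refine add_le_add hsum1 ?_
        rw [Finset.sum_congr rfl fun v _ => Finset.sum_add_distrib, Finset.sum_add_distrib]
        exact add_le_add hsum2 hsum3
    _ = _ := by rw [hC]; ring

end StandardSum

/-! ### Normal approximation under moments of order at least three -/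

/-- The modulus of continuity, on scale `l` around the point `q`, of the derivative of the Stein
solution for `ramp z h`. -/
def steinModulus (z h l q : ℝ) : ℝ :=
  min (2.52 / h) (1.26 + |q| + l + (Set.Ioc (z - l) (z + h + l)).indicator (fun _ => 1 / h) q)

lemma steinModulus_le (z h l q : ℝ) : steinModulus z h l q ≤ 2.52 / h := min_le_left _ _

lemma steinModulus_nonneg {h l : ℝ} (z : ℝ) (hh : 0 < h) (hl : 0 ≤ l) (q : ℝ) :
    0 ≤ steinModulus z h l q := by
  refine le_min (by positivity) ?_
  have : 0 ≤ (Set.Ioc (z - l) (z + h + l)).indicator (fun _ => 1 / h) q :=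
    Set.indicator_nonneg (fun _ _ => by positivity) _
  positivity

lemma measurable_steinModulus (z h l : ℝ) : Measurable (steinModulus z h l) := by
  unfold steinModulus
  have h1 : Measurable ((Set.Ioc (z - l) (z + h + l)).indicator fun _ : ℝ => 1 / h) :=
    measurable_const.indicator measurableSet_Ioc
  have h2 : Measurable fun q : ℝ => |q| := by fun_prop
  exact measurable_const.min (((h2.const_add 1.26).add_const l).add h1)

/-- If two points are within `θ` of `q`, then the derivative of the Stein solution oscillates
between them like `steinModulus z h l q` when `θ ≤ l`; the second summand is a Markov-type
majorant of the exceptional case `l < θ`. -/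
lemma abs_steinDeriv_sub_le_modulus {h l θ r : ℝ} (z : ℝ) (hh : 0 < h) (hh1 : h ≤ 1) (hl : 0 < l)
    (hr : 0 ≤ r) (q x x' : ℝ) (hx : |x - q| ≤ θ) (hx' : |x' - q| ≤ θ) :
    |steinDeriv z h x - steinDeriv z h x'|
      ≤ (steinModulus z h l q + 2.52 / h * (θ / l) ^ r) * |x - x'| := by
  have hθ : 0 ≤ θ := (abs_nonneg _).trans hx
  have hk : 0 < 2.52 / h := by positivity
  have hp : 0 ≤ (θ / l) ^ r := Real.rpow_nonneg (div_nonneg hθ hl.le) _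
  rcases le_or_gt θ l with hle | hgt
  · have h1 : |steinDeriv z h x - steinDeriv z h x'| ≤ steinModulus z h l q * |x - x'| := by
      rw [steinModulus, min_mul_of_nonneg _ _ (abs_nonneg _)]
      exact le_min (abs_steinDeriv_sub_le z hh hh1 x x')
        (abs_steinDeriv_sub_le_local z hh q x x' (hx.trans hle) (hx'.trans hle))
    refine h1.trans (mul_le_mul_of_nonneg_right ?_ (abs_nonneg _))
    exact le_add_of_nonneg_right (mul_nonneg hk.le hp)
  · refine (abs_steinDeriv_sub_le z hh hh1 x x').trans
      (mul_le_mul_of_nonneg_right ?_ (abs_nonneg _))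
    have h1 : 1 ≤ (θ / l) ^ r := Real.one_le_rpow ((one_le_div hl).2 hgt.le) hr
    nlinarith [steinModulus_nonneg z hh hl.le q]

section Bootstrap

variable {ι Ω : Type*} [Fintype ι] [MeasurableSpace Ω] {μ : Measure Ω} [IsProbabilityMeasure μ]
  {G : SimpleGraph ι} {y : ι → Ω → ℝ}

/-- An upper bound for the mean modulus, in terms of the Kolmogorov distance `d` that is to be
estimated: the interval where the modulus is of order `1 / h` has mass at most
`0.4 * (h + 4 * l) + 2 * d`. -/
def modulusBound (h l d : ℝ) : ℝ := 2.26 + 2 * l + (0.4 * (h + 4 * l) + 2 * d) / h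

/-- The mean modulus at a point that is independent of the variables in `A`. Removing the
neighbourhood of `A` from the sum shifts it by more than `l` only on an event that is controlled by
a moment of `absSum`; otherwise the law of the full sum decides how often the interval around
`[z, z + h]` is hit. -/
lemma integral_steinModulus_le (hm : ∀ v, Measurable (y v))
    (hU2 : Integrable (fun ω => (∑ v, y v ω) ^ 2) μ) (h1 : ∫ ω, (∑ v, y v ω) ^ 2 ∂μ = 1)
    {h l r : ℝ} (hh : 0 < h) (hl : 0 < l) (hr : 0 ≤ r) (z : ℝ) (A : Set ι)
    (hi : Integrable (fun ω => (absSum G y A ω / l) ^ r) μ) :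
    ∫ ω, steinModulus z h l (restSum G y A ω) ∂μ ≤
      modulusBound h l (kolmogorovDist (μ.map fun ω => ∑ v, y v ω) (gaussianReal 0 1))
        + 2.52 / h * ∫ ω, (absSum G y A ω / l) ^ r ∂μ := by
  set U : Ω → ℝ := fun ω => ∑ v, y v ω with hU
  have hUm : Measurable U := by simp only [hU]; fun_prop
  have hP : IsProbabilityMeasure (μ.map U) := Measure.isProbabilityMeasure_map hUm.aemeasurable
  set I : Set ℝ := Set.Ioc (z - 2 * l) (z + h + 2 * l) with hI
  have hIm : MeasurableSet (U ⁻¹' I) := hUm measurableSet_Ioc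
  have hk : 0 < 2.52 / h := by positivity
  have hpt : ∀ ω, steinModulus z h l (restSum G y A ω) ≤
      1.26 + (1 + U ω ^ 2) / 2 + 2 * l + (U ⁻¹' I).indicator (fun _ => 1 / h) ω
        + 2.52 / h * (absSum G y A ω / l) ^ r := by
    intro ω
    have hd := abs_sum_sub_restSum_le (G := G) (y := y) A ω
    have hθ := absSum_nonneg (G := G) (y := y) A ω
    have hp : 0 ≤ (absSum G y A ω / l) ^ r := Real.rpow_nonneg (div_nonneg hθ hl.le) _
    have hind : 0 ≤ (U ⁻¹' I).indicator (fun _ => 1 / h) ω :=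
      Set.indicator_nonneg (fun _ _ => by positivity) _
    have hU1 : |U ω| ≤ (1 + U ω ^ 2) / 2 := by nlinarith [sq_nonneg (|U ω| - 1), sq_abs (U ω)]
    rcases le_or_gt (absSum G y A ω) l with hle | hgt
    · have h2 : |U ω - restSum G y A ω| ≤ l := hd.trans hle
      have h3 := abs_le.1 h2
      have h4 : |restSum G y A ω| ≤ |U ω| + l := by
        have := abs_sub_abs_le_abs_sub (restSum G y A ω) (U ω)
        rw [abs_sub_comm] at this
        linarith
      have h5 : (Set.Ioc (z - l) (z + h + l)).indicator (fun _ => 1 / h) (restSum G y A ω)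
          ≤ (U ⁻¹' I).indicator (fun _ => 1 / h) ω := by
        by_cases hmem : restSum G y A ω ∈ Set.Ioc (z - l) (z + h + l)
        · have : ω ∈ U ⁻¹' I := ⟨by linarith [hmem.1], by linarith [hmem.2]⟩
          rw [Set.indicator_of_mem hmem, Set.indicator_of_mem this]
        · rw [Set.indicator_of_notMem hmem]; exact hind
      have h6 := min_le_right (2.52 / h) (1.26 + |restSum G y A ω| + l
        + (Set.Ioc (z - l) (z + h + l)).indicator (fun _ => 1 / h) (restSum G y A ω))
      rw [← steinModulus] at h6
      have := mul_nonneg hk.le hp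
      linarith
    · have h2 : 1 ≤ (absSum G y A ω / l) ^ r := Real.one_le_rpow ((one_le_div hl).2 hgt.le) hr
      have h3 := steinModulus_le z h l (restSum G y A ω)
      nlinarith [sq_nonneg (U ω)]
  have i1 : Integrable (fun ω => 1.26 + (1 + U ω ^ 2) / 2 + 2 * l) μ :=
    ((integrable_const _).add (((integrable_const _).add hU2).div_const 2)).add
      (integrable_const _)
  have i2 : Integrable ((U ⁻¹' I).indicator fun _ => 1 / h) μ :=
    (integrable_const _).indicator hIm
  have i3 : Integrable (fun ω => 1.26 + (1 + U ω ^ 2) / 2 + 2 * l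
      + (U ⁻¹' I).indicator (fun _ => 1 / h) ω) μ := i1.add i2
  refine (integral_mono_of_nonneg (Eventually.of_forall fun ω => steinModulus_nonneg z hh hl.le _)
    (i3.add (hi.const_mul _)) (Eventually.of_forall hpt)).trans ?_
  simp only [Pi.add_apply]
  rw [integral_add i3 (hi.const_mul _), integral_const_mul, integral_add i1 i2,
    integral_indicator hIm]
  have e1 : ∫ ω, (1.26 + (1 + U ω ^ 2) / 2 + 2 * l) ∂μ = 2.26 + 2 * l := by
    have hU2' : Integrable (fun ω => (1 + U ω ^ 2) / 2) μ :=
      ((integrable_const _).add hU2).div_const 2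
    rw [integral_add (f := fun ω => 1.26 + (1 + U ω ^ 2) / 2)
      ((integrable_const _).add hU2') (integrable_const _),
      integral_add (integrable_const _) hU2', integral_div, integral_add (integrable_const _) hU2,
      h1]
    simp only [integral_const, probReal_univ, one_smul]
    norm_num
  have e2 : ∫ _ω in U ⁻¹' I, 1 / h ∂μ = (μ.map U).real I / h := by
    rw [map_measureReal_apply hUm measurableSet_Ioc]
    rw [setIntegral_const, smul_eq_mul, mul_one_div]
  have e3 := measureReal_Ioc_le (μ.map U) (show z - 2 * l ≤ z + h + 2 * l by linarith)
  rw [e1, e2, modulusBound]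
  refine add_le_add (add_le_add le_rfl (div_le_div_of_nonneg_right (e3.trans (le_of_eq ?_)) hh.le))
    le_rfl
  ring

/-- The bound for the contribution of the triple `v, u, w` to the Stein expansion. The arguments `m`
and `M` stand for the third and the `p`-th absolute moments, `Ψ` for the mean modulus, and `κ` for
the weight of the exceptional event. -/
def tripleBound (G : SimpleGraph ι) (m M : ι → ℝ) (p D κ Ψ : ℝ) (v u w : ι) : ℝ :=
  (m v + m u + m w) / 3 * Ψ + 2 * κ * ((M v + M u + M w) / p + (p - 3) / p * (1 / (3 * D)
    * (∑ x ∈ nbhd G {v}, M x + ∑ x ∈ nbhd G {u}, M x + ∑ x ∈ nbhd G {w}, M x)))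

/-- Contribution of one triple of indices. As `restSum G y {v, u, w}` is independent of the three
variables, its modulus factors out; the exceptional part is split by the decoupled Young
inequality. -/
lemma triple_le (hG : IsDependencyGraph G y μ) (hm : ∀ v, Measurable (y v))
    {p : ℝ} (hp : 3 ≤ p) (hy : ∀ v, MemLp (y v) (ENNReal.ofReal p) μ)
    (h1 : ∫ ω, (∑ v, y v ω) ^ 2 ∂μ = 1) {D : ℝ} (hD0 : 0 < D)
    (hD : ∀ v, ((nbhd G {v}).card : ℝ) ≤ D) {h l : ℝ} (hh : 0 < h) (hl : 0 < l)
    (z : ℝ) (v u w : ι) {κ Ψ B : ℝ} (hκ : κ = 2.52 / h * (3 * D / l) ^ (p - 3))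
    (hΨ : Ψ = modulusBound h l (kolmogorovDist (μ.map fun ω => ∑ v, y v ω) (gaussianReal 0 1)))
    (hB : B = tripleBound G (fun v => ∫ ω, |y v ω| ^ (3 : ℝ) ∂μ) (fun v => ∫ ω, |y v ω| ^ p ∂μ)
      p D κ Ψ v u w) :
    Integrable (fun ω => |y v ω| * |y u ω| * |y w ω| *
      (steinModulus z h l (restSum G y {v, u, w} ω)
        + 2.52 / h * (absSum G y {v, u, w} ω / l) ^ (p - 3))) μ ∧
    ∫ ω, |y v ω| * |y u ω| * |y w ω| *
      (steinModulus z h l (restSum G y {v, u, w} ω)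
        + 2.52 / h * (absSum G y {v, u, w} ω / l) ^ (p - 3)) ∂μ ≤ B ∧
    Integrable (fun ω => |y w ω| *
      (steinModulus z h l (restSum G y {v, u, w} ω)
        + 2.52 / h * (absSum G y {v, u, w} ω / l) ^ (p - 3))) μ ∧
    (∫ ω, |y v ω| * |y u ω| ∂μ) * ∫ ω, |y w ω| *
      (steinModulus z h l (restSum G y {v, u, w} ω)
        + 2.52 / h * (absSum G y {v, u, w} ω / l) ^ (p - 3)) ∂μ ≤ B := by
  have hp0 : 0 < p := by linarith
  set A : Set ι := {v, u, w} with hA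
  have hK0 : 0 < 3 * D := by positivity
  have hcard : ((nbhd G A).card : ℝ) ≤ 3 * D := card_nbhd_triple_le hD v u w
  have hyp : ∀ v, Integrable (fun ω => |y v ω| ^ p) μ := fun v => integrable_abs_rpow hp0 (hy v)
  have hy3 : ∀ v, MemLp (y v) (ENNReal.ofReal 3) μ := fun v =>
    (hy v).mono_exponent (ENNReal.ofReal_le_ofReal hp)
  have hyp3 : ∀ v, Integrable (fun ω => |y v ω| ^ (3 : ℝ)) μ := fun v =>
    integrable_abs_rpow (by norm_num) (hy3 v)
  have hy2 : ∀ v, MemLp (y v) 2 μ := fun v => (hy v).mono_exponent (by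
    rw [show (2 : ℝ≥0∞) = ENNReal.ofReal 2 by simp]
    exact ENNReal.ofReal_le_ofReal (by linarith))
  have hU2 : Integrable (fun ω => (∑ v, y v ω) ^ 2) μ :=
    (memLp_finsetSum _ fun v _ => hy2 v).integrable_sq
  set t : Ω → ℝ := fun ω => absSum G y A ω / (3 * D) with ht
  have htm : Measurable t := (measurable_absSum hm A).div_const _
  have ht0 : ∀ ω, 0 ≤ t ω := fun ω => div_nonneg (absSum_nonneg A ω) hK0.le
  obtain ⟨hti, hti'⟩ := integrable_absSum_div_rpow hm (by linarith : 1 ≤ p) hyp (A := A) hK0 hcard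
  have hamp : ∀ v, Measurable fun ω => |y v ω| := fun v => (hm v).abs
  have ha0 : ∀ v ω, 0 ≤ |y v ω| := fun v ω => abs_nonneg _
  obtain ⟨⟨j1, c1⟩, c2, c3, c4, j2, j3, j4, j5, j6⟩ := decoupled_young_four hp (ha0 v) (ha0 u)
    (ha0 w) ht0 (hamp v) (hamp u) (hamp w) htm (hyp v) (hyp u) (hyp w) hti rfl
  -- with exponent `3` the same inequalities bound the third moments
  obtain ⟨⟨-, d1⟩, -, d2, -⟩ := decoupled_young_four (le_refl 3) (ha0 v) (ha0 u) (ha0 w)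
    (t := fun _ => 0) (fun _ => le_rfl) (hamp v) (hamp u) (hamp w) measurable_const (hyp3 v)
    (hyp3 u) (hyp3 w) (by simp) rfl
  simp only [sub_self, Real.rpow_zero, mul_one, zero_div, zero_mul, add_zero] at d1 d2
  set κ₀ : ℝ := 2.52 / h with hκ₀
  have hκ₀0 : 0 < κ₀ := by positivity
  have hl3 : 0 ≤ (3 * D / l) ^ (p - 3) := by positivity
  have hκ0 : 0 ≤ κ := by rw [hκ]; positivity
  have hΨ0 : 0 ≤ Ψ := by
    rw [hΨ, modulusBound]
    have := kolmogorovDist_nonneg (μ.map fun ω => ∑ v, y v ω) (gaussianReal 0 1)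
    positivity
  have htl : ∀ ω, (absSum G y A ω / l) ^ (p - 3) = (3 * D / l) ^ (p - 3) * t ω ^ (p - 3) := by
    intro ω
    rw [← Real.mul_rpow (by positivity) (ht0 ω)]
    congr 1; simp only [ht]; field_simp
  have hκt : ∀ ω, κ₀ * (absSum G y A ω / l) ^ (p - 3) = κ * t ω ^ (p - 3) := fun ω => by
    rw [htl, hκ]; ring
  have hl5 : Integrable (fun ω => (absSum G y A ω / l) ^ (p - 3)) μ := by
    simp only [htl]; exact j5.const_mul _
  have hmod : ∫ ω, steinModulus z h l (restSum G y A ω) ∂μ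
      ≤ Ψ + κ * ∫ ω, t ω ^ (p - 3) ∂μ := by
    refine (integral_steinModulus_le hm hU2 h1 hh hl (r := p - 3) (by linarith) z A hl5).trans
      (le_of_eq ?_)
    simp only [htl]
    rw [integral_const_mul, ← hΨ, hκ]; ring
  set R : ℝ := (∫ ω, |y v ω| ^ p ∂μ + ∫ ω, |y u ω| ^ p ∂μ + ∫ ω, |y w ω| ^ p ∂μ) / p
      + (p - 3) / p * ∫ ω, t ω ^ p ∂μ with hR
  have hmm : Measurable fun ω => steinModulus z h l (restSum G y A ω) :=
    (measurable_steinModulus z h l).comp (measurable_restSum hm A)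
  have hmb : ∀ ω, |steinModulus z h l (restSum G y A ω)| ≤ κ₀ := fun ω => by
    rw [abs_of_nonneg (steinModulus_nonneg z hh hl.le _)]; exact steinModulus_le _ _ _ _
  have hRB : (∫ ω, |y v ω| ^ (3 : ℝ) ∂μ + ∫ ω, |y u ω| ^ (3 : ℝ) ∂μ
      + ∫ ω, |y w ω| ^ (3 : ℝ) ∂μ) / 3 * Ψ + 2 * κ * R ≤ B := by
    rw [hB, tripleBound, hR]
    have hq : 0 ≤ (p - 3) / p := div_nonneg (by linarith) hp0.le
    have h6 := sum_nbhd_triple_le (G := G) (a := fun v => ∫ ω, |y v ω| ^ p ∂μ)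
      (fun v => integral_nonneg fun ω => Real.rpow_nonneg (abs_nonneg _) _) v u w
    have h7 : ∫ ω, t ω ^ p ∂μ ≤ 1 / (3 * D) * (∑ x ∈ nbhd G {v}, ∫ ω, |y x ω| ^ p ∂μ
        + ∑ x ∈ nbhd G {u}, ∫ ω, |y x ω| ^ p ∂μ + ∑ x ∈ nbhd G {w}, ∫ ω, |y x ω| ^ p ∂μ) :=
      hti'.trans (mul_le_mul_of_nonneg_left h6 (by positivity))
    gcongr
  have k1 : Integrable (fun ω => |y v ω| * |y u ω| * |y w ω|
      * steinModulus z h l (restSum G y A ω)) μ := integrable_mul_of_abs_le j2 hmm hmb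
  have k2 : Integrable (fun ω => |y v ω| * |y u ω| * |y w ω| * (κ * t ω ^ (p - 3))) μ :=
    (j1.const_mul κ).congr (Eventually.of_forall fun ω => by ring)
  have k3 : Integrable (fun ω => |y w ω| * steinModulus z h l (restSum G y A ω)) μ :=
    integrable_mul_of_abs_le j6 hmm hmb
  have k4 : Integrable (fun ω => |y w ω| * (κ * t ω ^ (p - 3))) μ :=
    (j4.const_mul κ).congr (Eventually.of_forall fun ω => by ring)
  have f1 : ∫ ω, |y v ω| * |y u ω| * |y w ω| * steinModulus z h l (restSum G y A ω) ∂μ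
      = (∫ ω, |y v ω| * |y u ω| * |y w ω| ∂μ)
        * ∫ ω, steinModulus z h l (restSum G y A ω) ∂μ :=
    integral_mul_restSum hG hm A
      (F := fun x => |x ⟨v, by simp [hA]⟩| * |x ⟨u, by simp [hA]⟩| * |x ⟨w, by simp [hA]⟩|)
      (by fun_prop) (measurable_steinModulus z h l)
  have f3 : ∫ ω, |y w ω| * steinModulus z h l (restSum G y A ω) ∂μ
      = (∫ ω, |y w ω| ∂μ) * ∫ ω, steinModulus z h l (restSum G y A ω) ∂μ :=
    integral_mul_restSum hG hm A (F := fun x => |x ⟨w, by simp [hA]⟩|)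
      (by fun_prop) (measurable_steinModulus z h l)
  have f2 : ∫ ω, |y v ω| * |y u ω| * |y w ω| * (κ * t ω ^ (p - 3)) ∂μ
      = κ * ∫ ω, |y v ω| * |y u ω| * |y w ω| * t ω ^ (p - 3) ∂μ := by
    rw [← integral_const_mul]; congr 1; ext ω; ring
  have f4 : ∫ ω, |y w ω| * (κ * t ω ^ (p - 3)) ∂μ
      = κ * ∫ ω, |y w ω| * t ω ^ (p - 3) ∂μ := by
    rw [← integral_const_mul]; congr 1; ext ω; ring
  have n1 : 0 ≤ ∫ ω, |y v ω| * |y u ω| * |y w ω| ∂μ := integral_nonneg fun ω => by positivity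
  have n2 : 0 ≤ ∫ ω, |y v ω| * |y u ω| ∂μ := integral_nonneg fun ω => by positivity
  have n3 : 0 ≤ ∫ ω, |y w ω| ∂μ := integral_nonneg fun ω => by positivity
  simp only [hκt, mul_add]
  refine ⟨k1.add k2, ?_, k3.add k4, ?_⟩
  · rw [integral_add k1 k2, f1, f2]
    refine le_trans ?_ hRB
    have g1 := mul_le_mul_of_nonneg_left hmod n1
    have g2 := mul_le_mul_of_nonneg_left c1 hκ0
    have g3 := mul_le_mul_of_nonneg_left c2 hκ0
    have g4 := mul_le_mul_of_nonneg_right d1 hΨ0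
    linarith
  · rw [integral_add k3 k4, f3, f4]
    refine le_trans ?_ hRB
    have g1 := mul_le_mul_of_nonneg_left (mul_le_mul_of_nonneg_left hmod n3) n2
    have g2 := mul_le_mul_of_nonneg_left c3 hκ0
    have g3 := mul_le_mul_of_nonneg_left c4 hκ0
    have g4 := mul_le_mul_of_nonneg_right d2 hΨ0
    linarith

end Bootstrap

/-! ### The bootstrap inequality -/

section BootstrapSum

variable {ι Ω : Type*} [Fintype ι] [MeasurableSpace Ω] {μ : Measure Ω} [IsProbabilityMeasure μ]
  {G : SimpleGraph ι} {y : ι → Ω → ℝ}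

/-- If `δ` is dominated by a sum of weights and `τ / δ` by each of the numbers `Λ w`, then `τ` is
dominated by the weighted sum of the `Λ w`. In this form each summand may be treated with its own
Lipschitz constant. -/
lemma abs_le_sum_mul_of_forall {α : Type*} (s : Finset α) {a Λ : α → ℝ} {τ δ : ℝ}
    (ha : ∀ w ∈ s, 0 ≤ a w) (hΛ : ∀ w ∈ s, 0 ≤ Λ w) (h0 : δ = 0 → τ = 0)
    (hδ : |δ| ≤ ∑ w ∈ s, a w) (hτ : ∀ w ∈ s, |τ| ≤ |δ| * Λ w) :
    |τ| ≤ ∑ w ∈ s, a w * Λ w := by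
  rcases eq_or_ne δ 0 with h | h
  · rw [h0 h, abs_zero]
    exact Finset.sum_nonneg fun w hw => mul_nonneg (ha w hw) (hΛ w hw)
  · have hpos := abs_pos.2 h
    refine le_of_mul_le_mul_left ?_ hpos
    calc |δ| * |τ| ≤ (∑ w ∈ s, a w) * |τ| := mul_le_mul_of_nonneg_right hδ (abs_nonneg _)
      _ = ∑ w ∈ s, a w * |τ| := Finset.sum_mul _ _ _
      _ ≤ ∑ w ∈ s, a w * (|δ| * Λ w) :=
          Finset.sum_le_sum fun w hw => mul_le_mul_of_nonneg_left (hτ w hw) (ha w hw)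
      _ = |δ| * ∑ w ∈ s, a w * Λ w := by
          rw [Finset.mul_sum]; exact Finset.sum_congr rfl fun w _ => by ring

lemma sum_tripleBound_le {m M : ι → ℝ} (hm : ∀ v, 0 ≤ m v) (hM : ∀ v, 0 ≤ M v) {p D κ Ψ : ℝ}
    (hp : 3 ≤ p) (hD0 : 0 < D) (hD : ∀ v, ((nbhd G {v}).card : ℝ) ≤ D) (hκ : 0 ≤ κ) (hΨ : 0 ≤ Ψ) :
    (∑ v, ∑ u ∈ nbhd G {v}, ∑ w ∈ nbhd G {v}, tripleBound G m M p D κ Ψ v u w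
      ≤ D ^ 2 * ((∑ v, m v) * Ψ + 2 * κ * ∑ v, M v)) ∧
    ∑ v, ∑ u ∈ nbhd G {v}, ∑ w ∈ nbhd G {u}, tripleBound G m M p D κ Ψ v u w
      ≤ D ^ 2 * ((∑ v, m v) * Ψ + 2 * κ * ∑ v, M v) := by
  have hp0 : 0 < p := by linarith
  have hq : 0 ≤ (p - 3) / p := div_nonneg (by linarith) hp0.le
  set S : ι → ℝ := fun v => ∑ x ∈ nbhd G {v}, M x with hS
  have hS0 : ∀ v, 0 ≤ S v := fun v => Finset.sum_nonneg fun x _ => hM x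
  have hSM : ∑ v, S v ≤ D * ∑ v, M v := sum_sum_nbhd_right_le hD hM
  -- `tripleBound` is a combination of the three functions `m`, `M` and `S`
  have heq : ∀ v u w, tripleBound G m M p D κ Ψ v u w = Ψ / 3 * (m v + m u + m w)
      + (2 * κ / p * (M v + M u + M w)
        + 2 * κ * ((p - 3) / p) * (1 / (3 * D)) * (S v + S u + S w)) := by
    intro v u w
    simp only [tripleBound, hS]; ring
  have hfin : Ψ / 3 * (3 * D ^ 2 * ∑ v, m v) + (2 * κ / p * (3 * D ^ 2 * ∑ v, M v)
      + 2 * κ * ((p - 3) / p) * (1 / (3 * D)) * (3 * D ^ 2 * ∑ v, S v))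
      ≤ D ^ 2 * ((∑ v, m v) * Ψ + 2 * κ * ∑ v, M v) := by
    calc _ ≤ Ψ / 3 * (3 * D ^ 2 * ∑ v, m v) + (2 * κ / p * (3 * D ^ 2 * ∑ v, M v)
      + 2 * κ * ((p - 3) / p) * (1 / (3 * D)) * (3 * D ^ 2 * (D * ∑ v, M v))) := by gcongr
      _ = _ := by field_simp; ring
  constructor
  · simp only [heq, Finset.sum_add_distrib (f := fun _ => Ψ / 3 * _),
      Finset.sum_add_distrib (f := fun _ => 2 * κ / p * _), ← Finset.mul_sum]
    refine le_trans ?_ hfin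
    have h1 := sum_star_le hD hD0.le hm
    have h2 := sum_star_le hD hD0.le hM
    have h3 := sum_star_le hD hD0.le hS0
    gcongr
  · simp only [heq, Finset.sum_add_distrib (f := fun _ => Ψ / 3 * _),
      Finset.sum_add_distrib (f := fun _ => 2 * κ / p * _), ← Finset.mul_sum]
    refine le_trans ?_ hfin
    have h1 := sum_chain_le hD hD0.le hm
    have h2 := sum_chain_le hD hD0.le hM
    have h3 := sum_chain_le hD hD0.le hS0
    gcongr

/-- Moments of order `p ≥ 3`: the smoothing error is bounded in terms of the third moments, the
Kolmogorov distance itself and a remainder that is small when the `p`-th moments are. -/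
lemma abs_integral_ramp_sub_le_bootstrap (hG : IsDependencyGraph G y μ)
    (hm : ∀ v, Measurable (y v)) {p : ℝ} (hp : 3 ≤ p)
    (hy : ∀ v, MemLp (y v) (ENNReal.ofReal p) μ) (h0 : ∀ v, ∫ ω, y v ω ∂μ = 0)
    (h1 : ∫ ω, (∑ v, y v ω) ^ 2 ∂μ = 1) {D : ℝ} (hD0 : 0 < D)
    (hD : ∀ v, ((nbhd G {v}).card : ℝ) ≤ D) {h l : ℝ} (hh : 0 < h) (hh1 : h ≤ 1) (hl : 0 < l)
    (z : ℝ) :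
    |∫ x, ramp z h x ∂(μ.map fun ω => ∑ v, y v ω) - rampMean z h| ≤
      3.5 * (D ^ 2 * ((∑ v, ∫ ω, |y v ω| ^ (3 : ℝ) ∂μ)
        * modulusBound h l (kolmogorovDist (μ.map fun ω => ∑ v, y v ω) (gaussianReal 0 1))
        + 2 * (2.52 / h * (3 * D / l) ^ (p - 3)) * ∑ v, ∫ ω, |y v ω| ^ p ∂μ)) := by
  have hp0 : 0 < p := by linarith
  have hy2 : ∀ v, MemLp (y v) 2 μ := fun v => (hy v).mono_exponent (by
    rw [show (2 : ℝ≥0∞) = ENNReal.ofReal 2 by simp]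
    exact ENNReal.ofReal_le_ofReal (by linarith))
  set Ψ : ℝ := modulusBound h l (kolmogorovDist (μ.map fun ω => ∑ v, y v ω) (gaussianReal 0 1))
    with hΨ
  set κ : ℝ := 2.52 / h * (3 * D / l) ^ (p - 3) with hκ
  have hκ0 : 0 ≤ κ := by positivity
  have hΨ0 : 0 ≤ Ψ := by
    rw [hΨ, modulusBound]
    have := kolmogorovDist_nonneg (μ.map fun ω => ∑ v, y v ω) (gaussianReal 0 1)
    positivity
  set B : ι → ι → ι → ℝ := fun v u w => tripleBound G (fun v => ∫ ω, |y v ω| ^ (3 : ℝ) ∂μ)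
    (fun v => ∫ ω, |y v ω| ^ p ∂μ) p D κ Ψ v u w with hB
  have htriple := fun v u w => triple_le hG hm hp hy h1 hD0 hD hh hl z v u w hκ hΨ
    (hB ▸ rfl : B v u w = _)
  set Λ : ι → ι → ι → Ω → ℝ := fun v u w ω => steinModulus z h l (restSum G y {v, u, w} ω)
    + 2.52 / h * (absSum G y {v, u, w} ω / l) ^ (p - 3) with hΛ
  have hΛ0 : ∀ v u w ω, 0 ≤ Λ v u w ω := by
    intro v u w ω
    have h2 := steinModulus_nonneg z hh hl.le (restSum G y {v, u, w} ω)
    have h3 : 0 ≤ (absSum G y {v, u, w} ω / l) ^ (p - 3) :=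
      Real.rpow_nonneg (div_nonneg (absSum_nonneg _ ω) hl.le) _
    simp only [hΛ]
    positivity
  have hUm : Measurable fun ω => ∑ v, y v ω := by fun_prop
  -- `Λ v u w` is a Lipschitz constant near `restSum G y {v, u, w}`
  have hlip : ∀ v u w ω x x', |x - restSum G y {v, u, w} ω| ≤ absSum G y {v, u, w} ω →
      |x' - restSum G y {v, u, w} ω| ≤ absSum G y {v, u, w} ω →
      |steinDeriv z h x - steinDeriv z h x'| ≤ |x - x'| * Λ v u w ω := by
    intro v u w ω x x' hx hx'
    rw [mul_comm]
    exact abs_steinDeriv_sub_le_modulus z hh hh1 hl (by linarith) _ x x' hx hx'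
  have hsub1 : ∀ v u w : ι, ({v} : Set ι) ⊆ {v, u, w} := by simp
  have hsub2 : ∀ v u w : ι, ({v, u} : Set ι) ⊆ {v, u, w} := fun v u w x hx => by
    simp only [Set.mem_insert_iff, Set.mem_singleton_iff] at hx ⊢; tauto
  rw [integral_ramp_map_sub hUm]
  refine (abs_integral_stein_le hG hm hy2 h0 h1 (continuous_steinSol z h)
    (continuous_steinDeriv z h) (C := 1.26) (C' := 1)
    (fun x => by rw [abs_of_nonneg (steinSol_nonneg z hh x)]; exact steinSol_le z h x)
    (abs_steinDeriv_le z hh)).trans ?_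
  have hT1 : ∀ v, ∫ ω, |y v ω| * |steinSol z h (∑ v, y v ω) - steinSol z h (restSum G y {v} ω)
      - (∑ v, y v ω - restSum G y {v} ω) * steinDeriv z h (restSum G y {v} ω)| ∂μ
      ≤ 1 / 2 * ∑ u ∈ nbhd G {v}, ∑ w ∈ nbhd G {v}, B v u w := by
    intro v
    have hi : Integrable (fun ω => 1 / 2 * ∑ u ∈ nbhd G {v}, ∑ w ∈ nbhd G {v},
        |y v ω| * |y u ω| * |y w ω| * Λ v u w ω) μ :=
      (integrable_finsetSum _ fun u _ => integrable_finsetSum _ fun w _ =>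
        (htriple v u w).1).const_mul _
    refine (integral_mono_of_nonneg (Eventually.of_forall fun ω => by positivity) hi
      (Eventually.of_forall fun ω => ?_)).trans ?_
    · simp only
      have hη := abs_sum_sub_restSum_le (G := G) (y := y) {v} ω
      set η := ∑ v, y v ω - restSum G y {v} ω with hηdef
      set τ := steinSol z h (∑ v, y v ω) - steinSol z h (restSum G y {v} ω)
        - η * steinDeriv z h (restSum G y {v} ω) with hτ
      have hpair : |τ| ≤ ∑ q ∈ nbhd G {v} ×ˢ nbhd G {v},
          |y q.1 ω| * |y q.2 ω| * (1 / 2 * Λ v q.1 q.2 ω) := by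
        refine abs_le_sum_mul_of_forall _ (δ := η ^ 2) (fun q _ => by positivity)
          (fun q _ => by have := hΛ0 v q.1 q.2 ω; positivity) (fun h => ?_) ?_ fun q _ => ?_
        · have h4 : η = 0 := pow_eq_zero_iff (two_ne_zero) |>.1 h
          have h5 : ∑ v, y v ω = restSum G y {v} ω := by linarith
          rw [hτ, h4, h5]; ring
        · rw [abs_of_nonneg (sq_nonneg η), Finset.sum_product]
          change η ^ 2 ≤ ∑ x ∈ nbhd G {v}, ∑ x' ∈ nbhd G {v}, |y x ω| * |y x' ω|
          rw [← Finset.sum_mul_sum, ← sq_abs, sq]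
          exact mul_le_mul hη hη (abs_nonneg _) (absSum_nonneg _ ω)
        · have h6 : |restSum G y {v} ω - restSum G y {v, q.1, q.2} ω|
              ≤ absSum G y {v, q.1, q.2} ω := abs_restSum_sub_restSum_le (hsub1 _ _ _) ω
          have h7 := abs_sum_sub_restSum_le (G := G) (y := y) {v, q.1, q.2} ω
          have h8 := abs_taylor_le_of_lipschitz (hasDerivAt_steinSol z h)
            (a := restSum G y {v} ω) (b := ∑ v, y v ω) (L := Λ v q.1 q.2 ω) fun s hs => by
              refine (hlip v q.1 q.2 ω _ _ ?_ h6).trans (le_of_eq ?_)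
              · -- the segment between two points of an interval stays in it
                rw [abs_le] at h6 h7 ⊢
                constructor
                · nlinarith [hs.1, hs.2, mul_le_mul_of_nonneg_left h7.1 hs.1,
                    mul_le_mul_of_nonneg_left h6.1 (sub_nonneg.2 hs.2)]
                · nlinarith [hs.1, hs.2, mul_le_mul_of_nonneg_left h7.2 hs.1,
                    mul_le_mul_of_nonneg_left h6.2 (sub_nonneg.2 hs.2)]
              · rw [add_sub_cancel_left, abs_mul, abs_of_nonneg hs.1]; ring
          refine h8.trans (le_of_eq ?_)
          rw [abs_of_nonneg (sq_nonneg η)]; ring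
      refine (mul_le_mul_of_nonneg_left hpair (abs_nonneg _)).trans (le_of_eq ?_)
      rw [Finset.sum_product, Finset.mul_sum, Finset.mul_sum]
      refine Finset.sum_congr rfl fun u _ => ?_
      rw [Finset.mul_sum, Finset.mul_sum]
      exact Finset.sum_congr rfl fun w _ => by ring
    · rw [integral_const_mul, integral_finsetSum _ fun u _ => integrable_finsetSum _ fun w _ =>
        (htriple v u w).1]
      refine mul_le_mul_of_nonneg_left (Finset.sum_le_sum fun u _ => ?_) (by norm_num)
      rw [integral_finsetSum _ fun w _ => (htriple v u w).1]
      exact Finset.sum_le_sum fun w _ => (htriple v u w).2.1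
  have hT2 : ∀ v u, ∫ ω, |y v ω * y u ω|
        * |steinDeriv z h (restSum G y {v} ω) - steinDeriv z h (restSum G y {v, u} ω)| ∂μ
      ≤ ∑ w ∈ nbhd G {u}, B v u w := by
    intro v u
    have hi : Integrable (fun ω => ∑ w ∈ nbhd G {u},
        |y v ω| * |y u ω| * |y w ω| * Λ v u w ω) μ :=
      integrable_finsetSum _ fun w _ => (htriple v u w).1
    refine (integral_mono_of_nonneg (Eventually.of_forall fun ω => by positivity) hi
      (Eventually.of_forall fun ω => ?_)).trans ?_
    · simp only
      have hs := abs_le_sum_mul_of_forall (nbhd G {u}) (a := fun w => |y w ω|)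
        (Λ := fun w => Λ v u w ω)
        (τ := steinDeriv z h (restSum G y {v} ω) - steinDeriv z h (restSum G y {v, u} ω))
        (δ := restSum G y {v} ω - restSum G y {v, u} ω) (fun _ _ => abs_nonneg _)
        (fun w _ => hΛ0 v u w ω) (fun h => by rw [sub_eq_zero.1 h, sub_self])
        (abs_restSum_sub_restSum_pair_le v u ω) fun w _ => hlip v u w ω _ _
          (abs_restSum_sub_restSum_le (hsub1 v u w) ω)
          (abs_restSum_sub_restSum_le (hsub2 v u w) ω)
      rw [abs_mul]
      refine (mul_le_mul_of_nonneg_left hs (by positivity)).trans (le_of_eq ?_)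
      rw [Finset.mul_sum]
      exact Finset.sum_congr rfl fun w _ => by ring
    · rw [integral_finsetSum _ fun w _ => (htriple v u w).1]
      exact Finset.sum_le_sum fun w _ => (htriple v u w).2.1
  have hB0 : ∀ v u w, 0 ≤ B v u w := fun v u w =>
    (integral_nonneg fun ω => mul_nonneg (by positivity) (hΛ0 v u w ω)).trans (htriple v u w).2.1
  have hT3 : ∀ v u, (∫ ω, |y v ω * y u ω| ∂μ)
        * ∫ ω, |steinDeriv z h (restSum G y {v, u} ω) - steinDeriv z h (∑ v, y v ω)| ∂μ
      ≤ ∑ w ∈ nbhd G {v}, B v u w + ∑ w ∈ nbhd G {u}, B v u w := by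
    intro v u
    have hi : Integrable (fun ω => ∑ w ∈ nbhd G {v, u}, |y w ω| * Λ v u w ω) μ :=
      integrable_finsetSum _ fun w _ => (htriple v u w).2.2.1
    refine le_trans (mul_le_mul_of_nonneg_left (integral_mono_of_nonneg
      (Eventually.of_forall fun ω => by positivity) hi (Eventually.of_forall fun ω => ?_))
      (integral_nonneg fun _ => abs_nonneg _)) ?_
    · refine abs_le_sum_mul_of_forall (nbhd G {v, u}) (a := fun w => |y w ω|)
        (Λ := fun w => Λ v u w ω) (δ := restSum G y {v, u} ω - ∑ v, y v ω)
        (fun _ _ => abs_nonneg _)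
        (fun w _ => hΛ0 v u w ω) (fun h => by rw [sub_eq_zero.1 h, sub_self]) ?_
        fun w _ => hlip v u w ω _ _ (abs_restSum_sub_restSum_le (hsub2 v u w) ω)
          (abs_sum_sub_restSum_le _ ω)
      rw [abs_sub_comm]; exact abs_sum_sub_restSum_le _ ω
    · rw [integral_finsetSum _ fun w _ => (htriple v u w).2.2.1, Finset.mul_sum]
      refine le_trans (Finset.sum_le_sum fun w _ => ?_)
        (sum_nbhd_insert_le (G := G) (a := B v u) (hB0 v u) v {u})
      simp only [abs_mul]
      exact (htriple v u w).2.2.2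
  obtain ⟨hstar, hchain⟩ := sum_tripleBound_le (G := G)
    (m := fun v => ∫ ω, |y v ω| ^ (3 : ℝ) ∂μ) (M := fun v => ∫ ω, |y v ω| ^ p ∂μ)
    (fun v => integral_nonneg fun ω => Real.rpow_nonneg (abs_nonneg _) _)
    (fun v => integral_nonneg fun ω => Real.rpow_nonneg (abs_nonneg _) _) hp hD0 hD hκ0 hΨ0
  calc _ ≤ ∑ v, 1 / 2 * ∑ u ∈ nbhd G {v}, ∑ w ∈ nbhd G {v}, B v u w
        + ∑ v, ∑ u ∈ nbhd G {v}, (∑ w ∈ nbhd G {u}, B v u w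
          + (∑ w ∈ nbhd G {v}, B v u w + ∑ w ∈ nbhd G {u}, B v u w)) :=
        add_le_add (Finset.sum_le_sum fun v _ => hT1 v)
          (Finset.sum_le_sum fun v _ => Finset.sum_le_sum fun u _ =>
            add_le_add (hT2 v u) (hT3 v u))
    _ = 3 / 2 * ∑ v, ∑ u ∈ nbhd G {v}, ∑ w ∈ nbhd G {v}, B v u w
        + 2 * ∑ v, ∑ u ∈ nbhd G {v}, ∑ w ∈ nbhd G {u}, B v u w := by
        rw [← Finset.mul_sum]
        simp only [Finset.sum_add_distrib]
        ring
    _ ≤ _ := by linarith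

end BootstrapSum

/-! ### Rates for sums with a dependency graph -/

section Rate

variable {ι : Type*} [Fintype ι] {Ω : Type*} [MeasurableSpace Ω] {μ : Measure Ω}
  [IsProbabilityMeasure μ] {G : SimpleGraph ι} {y : ι → Ω → ℝ}

/-- The rate for `2 < p ≤ 3`: the smoothing width is chosen to be the rate `E` itself. -/
lemma kolmogorovDist_sum_le (hG : IsDependencyGraph G y μ) (hm : ∀ v, Measurable (y v))
    {p : ℝ} (hp : 2 < p) (hp3 : p ≤ 3) (hy : ∀ v, MemLp (y v) (ENNReal.ofReal p) μ)
    (h0 : ∀ v, ∫ ω, y v ω ∂μ = 0) (h1 : ∫ ω, (∑ v, y v ω) ^ 2 ∂μ = 1) {D : ℝ} (hD0 : 0 < D)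
    (hD : ∀ v, ((nbhd G {v}).card : ℝ) ≤ D) {E : ℝ} (hE : 0 < E) (hE1 : E ≤ 1 / 8.015)
    (hβ : D ^ (p - 1) * ∑ v, ∫ ω, |y v ω| ^ p ∂μ ≤ 2 ^ p * E ^ (p + 1)) :
    kolmogorovDist (μ.map fun ω => ∑ v, y v ω) (gaussianReal 0 1) ≤ 1.5 * E := by
  have hUm : Measurable fun ω => ∑ v, y v ω := by fun_prop
  have : IsProbabilityMeasure (μ.map fun ω => ∑ v, y v ω) :=
    Measure.isProbabilityMeasure_map hUm.aemeasurable
  refine (kolmogorovDist_le_of_ramp _ hE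
    (abs_integral_ramp_sub_le hG hm hp hp3 hy h0 h1 hD0 hD hE (hE1.trans (by norm_num)))).trans ?_
  have hpow : (1.26 / E) ^ (p - 2) * E ^ (p + 1) = 1.26 ^ (p - 2) * E ^ 3 := by
    rw [Real.div_rpow (by norm_num) hE.le, div_mul_eq_mul_div, mul_div_assoc,
      ← Real.rpow_sub hE, ← Real.rpow_natCast E 3]
    norm_num
  have h126 : (1.26 : ℝ) ^ (p - 2) ≤ 1.26 := by
    simpa using Real.rpow_le_rpow_of_exponent_le (x := 1.26) (by norm_num)
      (show p - 2 ≤ 1 by linarith)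
  have h8 : (2 : ℝ) ^ p ≤ 8 := by
    refine (Real.rpow_le_rpow_of_exponent_le (x := 2) (by norm_num) hp3).trans (le_of_eq ?_)
    rw [show (3 : ℝ) = (3 : ℕ) by norm_num, Real.rpow_natCast]; norm_num
  have hE2 : E ^ 2 ≤ (1 / 8.015) ^ 2 := pow_le_pow_left₀ hE.le hE1 2
  calc 0.2 * E + 8 * (1.26 / E) ^ (p - 2) * D ^ (p - 1) * ∑ v, ∫ ω, |y v ω| ^ p ∂μ
      = 0.2 * E + 8 * (1.26 / E) ^ (p - 2) * (D ^ (p - 1) * ∑ v, ∫ ω, |y v ω| ^ p ∂μ) := by ring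
    _ ≤ 0.2 * E + 8 * (1.26 / E) ^ (p - 2) * (2 ^ p * E ^ (p + 1)) := by gcongr
    _ = 0.2 * E + 8 * 2 ^ p * ((1.26 / E) ^ (p - 2) * E ^ (p + 1)) := by ring
    _ = 0.2 * E + 8 * 2 ^ p * (1.26 ^ (p - 2) * (E ^ 2 * E)) := by rw [hpow]; ring
    _ ≤ 0.2 * E + 8 * 8 * (1.26 * ((1 / 8.015) ^ 2 * E)) := by gcongr
    _ ≤ 1.5 * E := by norm_num; linarith

/-- The rate for `p ≥ 3`. The Kolmogorov distance appears on both sides of the bootstrap bound;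
the smoothing width exceeds seven times the coefficient of the third moments, so that the
distance on the right-hand side is absorbed. -/
lemma kolmogorovDist_sum_le_bootstrap (hG : IsDependencyGraph G y μ)
    (hm : ∀ v, Measurable (y v)) {p : ℝ} (hp : 3 ≤ p)
    (hy : ∀ v, MemLp (y v) (ENNReal.ofReal p) μ) (h0 : ∀ v, ∫ ω, y v ω ∂μ = 0)
    (h1 : ∫ ω, (∑ v, y v ω) ^ 2 ∂μ = 1) {D : ℝ} (hD0 : 0 < D)
    (hD : ∀ v, ((nbhd G {v}).card : ℝ) ≤ D) {E e : ℝ} (hE : 0 < E) (hE1 : E ≤ 1 / 18.96)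
    (he : 0 ≤ e) (he1 : e ≤ 1 / 227.5)
    (hβ : D ^ (p - 1) * ∑ v, ∫ ω, |y v ω| ^ p ∂μ ≤ 2 ^ p * E ^ (p + 1))
    (hβ3 : D ^ 2 * ∑ v, ∫ ω, |y v ω| ^ (3 : ℝ) ∂μ ≤ 8 * e) :
    kolmogorovDist (μ.map fun ω => ∑ v, y v ω) (gaussianReal 0 1) ≤ 184 * e + 2.76 * E := by
  have hUm : Measurable fun ω => ∑ v, y v ω := by fun_prop
  have : IsProbabilityMeasure (μ.map fun ω => ∑ v, y v ω) :=
    Measure.isProbabilityMeasure_map hUm.aemeasurable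
  -- smoothing width `7 * (28 * e) + E`, where `28 * e` bounds the third moments with their
  -- constant `3.5`, and localisation scale `6 * E`
  have hh : 0 < 196 * e + E := by positivity
  have hh1 : 196 * e + E ≤ 1 := by norm_num at hE1 he1; linarith
  have hk := kolmogorovDist_le_of_ramp _ hh (abs_integral_ramp_sub_le_bootstrap hG hm hp hy h0 h1
    hD0 hD hh hh1 (l := 6 * E) (by positivity))
  set k := kolmogorovDist (μ.map fun ω => ∑ v, y v ω) (gaussianReal 0 1) with hkdef
  have hk0 : 0 ≤ k := kolmogorovDist_nonneg _ _
  set h := 196 * e + E with hhdef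
  have hE2 : E ^ 2 ≤ (1 / 18.96) ^ 2 := pow_le_pow_left₀ hE.le hE1 2
  -- the remainder
  have htail : (3 * D / (6 * E)) ^ (p - 3) * (D ^ 2 * ∑ v, ∫ ω, |y v ω| ^ p ∂μ) ≤ 8 * E ^ 4 := by
    have e1 : (3 * D / (6 * E)) ^ (p - 3) * (D ^ 2 * ∑ v, ∫ ω, |y v ω| ^ p ∂μ)
        = (2 * E) ^ (-(p - 3)) * (D ^ (p - 1) * ∑ v, ∫ ω, |y v ω| ^ p ∂μ) := by
      rw [show 3 * D / (6 * E) = D / (2 * E) by field_simp; ring, Real.div_rpow hD0.le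
        (by positivity), Real.rpow_neg (by positivity),
        show p - 1 = (p - 3) + (2 : ℕ) by push_cast; ring, Real.rpow_add hD0, Real.rpow_natCast]
      ring
    have e2 : (2 * E) ^ (-(p - 3)) * (2 ^ p * E ^ (p + 1)) = 8 * E ^ 4 := by
      rw [Real.mul_rpow (by norm_num) hE.le,
        show (2 : ℝ) ^ (-(p - 3)) * E ^ (-(p - 3)) * (2 ^ p * E ^ (p + 1))
          = ((2 : ℝ) ^ (-(p - 3)) * 2 ^ p) * (E ^ (-(p - 3)) * E ^ (p + 1)) by ring,
        ← Real.rpow_add (by norm_num), ← Real.rpow_add hE,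
        show -(p - 3) + p = (3 : ℕ) by push_cast; ring,
        show -(p - 3) + (p + 1) = (4 : ℕ) by push_cast; ring, Real.rpow_natCast,
        Real.rpow_natCast]
      norm_num
    rw [e1, ← e2]; gcongr
  have hEh : E / h ≤ 1 := (div_le_one hh).2 (by linarith)
  have heh : 28 * e / h ≤ 1 / 7 := by rw [div_le_div_iff₀ hh (by norm_num)]; linarith
  have hΨ0 : 0 ≤ modulusBound h (6 * E) k := by unfold modulusBound; positivity
  have hA : 3.5 * (D ^ 2 * ((∑ v, ∫ ω, |y v ω| ^ (3 : ℝ) ∂μ) * modulusBound h (6 * E) k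
        + 2 * (2.52 / h * (3 * D / (6 * E)) ^ (p - 3)) * ∑ v, ∫ ω, |y v ω| ^ p ∂μ))
      ≤ 28 * e * modulusBound h (6 * E) k + 17.64 / h * (8 * E ^ 4) := by
    have i1 := mul_le_mul_of_nonneg_right hβ3 hΨ0
    have i2 := mul_le_mul_of_nonneg_left htail (show 0 ≤ 17.64 / h by positivity)
    refine le_trans (le_of_eq ?_) (add_le_add (mul_le_mul_of_nonneg_left i1
      (show (0 : ℝ) ≤ 3.5 by norm_num)) i2) |>.trans (le_of_eq (by ring))
    ring
  have hB : 28 * e * modulusBound h (6 * E) k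
      = 28 * e * (2.66 + 12 * E) + 28 * e / h * (9.6 * E + 2 * k) := by
    unfold modulusBound; field_simp; ring
  have hC : 28 * e / h * (9.6 * E + 2 * k) ≤ 1 / 7 * (9.6 * E + 2 * k) := by gcongr
  have hF : 17.64 / h * (8 * E ^ 4) ≤ 141.12 * (1 * (E * (1 / 18.96) ^ 2)) := by
    rw [show 17.64 / h * (8 * E ^ 4) = 141.12 * (E / h * (E * E ^ 2)) by ring]
    gcongr
  have hI : 28 * e * (2.66 + 12 * E) ≤ 28 * e * (2.66 + 12 * (1 / 18.96)) := by gcongr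
  have := hk.trans (add_le_add le_rfl (hA.trans (add_le_add
    (hB.le.trans (add_le_add hI hC)) hF)))
  norm_num at this
  linarith

end Rate

/-! ### The dependency graph of a quadratic form -/

section PairGraph

variable {ι Ω : Type*} [MeasurableSpace Ω] {μ : Measure Ω}

/-- The graph on pairs of indices in which two distinct pairs are adjacent when some entry of the
first equals, or is adjacent to, some entry of the second. -/
def pairGraph (G : SimpleGraph ι) : SimpleGraph (ι × ι) where
  Adj v w := v ≠ w ∧ ∃ i j, (i = v.1 ∨ i = v.2) ∧ (j = w.1 ∨ j = w.2) ∧ (i = j ∨ G.Adj i j)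
  symm := ⟨fun _ _ ⟨h, i, j, hi, hj, hij⟩ =>
    ⟨h.symm, j, i, hj, hi, hij.imp Eq.symm SimpleGraph.Adj.symm⟩⟩
  loopless := ⟨fun _ h => h.1 rfl⟩

/-- Functions of two of the variables have the pair graph as a dependency graph. -/
lemma isDependencyGraph_pairGraph {G : SimpleGraph ι} {X : ι → Ω → ℝ}
    (hG : IsDependencyGraph G X μ) {g : ι × ι → ℝ × ℝ → ℝ} (hg : ∀ v, Measurable (g v)) :
    IsDependencyGraph (pairGraph G) (fun v ω => g v (X v.1 ω, X v.2 ω)) μ := by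
  intro A B hAB hno
  let S : Set (ι × ι) → Set ι := fun A => {i | ∃ v ∈ A, i = v.1 ∨ i = v.2}
  have hnear : ∀ i ∈ S A, ∀ j ∈ S B, ¬ (i = j ∨ G.Adj i j) := by
    rintro i ⟨v, hv, hi⟩ j ⟨w, hw, hj⟩ hij
    exact hno v hv w hw ⟨fun h => Set.disjoint_left.1 hAB hv (h ▸ hw), i, j, hi, hj, hij⟩
  have hind := hG (S A) (S B)
    (Set.disjoint_left.2 fun i hi hj => hnear i hi i hj (Or.inl rfl))
    fun i hi j hj h => hnear i hi j hj (Or.inr h)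
  have hmeas : ∀ C : Set (ι × ι), Measurable fun (x : S C → ℝ) (v : C) =>
      g v (x ⟨v.1.1, v, v.2, Or.inl rfl⟩, x ⟨v.1.2, v, v.2, Or.inr rfl⟩) := fun C =>
    measurable_pi_lambda _ fun v => (hg v).comp
      ((measurable_pi_apply _).prodMk (measurable_pi_apply _))
  exact hind.comp (hmeas A) (hmeas B)

lemma card_nbhd_le [Fintype ι] {G : SimpleGraph ι} {m : ℕ} {i : ι}
    (h : (G.neighborSet i).ncard ≤ m) : (nbhd G {i}).card ≤ m + 1 := by
  classical
  have h1 : (nbhd G {i} : Set ι) = insert i (G.neighborSet i) := by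
    ext j; simp [mem_nbhd_singleton]
  rw [← Set.ncard_coe_finset, h1]
  exact (Set.ncard_insert_le _ _).trans (by omega)

lemma card_nbhd_pairGraph_le [Fintype ι] {G : SimpleGraph ι} {d : ℕ}
    (h : ∀ i, (nbhd G {i}).card ≤ d) (v : ι × ι) :
    (nbhd (pairGraph G) {v}).card ≤ 4 * d * Fintype.card ι := by
  classical
  have hsub : nbhd (pairGraph G) {v} ⊆
      (nbhd G {v.1} ×ˢ Finset.univ ∪ Finset.univ ×ˢ nbhd G {v.1})
        ∪ (nbhd G {v.2} ×ˢ Finset.univ ∪ Finset.univ ×ˢ nbhd G {v.2}) := by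
    intro w hw
    simp only [Finset.mem_union, Finset.mem_product, Finset.mem_univ, and_true, true_and,
      mem_nbhd_singleton]
    rcases mem_nbhd_singleton.1 hw with rfl | ⟨-, i, j, hi, hj, hij⟩
    · exact Or.inl (Or.inl (Or.inl rfl))
    · rcases hi with rfl | rfl <;> rcases hj with rfl | rfl <;>
        rcases hij with hij | hij <;> simp [hij]
  refine (Finset.card_le_card hsub).trans ?_
  refine (Finset.card_union_le _ _).trans ?_
  have h1 := Finset.card_union_le (nbhd G {v.1} ×ˢ (Finset.univ : Finset ι))
    (Finset.univ ×ˢ nbhd G {v.1})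
  have h2 := Finset.card_union_le (nbhd G {v.2} ×ˢ (Finset.univ : Finset ι))
    (Finset.univ ×ˢ nbhd G {v.2})
  simp only [Finset.card_product, Finset.card_univ] at h1 h2
  have h3 := Nat.mul_le_mul_right (Fintype.card ι) (h v.1)
  have h4 := Nat.mul_le_mul_right (Fintype.card ι) (h v.2)
  nlinarith

end PairGraph

/-! ### Moment inequalities -/

section Moments

variable {Ω : Type*} [MeasurableSpace Ω] {μ : Measure Ω} [IsProbabilityMeasure μ]

lemma abs_sub_rpow_le {p : ℝ} (hp : 1 ≤ p) (a b : ℝ) :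
    |a - b| ^ p ≤ 2 ^ (p - 1) * (|a| ^ p + |b| ^ p) := by
  have h1 : |a - b| ^ p ≤ (|a| + |b|) ^ p :=
    Real.rpow_le_rpow (abs_nonneg _) (abs_sub _ _) (by linarith)
  refine h1.trans ?_
  have h2 := NNReal.rpow_add_le_mul_rpow_add_rpow (Real.nnabs a) (Real.nnabs b) hp
  exact_mod_cast h2

/-- Jensen's inequality for powers. -/
lemma integral_rpow_le {Y : Ω → ℝ} {p : ℝ} (hp : 1 ≤ p) (hY : Integrable Y μ)
    (h0 : ∀ ω, 0 ≤ Y ω) (hYp : Integrable (fun ω => Y ω ^ p) μ) :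
    (∫ ω, Y ω ∂μ) ^ p ≤ ∫ ω, Y ω ^ p ∂μ := by
  have hp0 : 0 < p := by linarith
  set t := ∫ ω, Y ω ∂μ with ht
  have ht0 : 0 ≤ t := integral_nonneg h0
  have hi : Integrable (fun ω => Y ω ^ p / p + (p - 1) / p * t ^ p) μ :=
    (hYp.div_const p).add (integrable_const _)
  have h1 := integral_mono (hY.mul_const (t ^ (p - 1))) hi fun ω => young_two hp (h0 ω) ht0
  rw [integral_mul_const, integral_add (hYp.div_const p) (integrable_const _), integral_div,
    integral_const, ← ht] at h1
  simp only [probReal_univ, smul_eq_mul, one_mul] at h1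
  have h2 : t * t ^ (p - 1) = t ^ p := by
    rcases ht0.eq_or_lt with h | h
    · rw [← h, zero_mul, Real.zero_rpow hp0.ne']
    · rw [← Real.rpow_one_add' ht0 (by linarith)]; ring_nf
  rw [h2] at h1
  have h3 : t ^ p / p ≤ (∫ ω, Y ω ^ p ∂μ) / p := by
    have : (p - 1) / p * t ^ p = t ^ p - t ^ p / p := by field_simp
    linarith
  exact (div_le_div_iff_of_pos_right hp0).1 h3

/-- Centring a random variable increases its `p`-th absolute moment at most by the factor
`2 ^ p`. -/
lemma integral_abs_sub_mean_rpow_le {Y : Ω → ℝ} {p : ℝ} (hp : 1 ≤ p)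
    (hY : MemLp Y (ENNReal.ofReal p) μ) :
    ∫ ω, |Y ω - ∫ ω', Y ω' ∂μ| ^ p ∂μ ≤ 2 ^ p * ∫ ω, |Y ω| ^ p ∂μ := by
  have hp0 : 0 < p := by linarith
  have hi := integrable_abs_rpow hp0 hY
  have hY1 : Integrable Y μ := hY.integrable (by simpa using ENNReal.ofReal_le_ofReal hp)
  have hj : Integrable (fun ω => |Y ω - ∫ ω', Y ω' ∂μ| ^ p) μ :=
    integrable_abs_rpow hp0 (hY.sub (memLp_const _))
  have hk : Integrable (fun ω => 2 ^ (p - 1) * (|Y ω| ^ p + |∫ ω', Y ω' ∂μ| ^ p)) μ :=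
    (hi.add (integrable_const _)).const_mul _
  have h1 := integral_mono hj hk fun ω => abs_sub_rpow_le hp (Y ω) (∫ ω', Y ω' ∂μ)
  rw [integral_const_mul, integral_add hi (integrable_const _), integral_const] at h1
  simp only [probReal_univ, smul_eq_mul, one_mul] at h1
  have h2 : |∫ ω', Y ω' ∂μ| ^ p ≤ ∫ ω, |Y ω| ^ p ∂μ :=
    (Real.rpow_le_rpow (abs_nonneg _) (abs_integral_le_integral_abs (f := Y)) hp0.le).trans
      (integral_rpow_le hp hY1.abs (fun _ => abs_nonneg _) hi)
  calc _ ≤ 2 ^ (p - 1) * (∫ ω, |Y ω| ^ p ∂μ + |∫ ω', Y ω' ∂μ| ^ p) := h1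
    _ ≤ 2 ^ (p - 1) * (∫ ω, |Y ω| ^ p ∂μ + ∫ ω, |Y ω| ^ p ∂μ) := by gcongr
    _ = 2 ^ p * ∫ ω, |Y ω| ^ p ∂μ := by
      rw [Real.rpow_sub (by norm_num), Real.rpow_one]; ring

/-- Young's inequality in the form of a tangent to `x ^ p ↦ x ^ r` at `s ^ p`. -/
lemma rpow_le_young {x s r p : ℝ} (hx : 0 ≤ x) (hs : 0 < s) (hr : 0 ≤ r) (hrp : r ≤ p)
    (hp : 0 < p) : x ^ r ≤ r / p * s ^ (r - p) * x ^ p + (1 - r / p) * s ^ r := by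
  have h := Real.geom_mean_le_arith_mean2_weighted (w₁ := r / p) (w₂ := 1 - r / p)
    (by positivity) (sub_nonneg.2 ((div_le_one hp).2 hrp)) (Real.rpow_nonneg hx p)
    (Real.rpow_nonneg hs.le p) (by ring)
  rw [← Real.rpow_mul hx, ← Real.rpow_mul hs.le, mul_div_cancel₀ _ hp.ne',
    show p * (1 - r / p) = p - r by field_simp] at h
  have h2 := mul_le_mul_of_nonneg_right h (Real.rpow_nonneg hs.le (r - p))
  rw [mul_assoc, ← Real.rpow_add hs, sub_add_sub_cancel, sub_self, Real.rpow_zero, mul_one,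
    add_mul, mul_assoc (1 - r / p), ← Real.rpow_add hs, add_sub_cancel] at h2
  linarith

/-- Monotonicity of averaged moments in the order: if the `p`-th moments are on average at most
`s ^ p`, then for `r ≤ p` the `r`-th moments are on average at most `s ^ r`. -/
lemma sum_integral_rpow_le {ι : Type*} [Fintype ι] {Y : ι → Ω → ℝ} {s r p : ℝ} (hs : 0 < s)
    (hr : 0 ≤ r) (hrp : r ≤ p) (hp : 0 < p) (h0 : ∀ v ω, 0 ≤ Y v ω)
    (hYp : ∀ v, Integrable (fun ω => Y v ω ^ p) μ)
    (h : ∑ v, ∫ ω, Y v ω ^ p ∂μ ≤ Fintype.card ι * s ^ p) :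
    ∑ v, ∫ ω, Y v ω ^ r ∂μ ≤ Fintype.card ι * s ^ r := by
  have h1 : ∀ v, ∫ ω, Y v ω ^ r ∂μ
      ≤ r / p * s ^ (r - p) * ∫ ω, Y v ω ^ p ∂μ + (1 - r / p) * s ^ r := by
    intro v
    have hi : Integrable (fun ω => r / p * s ^ (r - p) * Y v ω ^ p) μ := (hYp v).const_mul _
    have h2 := integral_mono_of_nonneg (Eventually.of_forall fun ω => Real.rpow_nonneg (h0 v ω) r)
      (hi.add (integrable_const ((1 - r / p) * s ^ r)))
      (Eventually.of_forall fun ω => rpow_le_young (h0 v ω) hs hr hrp hp)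
    refine h2.trans (le_of_eq ?_)
    simp only [Pi.add_apply]
    rw [integral_add hi (integrable_const _), integral_const_mul, integral_const]
    simp
  refine (Finset.sum_le_sum fun v _ => h1 v).trans ?_
  rw [Finset.sum_add_distrib, ← Finset.mul_sum, Finset.sum_const, Finset.card_univ, nsmul_eq_mul]
  have h3 : s ^ (r - p) * s ^ p = s ^ r := by rw [← Real.rpow_add hs]; ring_nf
  calc _ ≤ r / p * s ^ (r - p) * (Fintype.card ι * s ^ p)
        + Fintype.card ι * ((1 - r / p) * s ^ r) := by gcongr
    _ = Fintype.card ι * (r / p * (s ^ (r - p) * s ^ p) + (1 - r / p) * s ^ r) := by ring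
    _ = _ := by rw [h3]; ring

end Moments

/-! ### The volatility estimator as a quadratic form -/

section QuadraticForm

variable {Ω : Type*} [MeasurableSpace Ω] {μ : Measure Ω} {n : ℕ}

/-- The summands of the volatility estimator, which is the quadratic form
`(n t_n)⁻¹ ∑ (t_n / n * X_i ^ 2 / κ_i - X_i X_j)` over all pairs `(i, j)`. -/
def pairTerm (t : Fin (n + 1) → ℝ) (X : Fin n → Ω → ℝ) (v : Fin n × Fin n) (ω : Ω) : ℝ :=
  finalTime t / n * (X v.1 ω ^ 2 / timeStep t v.1) - X v.1 ω * X v.2 ω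

omit [MeasurableSpace Ω] in
lemma volEstimator_eq_sum_pairTerm {t : Fin (n + 1) → ℝ} (ht : finalTime t ≠ 0) (hn : n ≠ 0)
    (X : Fin n → Ω → ℝ) (ω : Ω) :
    volEstimator t X ω = 1 / (n * finalTime t) * ∑ v, pairTerm t X v ω := by
  have hn' : (n : ℝ) ≠ 0 := by exact_mod_cast hn
  unfold volEstimator driftEstimator pairTerm
  rw [Finset.sum_sub_distrib, Fintype.sum_prod_type, Fintype.sum_prod_type]
  simp only [Finset.sum_const, Finset.card_univ, Fintype.card_fin, nsmul_eq_mul,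
    ← Finset.mul_sum]
  field_simp
  rw [← Finset.mul_sum, sq]

lemma measurable_pairTerm {t : Fin (n + 1) → ℝ} {X : Fin n → Ω → ℝ} (hX : ∀ k, Measurable (X k))
    (v : Fin n × Fin n) : Measurable (pairTerm t X v) := by
  unfold pairTerm; fun_prop

omit [MeasurableSpace Ω] in
/-- Pointwise domination of the `p`-th power of a summand by `2 p`-th powers of the returns. -/
lemma abs_pairTerm_rpow_le {t : Fin (n + 1) → ℝ} (X : Fin n → Ω → ℝ) {p : ℝ} (hp : 1 ≤ p)
    (hτ : 0 < finalTime t) (hκ : ∀ i, 0 < timeStep t i) (v : Fin n × Fin n) (ω : Ω) :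
    |pairTerm t X v ω| ^ p ≤ 2 ^ (p - 1) * ((finalTime t / n / timeStep t v.1) ^ p
        * |X v.1 ω| ^ (2 * p) + 1 / 2 * (|X v.1 ω| ^ (2 * p) + |X v.2 ω| ^ (2 * p))) := by
  refine (abs_sub_rpow_le hp _ _).trans ?_
  have hsq : ∀ x : ℝ, |x| ^ (2 * p) = (|x| ^ p) ^ 2 := fun x => by
    rw [← Real.rpow_natCast, ← Real.rpow_mul (abs_nonneg _)]; congr 1; push_cast; ring
  have h1 : |finalTime t / n * (X v.1 ω ^ 2 / timeStep t v.1)| ^ p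
      = (finalTime t / n / timeStep t v.1) ^ p * |X v.1 ω| ^ (2 * p) := by
    have := hκ v.1
    rw [show finalTime t / n * (X v.1 ω ^ 2 / timeStep t v.1)
        = finalTime t / n / timeStep t v.1 * X v.1 ω ^ 2 by ring, abs_mul,
      abs_of_nonneg (show 0 ≤ finalTime t / n / timeStep t v.1 by positivity),
      Real.mul_rpow (by positivity) (abs_nonneg _), abs_pow, ← Real.rpow_natCast |X v.1 ω|,
      ← Real.rpow_mul (abs_nonneg _)]
    norm_num
  have h2 : |X v.1 ω * X v.2 ω| ^ p
      ≤ 1 / 2 * (|X v.1 ω| ^ (2 * p) + |X v.2 ω| ^ (2 * p)) := by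
    rw [abs_mul, Real.mul_rpow (abs_nonneg _) (abs_nonneg _), hsq, hsq]
    nlinarith [sq_nonneg (|X v.1 ω| ^ p - |X v.2 ω| ^ p)]
  rw [h1]
  gcongr

lemma integrable_pairTerm_bound {X : Fin n → Ω → ℝ} {p : ℝ}
    (hi : ∀ i, Integrable (fun ω => |X i ω| ^ (2 * p)) μ) (a b : ℝ) (v : Fin n × Fin n) :
    Integrable (fun ω => a * (b * |X v.1 ω| ^ (2 * p)
      + 1 / 2 * (|X v.1 ω| ^ (2 * p) + |X v.2 ω| ^ (2 * p)))) μ :=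
  (((hi v.1).const_mul b).add (((hi v.1).add (hi v.2)).const_mul _)).const_mul a

lemma memLp_pairTerm {t : Fin (n + 1) → ℝ} {X : Fin n → Ω → ℝ} (hX : ∀ k, Measurable (X k))
    {p : ℝ} (hp : 1 ≤ p) (hτ : 0 < finalTime t) (hκ : ∀ i, 0 < timeStep t i)
    (hi : ∀ i, Integrable (fun ω => |X i ω| ^ (2 * p)) μ) (v : Fin n × Fin n) :
    MemLp (pairTerm t X v) (ENNReal.ofReal p) μ := by
  have hm := measurable_pairTerm (t := t) hX v
  have hj : Integrable (fun ω => |pairTerm t X v ω| ^ p) μ :=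
    integrable_of_nonneg_of_le (hm.abs.pow_const p)
      (fun ω => Real.rpow_nonneg (abs_nonneg _) _)
      (integrable_pairTerm_bound hi _ _ v) (abs_pairTerm_rpow_le X hp hτ hκ v)
  rw [← integrable_norm_rpow_iff hm.aestronglyMeasurable (by simp; linarith) (by simp),
    ENNReal.toReal_ofReal (by linarith)]
  exact hj

/-- The numerical inequality behind the constants of `momentFunctional`. -/
lemma one_add_le_sqrt_two_mul (u : ℝ) : 1 + u ≤ √2 * (1 + 1 / 2 * u ^ 2) := by
  have h2 : 1.41 ≤ √2 := Real.le_sqrt_of_sq_le (by norm_num)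
  nlinarith [mul_nonneg (sub_nonneg.2 h2) (show 0 ≤ 1 + 1 / 2 * u ^ 2 by positivity),
    sq_nonneg (u - 0.71)]

lemma sum_integral_pairTerm_le {t : Fin (n + 1) → ℝ} {X : Fin n → Ω → ℝ}
    (hX : ∀ k, Measurable (X k)) {p : ℝ} (hp : 1 ≤ p) (hτ : 0 < finalTime t)
    (hκ : ∀ i, 0 < timeStep t i) (hi : ∀ i, Integrable (fun ω => |X i ω| ^ (2 * p)) μ) :
    ∑ v, ∫ ω, |pairTerm t X v ω| ^ p ∂μ ≤ (n : ℝ) ^ 2 * momentFunctional μ (2 * p) t X := by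
  have h1 : ∀ v : Fin n × Fin n, ∫ ω, |pairTerm t X v ω| ^ p ∂μ
      ≤ 2 ^ (p - 1) * ((finalTime t / n / timeStep t v.1) ^ p * ∫ ω, |X v.1 ω| ^ (2 * p) ∂μ
        + 1 / 2 * (∫ ω, |X v.1 ω| ^ (2 * p) ∂μ + ∫ ω, |X v.2 ω| ^ (2 * p) ∂μ)) := by
    intro v
    refine (integral_mono_of_nonneg (Eventually.of_forall fun ω => by positivity)
      (integrable_pairTerm_bound hi _ _ v)
      (Eventually.of_forall (abs_pairTerm_rpow_le X hp hτ hκ v))).trans (le_of_eq ?_)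
    have ha : Integrable (fun ω => (finalTime t / n / timeStep t v.1) ^ p
      * |X v.1 ω| ^ (2 * p)) μ := (hi v.1).const_mul _
    have hb : Integrable (fun ω => 1 / 2 * (|X v.1 ω| ^ (2 * p) + |X v.2 ω| ^ (2 * p))) μ :=
      ((hi v.1).add (hi v.2)).const_mul _
    rw [integral_const_mul, integral_add ha hb, integral_const_mul, integral_const_mul,
      integral_add (hi v.1) (hi v.2)]
  refine (Finset.sum_le_sum fun v _ => h1 v).trans ?_
  have h2 : ∑ v : Fin n × Fin n, 2 ^ (p - 1) * ((finalTime t / n / timeStep t v.1) ^ p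
        * ∫ ω, |X v.1 ω| ^ (2 * p) ∂μ
        + 1 / 2 * (∫ ω, |X v.1 ω| ^ (2 * p) ∂μ + ∫ ω, |X v.2 ω| ^ (2 * p) ∂μ))
      = n * ∑ i, 2 ^ (p - 1) * ((1 + (finalTime t / n / timeStep t i) ^ p)
        * ∫ ω, |X i ω| ^ (2 * p) ∂μ) := by
    simp only [← Finset.mul_sum, Finset.sum_add_distrib, Fintype.sum_prod_type, Finset.sum_const,
      Finset.card_univ, Fintype.card_fin, nsmul_eq_mul, add_mul, one_mul]
    simp only [mul_left_comm _ (n : ℝ), ← Finset.mul_sum]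
    ring
  rw [h2]
  rcases Nat.eq_zero_or_pos n with rfl | hn
  · simp
  have hn' : (0 : ℝ) < n := by exact_mod_cast hn
  have h3 : (n : ℝ) ^ 2 * momentFunctional μ (2 * p) t X = n * ∑ i, (2 : ℝ) ^ ((2 * p - 1) / 2)
      * ((timeStep t i ^ (2 * p) + 1 / 2 * (finalTime t / n) ^ (2 * p)) *
        ∫ ω, |X i ω / timeStep t i| ^ (2 * p) ∂μ) := by
    unfold momentFunctional
    rw [← Finset.mul_sum]; field_simp
  rw [h3]
  refine mul_le_mul_of_nonneg_left (Finset.sum_le_sum fun i _ => ?_) hn'.le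
  have hκi := hκ i
  have hM : 0 ≤ ∫ ω, |X i ω| ^ (2 * p) ∂μ :=
    integral_nonneg fun ω => Real.rpow_nonneg (abs_nonneg _) _
  have h4 : ∫ ω, |X i ω / timeStep t i| ^ (2 * p) ∂μ
      = (∫ ω, |X i ω| ^ (2 * p) ∂μ) / timeStep t i ^ (2 * p) := by
    rw [← integral_div]
    refine integral_congr_ae (Eventually.of_forall fun ω => ?_)
    simp only
    rw [abs_div, abs_of_pos hκi, Real.div_rpow (abs_nonneg _) hκi.le]
  have h5 : (2 : ℝ) ^ ((2 * p - 1) / 2) = 2 ^ (p - 1) * √2 := by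
    rw [Real.sqrt_eq_rpow, ← Real.rpow_add (by norm_num)]; congr 1; ring
  have hsq : ∀ x : ℝ, 0 < x → x ^ (2 * p) = (x ^ p) ^ 2 := fun x hx => by
    rw [← Real.rpow_natCast, ← Real.rpow_mul hx.le]; congr 1; push_cast; ring
  have hτn : 0 < finalTime t / n := by positivity
  have hκp : 0 < timeStep t i ^ p := Real.rpow_pos_of_pos hκi p
  rw [h4, h5, Real.div_rpow hτn.le hκi.le, hsq _ hτn, hsq _ hκi, mul_assoc]
  refine mul_le_mul_of_nonneg_left ?_ (by positivity)
  refine (mul_le_mul_of_nonneg_right (one_add_le_sqrt_two_mul _) hM).trans (le_of_eq ?_)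
  field_simp

/-- The variance of the returns bounds their moment functional from below, by Jensen's
inequality. -/
lemma rpow_le_momentFunctional [IsProbabilityMeasure μ] {t : Fin (n + 1) → ℝ}
    {X : Fin n → Ω → ℝ} {p ν : ℝ} (hp : 1 ≤ p) (hn : n ≠ 0) (hν : 0 < ν)
    (hτ : 0 < finalTime t) (hκ : ∀ i, 0 < timeStep t i)
    (hi : ∀ i, Integrable (fun ω => |X i ω| ^ (2 * p)) μ)
    (hi2 : ∀ i, Integrable (fun ω => X i ω ^ 2) μ)
    (hvar : ∀ i, ∫ ω, X i ω ^ 2 ∂μ = ν * timeStep t i) :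
    (ν * (finalTime t / n)) ^ p ≤ momentFunctional μ (2 * p) t X := by
  have hn' : (0 : ℝ) < n := by exact_mod_cast Nat.pos_of_ne_zero hn
  have hτn : 0 < finalTime t / n := by positivity
  have hsq : ∀ x : ℝ, 0 ≤ x → x ^ (2 * p) = (x ^ p) ^ 2 := fun x hx => by
    rw [← Real.rpow_natCast, ← Real.rpow_mul hx]; congr 1; push_cast; ring
  have key : ∀ i, (ν * (finalTime t / n)) ^ p ≤
      (timeStep t i ^ (2 * p) + 1 / 2 * (finalTime t / n) ^ (2 * p)) *
        ∫ ω, |X i ω / timeStep t i| ^ (2 * p) ∂μ := by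
    intro i
    have hκi := hκ i
    have hfun : ∀ ω, |X i ω / timeStep t i| ^ (2 * p)
        = (X i ω ^ 2) ^ p / timeStep t i ^ (2 * p) := fun ω => by
      rw [abs_div, abs_of_pos hκi, Real.div_rpow (abs_nonneg _) hκi.le, ← sq_abs,
        ← Real.rpow_natCast |X i ω| 2, ← Real.rpow_mul (abs_nonneg _)]
      norm_num
    have hint : Integrable (fun ω => (X i ω ^ 2) ^ p) μ := (hi i).congr
      (Eventually.of_forall fun ω => by
        simp only
        rw [← sq_abs, ← Real.rpow_natCast |X i ω| 2, ← Real.rpow_mul (abs_nonneg _)]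
        norm_num)
    have hJ := integral_rpow_le hp (hi2 i) (fun ω => sq_nonneg _) hint
    rw [hvar i] at hJ
    simp only [hfun]
    rw [integral_div]
    have hκp : 0 < timeStep t i ^ p := Real.rpow_pos_of_pos hκi p
    have hτp : 0 < (finalTime t / n) ^ p := Real.rpow_pos_of_pos hτn p
    have hνp : 0 < ν ^ p := Real.rpow_pos_of_pos hν p
    rw [Real.mul_rpow hν.le hκi.le] at hJ
    rw [Real.mul_rpow hν.le hτn.le, hsq _ hκi.le, hsq _ hτn.le]
    set a := timeStep t i ^ p
    set b := (finalTime t / n) ^ p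
    calc ν ^ p * b ≤ (a ^ 2 + 1 / 2 * b ^ 2) * (ν ^ p * a / a ^ 2) := by
          rw [show (a ^ 2 + 1 / 2 * b ^ 2) * (ν ^ p * a / a ^ 2)
            = ν ^ p * ((a ^ 2 + 1 / 2 * b ^ 2) / a) by field_simp]
          gcongr
          rw [le_div_iff₀ hκp]
          nlinarith [sq_nonneg (a - b / 2), sq_nonneg b]
      _ ≤ _ := by gcongr
  unfold momentFunctional
  have h1 : (1 : ℝ) ≤ 2 ^ ((2 * p - 1) / 2) := Real.one_le_rpow (by norm_num) (by linarith)
  have h2 : n * (ν * (finalTime t / n)) ^ p ≤ ∑ i : Fin n,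
      (timeStep t i ^ (2 * p) + 1 / 2 * (finalTime t / n) ^ (2 * p)) *
        ∫ ω, |X i ω / timeStep t i| ^ (2 * p) ∂μ := by
    refine le_trans (le_of_eq ?_) (Finset.sum_le_sum fun i _ => key i)
    simp
  have h3 : 0 ≤ (ν * (finalTime t / n)) ^ p := by positivity
  calc (ν * (finalTime t / n)) ^ p = 1 / n * (n * (ν * (finalTime t / n)) ^ p) := by field_simp
    _ ≤ 2 ^ ((2 * p - 1) / 2) / n * (n * (ν * (finalTime t / n)) ^ p) := by gcongr
    _ ≤ _ := by gcongr

end QuadraticForm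

/-! ### Normalization and bias -/

section SecondMoment

variable {ι Ω : Type*} [Fintype ι] [MeasurableSpace Ω] {μ : Measure Ω} {G : SimpleGraph ι}
  {y : ι → Ω → ℝ}

/-- The second moment of the sum, with the covariances estimated by the second moments. -/
lemma integral_sum_sq_le (hG : IsDependencyGraph G y μ) (hm : ∀ v, Measurable (y v))
    (h2 : ∀ v, MemLp (y v) 2 μ) (h0 : ∀ v, ∫ ω, y v ω ∂μ = 0) {D : ℝ}
    (hD : ∀ v, ((nbhd G {v}).card : ℝ) ≤ D) :
    ∫ ω, (∑ v, y v ω) ^ 2 ∂μ ≤ D * ∑ v, ∫ ω, y v ω ^ 2 ∂μ := by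
  rw [integral_sum_sq hG hm h2 h0]
  have hi : ∀ v, Integrable (fun ω => y v ω ^ 2) μ := fun v => (h2 v).integrable_sq
  have h1 : ∀ v u, ∫ ω, y v ω * y u ω ∂μ
      ≤ 1 / 2 * ∫ ω, y v ω ^ 2 ∂μ + 1 / 2 * ∫ ω, y u ω ^ 2 ∂μ := by
    intro v u
    rw [← integral_const_mul, ← integral_const_mul,
      ← integral_add ((hi v).const_mul _) ((hi u).const_mul _)]
    refine integral_mono ((h2 v).integrable_mul (h2 u))
      (((hi v).const_mul _).add ((hi u).const_mul _)) fun ω => ?_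
    simp only
    nlinarith [sq_nonneg (y v ω - y u ω)]
  have h3 : ∀ v, 0 ≤ ∫ ω, y v ω ^ 2 ∂μ := fun v => integral_nonneg fun ω => sq_nonneg _
  refine (Finset.sum_le_sum fun v _ => Finset.sum_le_sum fun u _ => h1 v u).trans ?_
  have h4 := sum_sum_nbhd_left_le hD h3
  have h5 := sum_sum_nbhd_right_le hD h3
  simp only [Finset.sum_add_distrib, ← Finset.mul_sum] at h4 h5 ⊢
  linarith

end SecondMoment

section Times

variable {n : ℕ} {t : Fin (n + 1) → ℝ}

lemma timeStep_pos (h : StrictMono t) (i : Fin n) : 0 < timeStep t i :=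
  sub_pos.2 (h i.castSucc_lt_succ)

lemma sum_timeStep (h : t 0 = 0) : ∑ i, timeStep t i = finalTime t := by
  unfold timeStep finalTime
  have h1 := Fin.sum_univ_succ t
  have h2 := Fin.sum_univ_castSucc t
  rw [Finset.sum_sub_distrib]
  linarith

lemma finalTime_pos (h : t 0 = 0) (hm : StrictMono t) (hn : n ≠ 0) : 0 < finalTime t := by
  rw [← h]
  exact hm (Fin.pos_of_ne_zero (by simpa [Fin.ext_iff] using hn))

end Times

section Normalized

variable {Ω : Type*} [MeasurableSpace Ω] {μ : Measure Ω} [IsProbabilityMeasure μ] {n : ℕ}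
  {t : Fin (n + 1) → ℝ} {X : Fin n → Ω → ℝ} {ν p K : ℝ} {m : ℕ}

/-- The summands of the normalized volatility error: `pairTerm`, centred and divided by
`n t_n √(Var ν̂_n)`. -/
def normTerm (μ : Measure Ω) (t : Fin (n + 1) → ℝ) (X : Fin n → Ω → ℝ) (v : Fin n × Fin n)
    (ω : Ω) : ℝ :=
  1 / (n * finalTime t * √(Var[volEstimator t X; μ]))
    * (pairTerm t X v ω - ∫ ω', pairTerm t X v ω' ∂μ)

omit [IsProbabilityMeasure μ] in
lemma measurable_normTerm (hX : ∀ k, Measurable (X k)) (v : Fin n × Fin n) :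
    Measurable (normTerm μ t X v) :=
  ((measurable_pairTerm hX v).sub_const _).const_mul _

omit [IsProbabilityMeasure μ] in
lemma isDependencyGraph_normTerm {G : SimpleGraph (Fin n)} (hG : IsDependencyGraph G X μ) :
    IsDependencyGraph (pairGraph G) (normTerm μ t X) μ :=
  isDependencyGraph_pairGraph hG (g := fun v x =>
    1 / (n * finalTime t * √(Var[volEstimator t X; μ]))
      * (finalTime t / n * (x.1 ^ 2 / timeStep t v.1) - x.1 * x.2
        - ∫ ω', pairTerm t X v ω' ∂μ)) fun v => by fun_prop

omit [IsProbabilityMeasure μ] in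
lemma IsReturnModel.integrable_rpow (h : IsReturnModel μ ν (2 * p) t X m) (hp : 2 < p)
    (i : Fin n) : Integrable (fun ω => |X i ω| ^ (2 * p)) μ :=
  integrable_abs_rpow (by linarith) (h.memLp i)

lemma IsReturnModel.memLp_two (h : IsReturnModel μ ν (2 * p) t X m) (hp : 2 < p)
    (i : Fin n) : MemLp (X i) 2 μ := (h.memLp i).mono_exponent (by
  rw [show (2 : ℝ≥0∞) = ENNReal.ofReal 2 by simp]
  exact ENNReal.ofReal_le_ofReal (by linarith))

omit [IsProbabilityMeasure μ] in
lemma IsReturnModel.integral_sq (h : IsReturnModel μ ν (2 * p) t X m) (i : Fin n) :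
    ∫ ω, X i ω ^ 2 ∂μ = ν * timeStep t i := by
  rw [← h.variance i, variance_of_integral_eq_zero (h.measurable i).aemeasurable (h.mean i)]

omit [IsProbabilityMeasure μ] in
lemma IsReturnModel.memLp_pairTerm (h : IsReturnModel μ ν (2 * p) t X m) (hp : 2 < p)
    (hn : n ≠ 0) (v : Fin n × Fin n) : MemLp (pairTerm t X v) (ENNReal.ofReal p) μ :=
  _root_.memLp_pairTerm h.measurable (by linarith)
    (finalTime_pos h.time_zero h.time_strictMono hn) (timeStep_pos h.time_strictMono)
    (h.integrable_rpow hp) v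

lemma IsReturnModel.memLp_two_pairTerm (h : IsReturnModel μ ν (2 * p) t X m) (hp : 2 < p)
    (hn : n ≠ 0) (v : Fin n × Fin n) : MemLp (pairTerm t X v) 2 μ :=
  (h.memLp_pairTerm hp hn v).mono_exponent (by
    rw [show (2 : ℝ≥0∞) = ENNReal.ofReal 2 by simp]
    exact ENNReal.ofReal_le_ofReal hp.le)

lemma IsReturnModel.integrable_pairTerm (h : IsReturnModel μ ν (2 * p) t X m) (hp : 2 < p)
    (hn : n ≠ 0) (v : Fin n × Fin n) : Integrable (pairTerm t X v) μ :=
  (h.memLp_two_pairTerm hp hn v).integrable (by norm_num)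

lemma IsReturnModel.integral_volEstimator (h : IsReturnModel μ ν (2 * p) t X m) (hp : 2 < p)
    (hn : n ≠ 0) : ∫ ω, volEstimator t X ω ∂μ
      = 1 / (n * finalTime t) * ∑ v, ∫ ω, pairTerm t X v ω ∂μ := by
  simp only [volEstimator_eq_sum_pairTerm
    (finalTime_pos h.time_zero h.time_strictMono hn).ne' hn X]
  rw [integral_const_mul, integral_finsetSum _ fun v _ => h.integrable_pairTerm hp hn v]

lemma IsReturnModel.sum_normTerm (h : IsReturnModel μ ν (2 * p) t X m) (hp : 2 < p)
    (hn : n ≠ 0) (ω : Ω) : ∑ v, normTerm μ t X v ω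
      = (volEstimator t X ω - ∫ ω', volEstimator t X ω' ∂μ) / √(Var[volEstimator t X; μ]) := by
  unfold normTerm
  rw [← Finset.mul_sum, Finset.sum_sub_distrib, h.integral_volEstimator hp hn,
    volEstimator_eq_sum_pairTerm (finalTime_pos h.time_zero h.time_strictMono hn).ne' hn X,
    ← mul_sub, mul_comm (n * finalTime t) _, ← div_div, div_mul_eq_mul_div, one_div, one_div]
  ring

lemma IsReturnModel.normalizedVolError_eq (h : IsReturnModel μ ν (2 * p) t X m) (hp : 2 < p)
    (hn : n ≠ 0) : normalizedVolError μ ν t X = fun ω => ∑ v, normTerm μ t X v ω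
      + (∫ ω', volEstimator t X ω' ∂μ - ν) / √(Var[volEstimator t X; μ]) := by
  funext ω
  rw [h.sum_normTerm hp hn, normalizedVolError, ← add_div]
  ring

omit [IsProbabilityMeasure μ] in
lemma measurable_volEstimator (hX : ∀ k, Measurable (X k)) : Measurable (volEstimator t X) := by
  unfold volEstimator driftEstimator; fun_prop

lemma IsReturnModel.integral_sum_normTerm_sq (h : IsReturnModel μ ν (2 * p) t X m) (hp : 2 < p)
    (hn : n ≠ 0) (hV : 0 < Var[volEstimator t X; μ]) :
    ∫ ω, (∑ v, normTerm μ t X v ω) ^ 2 ∂μ = 1 := by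
  simp only [h.sum_normTerm hp hn, div_pow, Real.sq_sqrt hV.le]
  rw [integral_div, ← variance_eq_integral (measurable_volEstimator h.measurable).aemeasurable,
    div_self hV.ne']

lemma IsReturnModel.integral_normTerm (h : IsReturnModel μ ν (2 * p) t X m) (hp : 2 < p)
    (hn : n ≠ 0) (v : Fin n × Fin n) : ∫ ω, normTerm μ t X v ω ∂μ = 0 := by
  unfold normTerm
  rw [integral_const_mul, integral_sub (h.integrable_pairTerm hp hn v) (integrable_const _)]
  simp

lemma IsReturnModel.memLp_normTerm (h : IsReturnModel μ ν (2 * p) t X m) (hp : 2 < p)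
    (hn : n ≠ 0) (v : Fin n × Fin n) : MemLp (normTerm μ t X v) (ENNReal.ofReal p) μ :=
  ((h.memLp_pairTerm hp hn v).sub (memLp_const _)).const_mul _

/-- The bias of the volatility estimator, `-E (∑ X_k) ^ 2 / (n t_n)`, is controlled by the
dependency graph. -/
lemma IsReturnModel.abs_integral_volEstimator_sub_le (h : IsReturnModel μ ν (2 * p) t X m)
    (hp : 2 < p) (hn : n ≠ 0) :
    |∫ ω, volEstimator t X ω ∂μ - ν| ≤ (m + 1) * ν / n := by
  have hT := finalTime_pos h.time_zero h.time_strictMono hn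
  have hn' : (0 : ℝ) < n := by exact_mod_cast Nat.pos_of_ne_zero hn
  obtain ⟨G, hG, hdeg⟩ := h.dependency
  have hS2 : MemLp (fun ω => ∑ k, X k ω) 2 μ := memLp_finsetSum _ fun k _ => h.memLp_two hp k
  have h1 : ∫ ω, volEstimator t X ω ∂μ - ν
      = -(1 / (n * finalTime t) * ∫ ω, (∑ k, X k ω) ^ 2 ∂μ) := by
    have hκ := fun i => (timeStep_pos h.time_strictMono i).ne'
    have e1 : ∀ ω, volEstimator t X ω = 1 / n * ∑ k, X k ω ^ 2 / timeStep t k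
        - 1 / (n * finalTime t) * (∑ k, X k ω) ^ 2 := fun ω => by
      unfold volEstimator driftEstimator; field_simp
    have i1 : ∀ k, Integrable (fun ω => X k ω ^ 2 / timeStep t k) μ := fun k =>
      (h.memLp_two hp k).integrable_sq.div_const _
    have i2 : Integrable (fun ω => 1 / (n : ℝ) * ∑ k, X k ω ^ 2 / timeStep t k) μ :=
      (integrable_finsetSum _ fun k _ => i1 k).const_mul _
    have i3 : Integrable (fun ω => 1 / (n * finalTime t) * (∑ k, X k ω) ^ 2) μ :=
      hS2.integrable_sq.const_mul _
    simp only [e1]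
    rw [integral_sub i2 i3, integral_const_mul, integral_const_mul,
      integral_finsetSum _ fun k _ => i1 k]
    have e2 : ∀ k, ∫ ω, X k ω ^ 2 / timeStep t k ∂μ = ν := fun k => by
      rw [integral_div, h.integral_sq, mul_div_cancel_right₀ _ (hκ k)]
    simp only [e2, Finset.sum_const, Finset.card_univ, Fintype.card_fin, nsmul_eq_mul]
    field_simp
    ring
  have hD : ∀ v, ((nbhd G {v}).card : ℝ) ≤ m + 1 := fun v => by
    exact_mod_cast card_nbhd_le (hdeg v)
  have h2 := integral_sum_sq_le hG h.measurable (h.memLp_two hp) h.mean hD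
  simp only [h.integral_sq, ← Finset.mul_sum, sum_timeStep h.time_zero] at h2
  have h3 : 0 ≤ ∫ ω, (∑ k, X k ω) ^ 2 ∂μ := integral_nonneg fun ω => sq_nonneg _
  rw [h1, abs_neg, abs_of_nonneg (by positivity)]
  calc 1 / (n * finalTime t) * ∫ ω, (∑ k, X k ω) ^ 2 ∂μ
      ≤ 1 / (n * finalTime t) * ((m + 1) * (ν * finalTime t)) := by gcongr
    _ = (m + 1) * ν / n := by field_simp

end Normalized

/-! ### The Berry-Esseen bounds -/

section Scalars

/-- The powers of `n` collected in `D ^ (r - 1) * n ^ 2 * (a / n ^ (3 / 2)) ^ r`, where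
`D = w * n`. -/
lemma pow_collect {w a n r : ℝ} (hw : 0 < w) (ha : 0 < a) (hn : 0 < n) :
    (w * n) ^ (r - 1) * (2 ^ r * (n ^ 2 * (a / (n * √n)) ^ r))
      = 2 ^ r * (w ^ (r - 1) * a ^ r * n ^ (1 - r / 2)) := by
  have h1 : n * √n = n ^ (3 / 2 : ℝ) := by
    rw [Real.sqrt_eq_rpow, ← Real.rpow_one_add' hn.le (by norm_num)]; norm_num
  have h2 : n ^ (r - 1) * n ^ 2 * (n ^ (3 / 2 * r))⁻¹ = n ^ (1 - r / 2) := by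
    rw [← Real.rpow_neg hn.le, ← Real.rpow_natCast n 2, ← Real.rpow_add hn, ← Real.rpow_add hn]
    congr 1; push_cast; ring
  rw [Real.mul_rpow hw.le hn.le, h1, Real.div_rpow ha.le (by positivity), ← Real.rpow_mul hn.le,
    ← h2]
  ring

/-- The `(p + 1)`-st power of the rate. -/
lemma rate_rpow {x T w n p : ℝ} (hx : 0 < x) (hT : 0 < T) (hw : 0 < w) (hn : 0 < n)
    (hp : 0 < p) :
    (x ^ (p / (p + 1)) * T ^ (1 / (p + 1)) * w ^ ((p - 1) / (p + 1))
        * n ^ (-((p - 2) / (2 * (p + 1))))) ^ (p + 1)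
      = w ^ (p - 1) * (x * T ^ (1 / p)) ^ p * n ^ (1 - p / 2) := by
  have hp1 : p + 1 ≠ 0 := by positivity
  rw [Real.mul_rpow (by positivity) (by positivity), Real.mul_rpow (by positivity) (by positivity),
    Real.mul_rpow (by positivity) (by positivity), Real.mul_rpow hx.le (by positivity),
    ← Real.rpow_mul hx.le, ← Real.rpow_mul hT.le, ← Real.rpow_mul hw.le, ← Real.rpow_mul hn.le,
    ← Real.rpow_mul hT.le]
  rw [div_mul_cancel₀ _ hp1, div_mul_cancel₀ _ hp1, div_mul_cancel₀ _ hp1,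
    one_div_mul_cancel hp.ne', show -((p - 2) / (2 * (p + 1))) * (p + 1) = 1 - p / 2 by
      field_simp; ring]
  ring

lemma cubic_rate {x T w n p : ℝ} (hT : 0 < T) (hn : 0 < n) :
    w ^ (3 - 1 : ℝ) * (x * T ^ (1 / p)) ^ (3 : ℝ) * n ^ (1 - 3 / 2 : ℝ)
      = x ^ 3 * T ^ (3 / p) * (w ^ 2 / √n) := by
  have h1 : (T ^ (1 / p)) ^ 3 = T ^ (3 / p) := by
    rw [← Real.rpow_natCast, ← Real.rpow_mul hT.le]; congr 1; push_cast; ring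
  have h2 : n ^ (1 - 3 / 2 : ℝ) = 1 / √n := by
    rw [Real.sqrt_eq_rpow, one_div, ← Real.rpow_neg hn.le]; norm_num
  rw [show (3 - 1 : ℝ) = (2 : ℕ) by norm_num, Real.rpow_natCast, h2,
    show (3 : ℝ) = (3 : ℕ) by norm_num, Real.rpow_natCast, mul_pow]
  push_cast
  rw [h1]; ring

/-- The bias is at most of the order of the rate `E`. -/
lemma bias_scale_le {w a n p E : ℝ} (hw : 0 < w) (ha : 0 < a) (hn : 0 < n) (hp : 2 < p)
    (hE : 0 < E) (hE1 : E < 1) (hq : 1 ≤ w * a ^ 2)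
    (h : E ^ (p + 1) = w ^ (p - 1) * a ^ p * n ^ (1 - p / 2)) : a * w / √n ≤ E := by
  by_contra! hlt
  have hb : E ^ (p - 2) < (a * w / √n) ^ (p - 2) := Real.rpow_lt_rpow hE.le hlt (by linarith)
  have h1 : E ^ (p + 1) = w * a ^ 2 * (a * w / √n) ^ (p - 2) := by
    have e1 : (√n ^ (p - 2))⁻¹ = n ^ (1 - p / 2) := by
      rw [Real.sqrt_eq_rpow, ← Real.rpow_mul hn.le, ← Real.rpow_neg hn.le]; congr 1; ring
    have e2 : a ^ p = a ^ 2 * a ^ (p - 2) := by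
      rw [← Real.rpow_natCast a 2, ← Real.rpow_add ha]; congr 1; push_cast; ring
    have e3 : w ^ (p - 1) = w * w ^ (p - 2) := by
      rw [← Real.rpow_one_add' hw.le (by linarith)]; congr 1; ring
    rw [h, Real.div_rpow (by positivity) (by positivity), Real.mul_rpow ha.le hw.le,
      ← e1, e2, e3]
    ring
  have h2 : E ^ (p + 1) ≤ E ^ (p - 2) :=
    Real.rpow_le_rpow_of_exponent_ge hE hE1.le (by linarith)
  have h3 : (a * w / √n) ^ (p - 2) ≤ w * a ^ 2 * (a * w / √n) ^ (p - 2) :=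
    le_mul_of_one_le_left (by positivity) hq
  linarith

end Scalars

section Bounds

variable {Ω : Type*} [MeasurableSpace Ω] {μ : Measure Ω} [IsProbabilityMeasure μ] {n : ℕ}
  {t : Fin (n + 1) → ℝ} {X : Fin n → Ω → ℝ} {ν p K : ℝ} {m : ℕ}

/-- The natural scale of the summands: `normTerm` is of order `volScale / n ^ (3 / 2)`. -/
def volScale (μ : Measure Ω) (p K : ℝ) (t : Fin (n + 1) → ℝ) (X : Fin n → Ω → ℝ) : ℝ :=
  n / (K * finalTime t) * momentFunctional μ (2 * p) t X ^ (1 / p)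

lemma IsReturnModel.rpow_le_momentFunctional (h : IsReturnModel μ ν (2 * p) t X m) (hp : 2 < p)
    (hν : 0 < ν) (hn : n ≠ 0) :
    (ν * (finalTime t / n)) ^ p ≤ momentFunctional μ (2 * p) t X :=
  _root_.rpow_le_momentFunctional (by linarith) hn hν
    (finalTime_pos h.time_zero h.time_strictMono hn) (timeStep_pos h.time_strictMono)
    (h.integrable_rpow hp) (fun i => (h.memLp_two hp i).integrable_sq) h.integral_sq

lemma IsReturnModel.momentFunctional_pos (h : IsReturnModel μ ν (2 * p) t X m) (hp : 2 < p)
    (hν : 0 < ν) (hn : n ≠ 0) : 0 < momentFunctional μ (2 * p) t X := by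
  have hT := finalTime_pos h.time_zero h.time_strictMono hn
  have hn' : (0 : ℝ) < n := by exact_mod_cast Nat.pos_of_ne_zero hn
  exact lt_of_lt_of_le (by positivity) (h.rpow_le_momentFunctional hp hν hn)

lemma IsReturnModel.volScale_pos (h : IsReturnModel μ ν (2 * p) t X m) (hp : 2 < p)
    (hν : 0 < ν) (hK : 0 < K) (hn : n ≠ 0) : 0 < volScale μ p K t X := by
  have hT := finalTime_pos h.time_zero h.time_strictMono hn
  have hn' : (0 : ℝ) < n := by exact_mod_cast Nat.pos_of_ne_zero hn
  have := h.momentFunctional_pos hp hν hn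
  unfold volScale; positivity

omit [IsProbabilityMeasure μ] in
lemma div_sqrt_le_sqrt_variance (hV : K ^ 2 / n ≤ Var[volEstimator t X; μ]) :
    K / √(n : ℝ) ≤ √(Var[volEstimator t X; μ]) := by
  refine Real.le_sqrt_of_sq_le ?_
  rwa [div_pow, Real.sq_sqrt (Nat.cast_nonneg n)]

lemma IsReturnModel.normalization_mul_le (h : IsReturnModel μ ν (2 * p) t X m) (hp : 2 < p)
    (hν : 0 < ν) (hK : 0 < K) (hn : n ≠ 0) (hV : K ^ 2 / n ≤ Var[volEstimator t X; μ]) :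
    1 / (n * finalTime t * √(Var[volEstimator t X; μ]))
        * momentFunctional μ (2 * p) t X ^ (1 / p) ≤ volScale μ p K t X / (n * √(n : ℝ)) := by
  have hT := finalTime_pos h.time_zero h.time_strictMono hn
  have hn' : (0 : ℝ) < n := by exact_mod_cast Nat.pos_of_ne_zero hn
  have hM := h.momentFunctional_pos hp hν hn
  have hs : √(n : ℝ) ^ 2 = n := Real.sq_sqrt hn'.le
  have hsn : 0 < √(n : ℝ) := Real.sqrt_pos.2 hn'
  calc _ ≤ 1 / (n * finalTime t * (K / √(n : ℝ)))
        * momentFunctional μ (2 * p) t X ^ (1 / p) := by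
        have := div_sqrt_le_sqrt_variance hV
        gcongr
    _ = volScale μ p K t X / (n * √(n : ℝ)) := by
        unfold volScale; field_simp; rw [hs]

/-- Averaged moments of the summands before normalization. -/
lemma IsReturnModel.sum_integral_pairTerm_le (h : IsReturnModel μ ν (2 * p) t X m) (hp : 2 < p)
    (hν : 0 < ν) (hn : n ≠ 0) {r : ℝ} (hr : 0 ≤ r) (hrp : r ≤ p) :
    ∑ v, ∫ ω, |pairTerm t X v ω| ^ r ∂μ
      ≤ (n : ℝ) ^ 2 * (momentFunctional μ (2 * p) t X ^ (1 / p)) ^ r := by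
  have hM := h.momentFunctional_pos hp hν hn
  have h1 := sum_integral_rpow_le (μ := μ) (Y := fun v ω => |pairTerm t X v ω|)
    (s := momentFunctional μ (2 * p) t X ^ (1 / p)) (p := p) (by positivity) hr hrp (by linarith)
    (fun _ _ => abs_nonneg _)
    (fun v => integrable_abs_rpow (by linarith) (h.memLp_pairTerm hp hn v)) (by
      rw [← Real.rpow_mul hM.le, one_div_mul_cancel (by linarith), Real.rpow_one]
      simpa [sq] using _root_.sum_integral_pairTerm_le h.measurable (by linarith)
        (finalTime_pos h.time_zero h.time_strictMono hn) (timeStep_pos h.time_strictMono)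
        (h.integrable_rpow hp))
  simpa [sq] using h1

lemma IsReturnModel.sum_integral_normTerm_le (h : IsReturnModel μ ν (2 * p) t X m) (hp : 2 < p)
    (hν : 0 < ν) (hK : 0 < K) (hn : n ≠ 0) (hV : K ^ 2 / n ≤ Var[volEstimator t X; μ])
    {r : ℝ} (hr : 1 ≤ r) (hrp : r ≤ p) :
    (4 * ((m : ℝ) + 1) * n) ^ (r - 1) * ∑ v, ∫ ω, |normTerm μ t X v ω| ^ r ∂μ
      ≤ 2 ^ r * ((4 * ((m : ℝ) + 1)) ^ (r - 1) * volScale μ p K t X ^ r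
        * (n : ℝ) ^ (1 - r / 2)) := by
  have hT := finalTime_pos h.time_zero h.time_strictMono hn
  have hn' : (0 : ℝ) < n := by exact_mod_cast Nat.pos_of_ne_zero hn
  have hM := h.momentFunctional_pos hp hν hn
  set c := 1 / (n * finalTime t * √(Var[volEstimator t X; μ])) with hc
  have hc0 : 0 ≤ c := by positivity
  have h1 : ∀ v, ∫ ω, |normTerm μ t X v ω| ^ r ∂μ
      ≤ c ^ r * (2 ^ r * ∫ ω, |pairTerm t X v ω| ^ r ∂μ) := by
    intro v
    have e1 : ∀ ω, |normTerm μ t X v ω| ^ r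
        = c ^ r * |pairTerm t X v ω - ∫ ω', pairTerm t X v ω' ∂μ| ^ r := fun ω => by
      rw [normTerm, abs_mul, ← hc, abs_of_nonneg hc0, Real.mul_rpow hc0 (abs_nonneg _)]
    simp only [e1]
    rw [integral_const_mul]
    exact mul_le_mul_of_nonneg_left (integral_abs_sub_mean_rpow_le hr
      ((h.memLp_pairTerm hp hn v).mono_exponent (ENNReal.ofReal_le_ofReal hrp))) (by positivity)
  rw [← pow_collect (by positivity) (h.volScale_pos hp hν hK hn) hn']
  refine mul_le_mul_of_nonneg_left ?_ (by positivity)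
  have hs := h.sum_integral_pairTerm_le hp hν hn (by linarith) hrp
  set s := momentFunctional μ (2 * p) t X ^ (1 / p) with hsdef
  have hs0 : 0 < s := by positivity
  calc ∑ v, ∫ ω, |normTerm μ t X v ω| ^ r ∂μ
      ≤ ∑ v, c ^ r * (2 ^ r * ∫ ω, |pairTerm t X v ω| ^ r ∂μ) :=
        Finset.sum_le_sum fun v _ => h1 v
    _ = c ^ r * (2 ^ r * ∑ v, ∫ ω, |pairTerm t X v ω| ^ r ∂μ) := by
        rw [← Finset.mul_sum, ← Finset.mul_sum]
    _ ≤ c ^ r * (2 ^ r * ((n : ℝ) ^ 2 * s ^ r)) := by gcongr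
    _ = 2 ^ r * ((n : ℝ) ^ 2 * (c * s) ^ r) := by rw [Real.mul_rpow hc0 hs0.le]; ring
    _ ≤ _ := by
        have := h.normalization_mul_le hp hν hK hn hV
        gcongr

omit [IsProbabilityMeasure μ] in
lemma IsReturnModel.card_nbhd_le (h : IsReturnModel μ ν (2 * p) t X m) :
    ∃ G : SimpleGraph (Fin n × Fin n), IsDependencyGraph G (normTerm μ t X) μ ∧
      ∀ v, ((nbhd G {v}).card : ℝ) ≤ 4 * ((m : ℝ) + 1) * n := by
  obtain ⟨G, hG, hdeg⟩ := h.dependency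
  refine ⟨pairGraph G, isDependencyGraph_normTerm hG, fun v => ?_⟩
  have := card_nbhd_pairGraph_le (fun i => _root_.card_nbhd_le (hdeg i)) v
  rw [Fintype.card_fin] at this
  exact_mod_cast this

/-- Since the normalized error has variance one, its summands cannot be too small. -/
lemma IsReturnModel.one_le_mul_volScale_sq (h : IsReturnModel μ ν (2 * p) t X m) (hp : 2 < p)
    (hν : 0 < ν) (hK : 0 < K) (hn : n ≠ 0) (hV : K ^ 2 / n ≤ Var[volEstimator t X; μ]) :
    1 ≤ 4 * ((m : ℝ) + 1) * volScale μ p K t X ^ 2 := by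
  have hT := finalTime_pos h.time_zero h.time_strictMono hn
  have hn' : (0 : ℝ) < n := by exact_mod_cast Nat.pos_of_ne_zero hn
  have hM := h.momentFunctional_pos hp hν hn
  have hV0 : 0 < Var[volEstimator t X; μ] := lt_of_lt_of_le (by positivity) hV
  obtain ⟨G, hG, hD⟩ := h.card_nbhd_le
  have hle : ENNReal.ofReal 2 ≤ ENNReal.ofReal p := ENNReal.ofReal_le_ofReal hp.le
  have h1 := integral_sum_sq_le hG (measurable_normTerm h.measurable) (fun v =>
    (h.memLp_normTerm hp hn v).mono_exponent (by simpa using hle)) (h.integral_normTerm hp hn) hD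
  rw [h.integral_sum_normTerm_sq hp hn hV0] at h1
  have hc0 : 0 ≤ 1 / (n * finalTime t * √(Var[volEstimator t X; μ])) := by positivity
  have h2 : ∀ v, ∫ ω, normTerm μ t X v ω ^ 2 ∂μ
      ≤ (1 / (n * finalTime t * √(Var[volEstimator t X; μ]))) ^ 2
        * ∫ ω, |pairTerm t X v ω| ^ (2 : ℝ) ∂μ := by
    intro v
    unfold normTerm
    simp only [mul_pow, Real.rpow_ofNat, sq_abs]
    rw [integral_const_mul]
    refine mul_le_mul_of_nonneg_left ?_ (by positivity)
    rw [← variance_eq_integral (measurable_pairTerm h.measurable v).aemeasurable]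
    exact variance_le_expectation_sq (measurable_pairTerm h.measurable v).aestronglyMeasurable
  have h3 := h.sum_integral_pairTerm_le hp hν hn (r := 2) (by norm_num) hp.le
  have h4 := h.normalization_mul_le hp hν hK hn hV
  have hs : √(n : ℝ) ^ 2 = n := Real.sq_sqrt hn'.le
  set c := 1 / (n * finalTime t * √(Var[volEstimator t X; μ]))
  set s := momentFunctional μ (2 * p) t X ^ (1 / p)
  have hs0 : 0 < s := by positivity
  calc (1 : ℝ) ≤ 4 * ((m : ℝ) + 1) * n * ∑ v, ∫ ω, normTerm μ t X v ω ^ 2 ∂μ := h1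
    _ ≤ 4 * ((m : ℝ) + 1) * n * ∑ v, c ^ 2 * ∫ ω, |pairTerm t X v ω| ^ (2 : ℝ) ∂μ := by
        gcongr with v; exact h2 v
    _ = 4 * ((m : ℝ) + 1) * n * (c ^ 2 * ∑ v, ∫ ω, |pairTerm t X v ω| ^ (2 : ℝ) ∂μ) := by
        rw [← Finset.mul_sum]
    _ ≤ 4 * ((m : ℝ) + 1) * n * (c ^ 2 * ((n : ℝ) ^ 2 * s ^ (2 : ℝ))) := by gcongr
    _ = 4 * ((m : ℝ) + 1) * n * ((n : ℝ) ^ 2 * (c * s) ^ 2) := by rw [Real.rpow_two]; ring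
    _ ≤ 4 * ((m : ℝ) + 1) * n * ((n : ℝ) ^ 2 * (volScale μ p K t X / (n * √(n : ℝ))) ^ 2) := by
        gcongr
    _ = 4 * ((m : ℝ) + 1) * volScale μ p K t X ^ 2 := by
        rw [div_pow, mul_pow, hs]; field_simp

/-- The Kolmogorov distance of the normalized error exceeds that of its centred version by at most
the effect of the bias. -/
lemma IsReturnModel.kolmogorovDist_le_add (h : IsReturnModel μ ν (2 * p) t X m) (hp : 2 < p)
    (hν : 0 < ν) (hK : 0 < K) (hn : n ≠ 0) (hV : K ^ 2 / n ≤ Var[volEstimator t X; μ]) :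
    kolmogorovDist (μ.map (normalizedVolError μ ν t X)) (gaussianReal 0 1)
      ≤ kolmogorovDist (μ.map fun ω => ∑ v, normTerm μ t X v ω) (gaussianReal 0 1)
        + 0.1 * (volScale μ p K t X * (4 * ((m : ℝ) + 1)) / √(n : ℝ)) := by
  have hT := finalTime_pos h.time_zero h.time_strictMono hn
  have hn' : (0 : ℝ) < n := by exact_mod_cast Nat.pos_of_ne_zero hn
  have hsn : 0 < √(n : ℝ) := Real.sqrt_pos.2 hn'
  have hs : √(n : ℝ) ^ 2 = n := Real.sq_sqrt hn'.le
  have hM := h.momentFunctional_pos hp hν hn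
  have hU : Measurable fun ω => ∑ v, normTerm μ t X v ω :=
    Finset.measurable_fun_sum _ fun v _ => measurable_normTerm h.measurable v
  have h1 := kolmogorovDist_map_add_const_le μ hU
    ((∫ ω', volEstimator t X ω' ∂μ - ν) / √(Var[volEstimator t X; μ]))
  rw [← h.normalizedVolError_eq hp hn] at h1
  have h2 : ν * (finalTime t / n) ≤ momentFunctional μ (2 * p) t X ^ (1 / p) := by
    have := Real.rpow_le_rpow (by positivity) (h.rpow_le_momentFunctional hp hν hn)
      (show 0 ≤ 1 / p by positivity)
    rwa [← Real.rpow_mul (by positivity), mul_one_div_cancel (by linarith), Real.rpow_one] at this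
  have h3 : |(∫ ω', volEstimator t X ω' ∂μ - ν) / √(Var[volEstimator t X; μ])|
      ≤ volScale μ p K t X * ((m : ℝ) + 1) / √(n : ℝ) := by
    rw [abs_div, abs_of_nonneg (Real.sqrt_nonneg _)]
    calc _ ≤ ((m : ℝ) + 1) * ν / n / (K / √(n : ℝ)) := by
          have := h.abs_integral_volEstimator_sub_le hp hn
          have := div_sqrt_le_sqrt_variance hV
          gcongr
      _ = n / (K * finalTime t) * (ν * (finalTime t / n)) * ((m : ℝ) + 1) / √(n : ℝ) := by
          field_simp; rw [hs]
      _ ≤ _ := by unfold volScale; gcongr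
  refine h1.trans (add_le_add le_rfl ((mul_le_mul_of_nonneg_left h3 (by norm_num)).trans
    (le_of_eq ?_)))
  ring

/-- The Berry-Esseen bound when returns have between four and six moments. -/
theorem IsReturnModel.kolmogorovDist_le (h : IsReturnModel μ ν (2 * p) t X m) (hp : 2 < p)
    (hp3 : p < 3) (hν : 0 < ν) (hK : 0 < K) (hn : n ≠ 0)
    (hV : K ^ 2 / n ≤ Var[volEstimator t X; μ]) :
    kolmogorovDist (μ.map (normalizedVolError μ ν t X)) (gaussianReal 0 1) ≤
      8.015 * ((n / (K * finalTime t)) ^ (p / (p + 1))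
        * momentFunctional μ (2 * p) t X ^ (1 / (p + 1))
        * (4 * ((m : ℝ) + 1)) ^ ((p - 1) / (p + 1))
        * (n : ℝ) ^ (-((p - 2) / (2 * (p + 1))))) := by
  have hT := finalTime_pos h.time_zero h.time_strictMono hn
  have hn' : (0 : ℝ) < n := by exact_mod_cast Nat.pos_of_ne_zero hn
  have hM := h.momentFunctional_pos hp hν hn
  have hw : 0 < 4 * ((m : ℝ) + 1) := by positivity
  have hV0 : 0 < Var[volEstimator t X; μ] := lt_of_lt_of_le (by positivity) hV
  have hEp := rate_rpow (show 0 < n / (K * finalTime t) by positivity) hM hw hn'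
    (show 0 < p by linarith)
  set E := (n / (K * finalTime t)) ^ (p / (p + 1))
        * momentFunctional μ (2 * p) t X ^ (1 / (p + 1))
        * (4 * ((m : ℝ) + 1)) ^ ((p - 1) / (p + 1))
        * (n : ℝ) ^ (-((p - 2) / (2 * (p + 1)))) with hE
  have hE0 : 0 < E := by positivity
  have hmeas : Measurable (normalizedVolError μ ν t X) :=
    ((measurable_volEstimator h.measurable).sub_const _).div_const _
  have : IsProbabilityMeasure (μ.map (normalizedVolError μ ν t X)) :=
    Measure.isProbabilityMeasure_map hmeas.aemeasurable
  by_cases hE1 : E ≤ 1 / 8.015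
  · obtain ⟨G, hG, hD⟩ := h.card_nbhd_le
    have hβ := h.sum_integral_normTerm_le hp hν hK hn hV (r := p) (by linarith) le_rfl
    rw [volScale, ← hEp] at hβ
    have h1 := kolmogorovDist_sum_le hG (measurable_normTerm h.measurable) hp hp3.le
      (h.memLp_normTerm hp hn) (h.integral_normTerm hp hn)
      (h.integral_sum_normTerm_sq hp hn hV0) (by positivity) hD hE0 hE1 hβ
    have h2 := bias_scale_le hw (h.volScale_pos hp hν hK hn) hn' hp hE0
      (hE1.trans_lt (by norm_num)) (h.one_le_mul_volScale_sq hp hν hK hn hV) hEp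
    have h3 := h.kolmogorovDist_le_add hp hν hK hn hV
    linarith
  · refine (kolmogorovDist_le_one _ _).trans ?_
    rw [not_le, div_lt_iff₀ (by norm_num)] at hE1
    linarith

/-- The Berry-Esseen bound when returns have at least six moments. -/
theorem IsReturnModel.kolmogorovDist_le_max (h : IsReturnModel μ ν (2 * p) t X m) (hp : 3 ≤ p)
    (hν : 0 < ν) (hK : 0 < K) (hn : n ≠ 0)
    (hV : K ^ 2 / n ≤ Var[volEstimator t X; μ]) :
    kolmogorovDist (μ.map (normalizedVolError μ ν t X)) (gaussianReal 0 1) ≤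
      max (18.96 * ((n / (K * finalTime t)) ^ (p / (p + 1))
        * momentFunctional μ (2 * p) t X ^ (1 / (p + 1))
        * (4 * ((m : ℝ) + 1)) ^ ((p - 1) / (p + 1))
        * (n : ℝ) ^ (-((p - 2) / (2 * (p + 1))))))
        (227.5 * ((n / (K * finalTime t)) ^ 3 * momentFunctional μ (2 * p) t X ^ (3 / p)
        * ((4 * ((m : ℝ) + 1)) ^ 2 / √(n : ℝ)))) := by
  have hp2 : 2 < p := by linarith
  have hT := finalTime_pos h.time_zero h.time_strictMono hn
  have hn' : (0 : ℝ) < n := by exact_mod_cast Nat.pos_of_ne_zero hn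
  have hM := h.momentFunctional_pos hp2 hν hn
  have hw : 0 < 4 * ((m : ℝ) + 1) := by positivity
  have hV0 : 0 < Var[volEstimator t X; μ] := lt_of_lt_of_le (by positivity) hV
  have hEp := rate_rpow (show 0 < n / (K * finalTime t) by positivity) hM hw hn'
    (show 0 < p by linarith)
  set E := (n / (K * finalTime t)) ^ (p / (p + 1))
        * momentFunctional μ (2 * p) t X ^ (1 / (p + 1))
        * (4 * ((m : ℝ) + 1)) ^ ((p - 1) / (p + 1))
        * (n : ℝ) ^ (-((p - 2) / (2 * (p + 1)))) with hE
  have hE0 : 0 < E := by positivity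
  have he3 := cubic_rate (x := n / (K * finalTime t)) (w := 4 * ((m : ℝ) + 1)) (p := p) hM hn'
  set e := (n / (K * finalTime t)) ^ 3 * momentFunctional μ (2 * p) t X ^ (3 / p)
        * ((4 * ((m : ℝ) + 1)) ^ 2 / √(n : ℝ)) with he
  have he0 : 0 ≤ e := by positivity
  have hmeas : Measurable (normalizedVolError μ ν t X) :=
    ((measurable_volEstimator h.measurable).sub_const _).div_const _
  have : IsProbabilityMeasure (μ.map (normalizedVolError μ ν t X)) :=
    Measure.isProbabilityMeasure_map hmeas.aemeasurable
  have hmax1 := le_max_left (18.96 * E) (227.5 * e)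
  have hmax2 := le_max_right (18.96 * E) (227.5 * e)
  by_cases hE1 : E ≤ 1 / 18.96
  · by_cases he1 : e ≤ 1 / 227.5
    · obtain ⟨G, hG, hD⟩ := h.card_nbhd_le
      have hβ := h.sum_integral_normTerm_le hp2 hν hK hn hV (r := p) (by linarith) le_rfl
      have hβ3 := h.sum_integral_normTerm_le hp2 hν hK hn hV (r := 3) (by norm_num) hp
      rw [volScale, ← hEp] at hβ
      rw [volScale, he3] at hβ3
      have hβ3' : (4 * ((m : ℝ) + 1) * n) ^ 2 * ∑ v, ∫ ω, |normTerm μ t X v ω| ^ (3 : ℝ) ∂μ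
          ≤ 8 * e := by
        convert hβ3 using 2
        · rw [← Real.rpow_natCast]; norm_num
        · rw [show (3 : ℝ) = (3 : ℕ) by norm_num, Real.rpow_natCast]; norm_num
      have h1 := kolmogorovDist_sum_le_bootstrap hG (measurable_normTerm h.measurable) hp
        (h.memLp_normTerm hp2 hn) (h.integral_normTerm hp2 hn)
        (h.integral_sum_normTerm_sq hp2 hn hV0) (by positivity) hD hE0 hE1 he0 he1 hβ hβ3'
      have h2 := bias_scale_le hw (h.volScale_pos hp2 hν hK hn) hn' hp2 hE0
        (hE1.trans_lt (by norm_num)) (h.one_le_mul_volScale_sq hp2 hν hK hn hV) hEp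
      have h3 := h.kolmogorovDist_le_add hp2 hν hK hn hV
      -- `184 / 227.5 + 2.86 / 18.96 < 1`
      have h4 : 184 * e ≤ 184 / 227.5 * max (18.96 * E) (227.5 * e) := by linarith
      have h5 : 2.86 * E ≤ 2.86 / 18.96 * max (18.96 * E) (227.5 * e) := by linarith
      have h6 : 0 ≤ max (18.96 * E) (227.5 * e) := le_trans (by positivity) hmax1
      norm_num at h4 h5
      linarith
    · refine (kolmogorovDist_le_one _ _).trans (le_trans ?_ hmax2)
      rw [not_le, div_lt_iff₀ (by norm_num)] at he1
      linarith
  · refine (kolmogorovDist_le_one _ _).trans (le_trans ?_ hmax1)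
    rw [not_le, div_lt_iff₀ (by norm_num)] at hE1
    linarith

end Bounds

/-! ### The central limit theorem -/

section WeakConvergence

/-- Convergence in Kolmogorov distance implies weak convergence: the half-open intervals form a
π-system containing arbitrarily small neighbourhoods of every point. -/
lemma tendsto_of_tendsto_kolmogorovDist {P : ℕ → ProbabilityMeasure ℝ} {Q : ProbabilityMeasure ℝ}
    (h : Tendsto (fun n => kolmogorovDist (P n : Measure ℝ) (Q : Measure ℝ)) atTop (𝓝 0)) :
    Tendsto P atTop (𝓝 Q) := by
  have hIic : ∀ x, Tendsto (fun n => (P n : Measure ℝ).real (Set.Iic x)) atTop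
      (𝓝 ((Q : Measure ℝ).real (Set.Iic x))) := fun x => by
    rw [tendsto_iff_dist_tendsto_zero]
    exact squeeze_zero (fun _ => dist_nonneg)
      (fun n => abs_measureReal_Iic_sub_le (P n : Measure ℝ) (Q : Measure ℝ) x) h
  refine (isPiSystem_Ioc (id : ℝ → ℝ) id).tendsto_probabilityMeasure_of_tendsto_of_mem
    ?_ ?_ ?_
  · rintro s ⟨a, b, -, rfl⟩
    exact measurableSet_Ioc
  · intro u hu x hx
    obtain ⟨ε, hε, hεu⟩ := Metric.isOpen_iff.1 hu x hx
    refine ⟨Set.Ioc (x - ε / 2) (x + ε / 2), ⟨x - ε / 2, x + ε / 2, by simp; linarith, rfl⟩,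
      Ioc_mem_nhds (by linarith) (by linarith), fun y hy => hεu ?_⟩
    rw [Metric.mem_ball, Real.dist_eq, abs_lt]
    constructor <;> linarith [hy.1, hy.2]
  · rintro s ⟨a, b, hab, rfl⟩
    simp only [id] at hab ⊢
    rw [← NNReal.tendsto_coe]
    have h1 : ∀ R : ProbabilityMeasure ℝ, ((R (Set.Ioc a b) : NNReal) : ℝ)
        = (R : Measure ℝ).real (Set.Iic b) - (R : Measure ℝ).real (Set.Iic a) := fun R => by
      rw [← measureReal_Ioc_eq_sub _ hab.le]; rfl
    simp only [h1]
    exact (hIic b).sub (hIic a)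

end WeakConvergence

section Rates

/-- The rate tends to zero when the degrees are `o (n ^ ((p - 2) / (2 * p - 2)))`. -/
lemma tendsto_rate {p K : ℝ} (hp : 2 < p) (hK : 0 < K) {a T : ℕ → ℝ} {m : ℕ → ℕ}
    (ha : ∀ n, 0 ≤ a n) (hT : ∀ᶠ n in atTop, 0 ≤ T n) (hab : IsBoundedUnder (· ≤ ·) atTop a)
    (hTb : IsBoundedUnder (· ≤ ·) atTop T)
    (hm : (fun n : ℕ => (m n : ℝ) + 1) =o[atTop]
      (fun n : ℕ => (n : ℝ) ^ ((p - 2) / (2 * p - 2)))) :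
    Tendsto (fun n : ℕ => (a n / K) ^ (p / (p + 1)) * T n ^ (1 / (p + 1))
      * (4 * ((m n : ℝ) + 1)) ^ ((p - 1) / (p + 1))
      * (n : ℝ) ^ (-((p - 2) / (2 * (p + 1))))) atTop (𝓝 0) := by
  obtain ⟨A, hA⟩ := hab.eventually_le
  obtain ⟨B, hB⟩ := hTb.eventually_le
  have hθ : 0 < (p - 1) / (p + 1) := div_pos (by linarith) (by linarith)
  have h1 := hm.tendsto_div_nhds_zero.rpow_const (p := (p - 1) / (p + 1)) (Or.inr hθ.le)
  rw [Real.zero_rpow hθ.ne'] at h1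
  have h2 := h1.const_mul ((A / K) ^ (p / (p + 1)) * B ^ (1 / (p + 1)) * 4 ^ ((p - 1) / (p + 1)))
  rw [mul_zero] at h2
  refine squeeze_zero' ?_ ?_ h2
  · filter_upwards [hT] with n hn
    have := ha n
    positivity
  · filter_upwards [hT, hA, hB, eventually_gt_atTop 0] with n hn hnA hnB hn0
    have hn' : (0 : ℝ) < n := by exact_mod_cast hn0
    have ha0 := ha n
    have e1 : ((n : ℝ) ^ ((p - 2) / (2 * p - 2))) ^ ((p - 1) / (p + 1))
        = (n : ℝ) ^ ((p - 2) / (2 * (p + 1))) := by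
      rw [← Real.rpow_mul hn'.le]
      congr 1
      have h3 : p - 1 ≠ 0 := by linarith
      have h4 : p + 1 ≠ 0 := by linarith
      rw [show 2 * p - 2 = 2 * (p - 1) by ring]
      field_simp
    rw [Real.div_rpow (x := (m n : ℝ) + 1) (by positivity) (by positivity), e1,
      Real.mul_rpow (by norm_num)
      (by positivity), Real.rpow_neg hn'.le]
    have hp0 : 0 ≤ p / (p + 1) := by positivity
    have hp1 : 0 ≤ 1 / (p + 1) := by positivity
    have i1 : (a n / K) ^ (p / (p + 1)) ≤ (A / K) ^ (p / (p + 1)) :=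
      Real.rpow_le_rpow (by positivity) (by gcongr) hp0
    have i2 : T n ^ (1 / (p + 1)) ≤ B ^ (1 / (p + 1)) := Real.rpow_le_rpow hn hnB hp1
    have i3 := mul_le_mul i1 i2 (by positivity) (le_trans (by positivity) i1)
    have i4 := mul_le_mul_of_nonneg_right i3 (show 0 ≤ (4 : ℝ) ^ ((p - 1) / (p + 1))
      * (((m n : ℝ) + 1) ^ ((p - 1) / (p + 1)) / (n : ℝ) ^ ((p - 2) / (2 * (p + 1)))) by
        positivity)
    refine le_trans (le_of_eq ?_) (i4.trans (le_of_eq ?_)) <;> ring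

/-- The third-moment term tends to zero when the degrees are `o (n ^ (1 / 4))`. -/
lemma tendsto_cubic_rate {p K : ℝ} (hp : 0 < p) (hK : 0 < K) {a T : ℕ → ℝ} {m : ℕ → ℕ}
    (ha : ∀ n, 0 ≤ a n) (hT : ∀ᶠ n in atTop, 0 ≤ T n) (hab : IsBoundedUnder (· ≤ ·) atTop a)
    (hTb : IsBoundedUnder (· ≤ ·) atTop T)
    (hm : (fun n : ℕ => (m n : ℝ) + 1) =o[atTop] (fun n : ℕ => (n : ℝ) ^ (1 / 4 : ℝ))) :
    Tendsto (fun n : ℕ => (a n / K) ^ 3 * T n ^ (3 / p)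
      * ((4 * ((m n : ℝ) + 1)) ^ 2 / √(n : ℝ))) atTop (𝓝 0) := by
  obtain ⟨A, hA⟩ := hab.eventually_le
  obtain ⟨B, hB⟩ := hTb.eventually_le
  have h1 := hm.tendsto_div_nhds_zero.pow 2
  have h2 := h1.const_mul ((A / K) ^ 3 * B ^ (3 / p) * 16)
  rw [zero_pow two_ne_zero, mul_zero] at h2
  refine squeeze_zero' ?_ ?_ h2
  · filter_upwards [hT] with n hn
    have := ha n
    positivity
  · filter_upwards [hT, hA, hB, eventually_gt_atTop 0] with n hn hnA hnB hn0
    have hn' : (0 : ℝ) < n := by exact_mod_cast hn0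
    have ha0 := ha n
    have e1 : ((n : ℝ) ^ (1 / 4 : ℝ)) ^ 2 = √(n : ℝ) := by
      rw [← Real.rpow_natCast, ← Real.rpow_mul hn'.le, Real.sqrt_eq_rpow]; norm_num
    rw [div_pow ((m n : ℝ) + 1), e1, mul_pow]
    have i1 : (a n / K) ^ 3 ≤ (A / K) ^ 3 := by gcongr
    have i2 : T n ^ (3 / p) ≤ B ^ (3 / p) := Real.rpow_le_rpow hn hnB (by positivity)
    have i3 := mul_le_mul i1 i2 (by positivity) (le_trans (by positivity) i1)
    have i4 := mul_le_mul_of_nonneg_right i3 (show 0 ≤ 16 * (((m n : ℝ) + 1) ^ 2 / √(n : ℝ)) by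
        positivity)
    refine le_trans (le_of_eq ?_) (i4.trans (le_of_eq ?_)) <;> ring

/-- For `p ≥ 3` the condition with exponent `1 / 4` is the stronger one. -/
lemma isLittleO_rpow_of_quarter {p : ℝ} (hp : 3 ≤ p) {m : ℕ → ℕ}
    (hm : (fun n : ℕ => (m n : ℝ) + 1) =o[atTop] (fun n : ℕ => (n : ℝ) ^ (1 / 4 : ℝ))) :
    (fun n : ℕ => (m n : ℝ) + 1) =o[atTop]
      (fun n : ℕ => (n : ℝ) ^ ((p - 2) / (2 * p - 2))) := by
  refine hm.trans_isBigO (IsBigO.of_bound 1 ?_)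
  filter_upwards [eventually_ge_atTop 1] with n hn
  have hn' : (1 : ℝ) ≤ n := by exact_mod_cast hn
  rw [one_mul, Real.norm_of_nonneg (by positivity), Real.norm_of_nonneg (by positivity)]
  refine Real.rpow_le_rpow_of_exponent_le hn' ?_
  rw [div_le_div_iff₀ (by norm_num) (by linarith)]
  linarith

lemma IsReturnModel.finalTime_nonneg {Ω : Type*} [MeasurableSpace Ω] {μ : Measure Ω} {n : ℕ}
    {ν δ : ℝ} {t : Fin (n + 1) → ℝ} {X : Fin n → Ω → ℝ} {m : ℕ}
    (h : IsReturnModel μ ν δ t X m) : 0 ≤ finalTime t := by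
  rw [← h.time_zero]
  exact h.time_strictMono.monotone (Fin.zero_le _)

end Rates

end

theorem mainTheorem9 (ν δ δ' K : ℝ) (hν : 0 < ν) (hδ : 4 < δ) (hδ' : δ' = δ / 2) (hK : 0 < K) :
    -- the bounds for a fixed number `n` of returns
    (∀ (Ω : Type*) [MeasurableSpace Ω] (μ : Measure Ω) [IsProbabilityMeasure μ]
        (n : ℕ) (t : Fin (n + 1) → ℝ) (X : Fin n → Ω → ℝ) (m : ℕ),
        1 ≤ n →
        IsReturnModel μ ν δ t X m →
        K ^ 2 / n ≤ Var[volEstimator t X; μ] →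
        (δ < 6 →
          kolmogorovDist (μ.map (normalizedVolError μ ν t X)) (gaussianReal 0 1) ≤
            8.015 * (n / (K * finalTime t)) ^ (δ' / (δ' + 1))
              * momentFunctional μ δ t X ^ (1 / (δ' + 1))
              * (4 * ((m : ℝ) + 1)) ^ ((δ' - 1) / (δ' + 1))
              * (n : ℝ) ^ (-((δ' - 2) / (2 * (δ' + 1))))) ∧
        (6 ≤ δ →
          kolmogorovDist (μ.map (normalizedVolError μ ν t X)) (gaussianReal 0 1) ≤
            max
              (18.96 * (n / (K * finalTime t)) ^ (δ' / (δ' + 1))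
                * momentFunctional μ δ t X ^ (1 / (δ' + 1))
                * (4 * ((m : ℝ) + 1)) ^ ((δ' - 1) / (δ' + 1))
                * (n : ℝ) ^ (-((δ' - 2) / (2 * (δ' + 1)))))
              (227.5 * (n / (K * finalTime t)) ^ 3
                * momentFunctional μ δ t X ^ (3 / δ')
                * ((4 * ((m : ℝ) + 1)) ^ 2 / √(n : ℝ))))) ∧
    -- the central limit theorem, for one such model for every `n`
    (∀ (Ω : ℕ → Type*) [∀ n, MeasurableSpace (Ω n)] (μ : (n : ℕ) → Measure (Ω n))
        [∀ n, IsProbabilityMeasure (μ n)]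
        (t : (n : ℕ) → Fin (n + 1) → ℝ) (X : (n : ℕ) → Fin n → Ω n → ℝ) (m : ℕ → ℕ),
        (∀ n, IsReturnModel (μ n) ν δ (t n) (X n) (m n)) →
        (∀ᶠ n : ℕ in atTop, K ^ 2 / n ≤ Var[volEstimator (t n) (X n); μ n]) →
        IsBoundedUnder (· ≤ ·) atTop (fun n : ℕ => momentFunctional (μ n) δ (t n) (X n)) →
        IsBoundedUnder (· ≤ ·) atTop (fun n : ℕ => (n : ℝ) / finalTime (t n)) →
        ((δ < 6 ∧ (fun n : ℕ => (m n : ℝ) + 1) =o[atTop]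
            (fun n : ℕ => (n : ℝ) ^ ((δ' - 2) / (2 * δ' - 2)))) ∨
          (6 ≤ δ ∧ (fun n : ℕ => (m n : ℝ) + 1) =o[atTop]
            (fun n : ℕ => (n : ℝ) ^ (1 / 4 : ℝ)))) →
        TendstoInDistribution (fun n => normalizedVolError (μ n) ν (t n) (X n)) atTop
          (id : ℝ → ℝ) μ (gaussianReal 0 1)) := by

  have hδ2 : δ = 2 * δ' := by linarith
  subst hδ2
  clear hδ'
  have hp : 2 < δ' := by linarith
  refine ⟨fun Ω _ μ _ n t X m hn h hV => ⟨fun h6 => ?_, fun h6 => ?_⟩,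
    fun Ω _ μ _ t X m h hV hTb htb hm => ?_⟩
  · refine (h.kolmogorovDist_le hp (by linarith) hν hK (by omega) hV).trans (le_of_eq ?_)
    ring
  · refine (h.kolmogorovDist_le_max (by linarith) hν hK (by omega) hV).trans (le_of_eq ?_)
    congr 1 <;> ring
  · have hmeas : ∀ n, Measurable (normalizedVolError (μ n) ν (t n) (X n)) := fun n =>
      ((measurable_volEstimator (h n).measurable).sub_const _).div_const _
    have ha : ∀ n : ℕ, 0 ≤ (n : ℝ) / finalTime (t n) := fun n =>
      div_nonneg (Nat.cast_nonneg n) (h n).finalTime_nonneg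
    have hT : ∀ᶠ n in atTop, 0 ≤ momentFunctional (μ n) (2 * δ') (t n) (X n) := by
      filter_upwards [eventually_gt_atTop 0] with n hn
      exact ((h n).momentFunctional_pos hp hν hn.ne').le
    have hdiv : ∀ n : ℕ, (n : ℝ) / (K * finalTime (t n)) = n / finalTime (t n) / K := fun n => by
      rw [mul_comm, div_div]
    have hkol : Tendsto (fun n => kolmogorovDist
        ((μ n).map (normalizedVolError (μ n) ν (t n) (X n))) (gaussianReal 0 1)) atTop (𝓝 0) := by
      rcases hm with ⟨h6, hm⟩ | ⟨h6, hm⟩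
      · have hlim := (tendsto_rate hp hK ha hT htb hTb hm).const_mul 8.015
        rw [mul_zero] at hlim
        refine squeeze_zero' (Eventually.of_forall fun n => kolmogorovDist_nonneg _ _) ?_ hlim
        filter_upwards [hV, eventually_gt_atTop 0] with n hVn hn
        have := (h n).kolmogorovDist_le hp (by linarith) hν hK hn.ne' hVn
        rwa [hdiv] at this
      · have h3 : 3 ≤ δ' := by linarith
        have hlim1 := (tendsto_rate hp hK ha hT htb hTb
          (isLittleO_rpow_of_quarter h3 hm)).const_mul 18.96
        have hlim2 := (tendsto_cubic_rate (p := δ') (by linarith) hK ha hT htb hTb hm).const_mul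
          227.5
        have hlim := hlim1.max hlim2
        rw [mul_zero, mul_zero, max_self] at hlim
        refine squeeze_zero' (Eventually.of_forall fun n => kolmogorovDist_nonneg _ _) ?_ hlim
        filter_upwards [hV, eventually_gt_atTop 0] with n hVn hn
        have := (h n).kolmogorovDist_le_max h3 hν hK hn.ne' hVn
        rwa [hdiv] at this
    exact
      { forall_aemeasurable := fun n => (hmeas n).aemeasurable
        aemeasurable_limit := aemeasurable_id
        tendsto := tendsto_of_tendsto_kolmogorovDist (by
          simpa only [ProbabilityMeasure.coe_mk, Measure.map_id] using hkol) }
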